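/- Let $\gamma=(\gamma_{ij})$ be a real symmetric $3\times3$ matrix function on $\mathbb R^3$ with $\gamma_{ij}\in L^\infty(\mathbb R^3)$ and $\gamma(x)\xi\cdot\xi\ge c_0|\xi|^2$ for a.e. $x$ and all $\xi\in\mathbb R^3$, with a constant $c_0>0$; put $L_\gamma u=\operatorname{div}(\gamma\nabla u)$. Let $D\subset\mathbb R^3$ be a nonempty bounded set with $\mathbb R^3\setminus D$ connected, such that $\gamma=I_3$ in $\mathbb R^3\setminus D$ and one of the following holds: $(\mathrm M)_+$: there is $c>1$ with $\gamma(x)\ge cI_3$ for $x\in D$; or $(\mathrm M)_-$: there is $c<1$ with $\gamma(x)\le cI_3$ for $x\in D$. Let $B\subset\mathbb R^3$ be a nonempty open set with $\overline B\cap\overline D=\emptyset$, and let $f\in L^2(\mathbb R^3)$ be real valued with $\operatorname{supp}f\subset\overline B$ such that, for some constant $c_1>0$, either $f\ge c_1$ on $B$ or $-f\ge c_1$ on $B$. (Pointwise relations between $L^\infty$ or $L^2$ functions are understood almost everywhere.) Let $T>0$ and let $u$ be the weak solution of $$(\partial_t^2-L_\gamma)u=0\ \text{ in }(0,T)\times\mathbb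 R^3,\qquad u(0,\cdot)=0,\quad \partial_tu(0,\cdot)=f,$$ that is, $u\in L^2(0,T;H^1(\mathbb R^3))$, $\partial_tu\in L^2(0,T;L^2(\mathbb R^3))$, $\partial_t^2u\in L^2(0,T;(H^1(\mathbb R^3))')$, $\langle\partial_t^2u(t,\cdot),\phi\rangle+\int_{\mathbb R^3}\gamma\nabla_xu(t,x)\cdot\nabla\phi(x)\,dx=0$ for a.e. $t\in(0,T)$ and all $\phi\in H^1(\mathbb R^3)$, and the initial values are attained by the continuous representatives $u\in C([0,T];L^2(\mathbb R^3))$ and $\partial_tu\in C([0,T];(H^1(\mathbb R^3))')$. For $\tau\ge1$ let $v(\cdot;\tau)\in H^1(\mathbb R^3)$ be the weak solution of $(\Delta-\tau^2)v+f=0$ in $\mathbb R^3$, put $w(x;\tau)=\int_0^Te^{-\tau t}u(t,x)\,dt$, and define the indicator function $$I_\tau=\int_{\mathbb R^3}f(x)\,\bigl(w(x;\tau)-v(x;\tau)\bigr)\,dx .$$ Put $\operatorname{dist}(D,B)=\inf_{x\in D,\,y\in B}|x-y|$. A set $A\subset\mathbb R^3$ satisfies condition (C) if for every $x\in\partial A$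 there are a unit vector $n$, $h>0$ and $\theta\in(0,\pi]$ such that $\{y:|y-x|\le h,\ (y-x)\cdot n\ge|y-x|\cos\theta\}\setminus\{x\}\subset A$. Suppose that either (a) $D$ has $C^1$ boundary and $B$ satisfies (C), or (b) $D$ and $B$ satisfy (C) and $B$ is convex. Then: (i) if $T<2\operatorname{dist}(D,B)$, then $\lim_{\tau\to\infty}e^{\tau T}I_\tau=0$; (ii) if $T>2\operatorname{dist}(D,B)$, then $\lim_{\tau\to\infty}e^{\tau T}I_\tau=-\infty$ under $(\mathrm M)_+$, and $\lim_{\tau\to\infty}e^{\tau T}I_\tau=+\infty$ under $(\mathrm M)_-$; (iii) if $T>2\operatorname{dist}(D,B)$, then $\displaystyle\lim_{\tau\to\infty}\frac1\tau\log|I_\tau|=-2\operatorname{dist}(D,B)$. -/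

import Mathlib

open MeasureTheory Filter Topology Set
open scoped ContDiff ENNReal Matrix

noncomputable section

namespace Enclosure

/-- The Euclidean space `ℝ³`. -/
abbrev E3 : Type := EuclideanSpace ℝ (Fin 3)

/-- `L²(ℝ³)`, real valued. -/
abbrev L2 : Type := Lp ℝ 2 (volume : Measure E3)

/-- `L²(ℝ³; ℝ³)`. -/
abbrev L2Vec : Type := Lp E3 2 (volume : Measure E3)

/-! ### The Sobolev space `H¹(ℝ³)` -/

/-- `g ∈ L²(ℝ³; ℝ³)` is the weak gradient of `u ∈ L²(ℝ³)`. -/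
def IsWeakGradient (u : L2) (g : L2Vec) : Prop :=
  ∀ φ : E3 → ℝ, ContDiff ℝ ∞ φ → HasCompactSupport φ → ∀ i : Fin 3,
    ∫ x, u x * fderiv ℝ φ x (EuclideanSpace.single i 1) = - ∫ x, g x i * φ x

theorem memLp_test {φ : E3 → ℝ} (h : ContDiff ℝ ∞ φ) (hc : HasCompactSupport φ) :
    MemLp φ 2 (volume : Measure E3) :=
  h.continuous.memLp_of_hasCompactSupport hc

theorem memLp_test_deriv {φ : E3 → ℝ} (h : ContDiff ℝ ∞ φ) (hc : HasCompactSupport φ) (e : E3) :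
    MemLp (fun x => fderiv ℝ φ x e) 2 (volume : Measure E3) := by
  refine Continuous.memLp_of_hasCompactSupport ?_ ?_
  · exact (h.continuous_fderiv (by simp)).clm_apply continuous_const
  · exact hc.fderiv_apply (𝕜 := ℝ) e

theorem memLp_coord (g : L2Vec) (i : Fin 3) :
    MemLp (fun x => g x i) 2 (volume : Measure E3) :=
  (EuclideanSpace.proj i : E3 →L[ℝ] ℝ).comp_memLp' (Lp.memLp g)

theorem IsWeakGradient.add {u₁ u₂ : L2} {g₁ g₂ : L2Vec} (h₁ : IsWeakGradient u₁ g₁)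
    (h₂ : IsWeakGradient u₂ g₂) : IsWeakGradient (u₁ + u₂) (g₁ + g₂) := by
  intro φ hφ hc i
  have e₁ : ∫ x, (u₁ + u₂ : L2) x * fderiv ℝ φ x (EuclideanSpace.single i 1)
      = ∫ x, (u₁ x * fderiv ℝ φ x (EuclideanSpace.single i 1)
        + u₂ x * fderiv ℝ φ x (EuclideanSpace.single i 1)) := by
    refine integral_congr_ae ?_
    filter_upwards [Lp.coeFn_add u₁ u₂] with x hx
    rw [hx, Pi.add_apply, add_mul]
  have e₂ : ∫ x, (g₁ + g₂ : L2Vec) x i * φ x = ∫ x, (g₁ x i * φ x + g₂ x i * φ x) := by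
    refine integral_congr_ae ?_
    filter_upwards [Lp.coeFn_add g₁ g₂] with x hx
    rw [hx, Pi.add_apply, PiLp.add_apply, add_mul]
  rw [e₁, e₂, integral_add, integral_add, h₁ φ hφ hc i, h₂ φ hφ hc i, neg_add]
  · exact (memLp_coord g₁ i).integrable_mul (memLp_test hφ hc)
  · exact (memLp_coord g₂ i).integrable_mul (memLp_test hφ hc)
  · exact (Lp.memLp u₁).integrable_mul (memLp_test_deriv hφ hc _)
  · exact (Lp.memLp u₂).integrable_mul (memLp_test_deriv hφ hc _)

theorem IsWeakGradient.smul (c : ℝ) {u : L2} {g : L2Vec} (h : IsWeakGradient u g) :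
    IsWeakGradient (c • u) (c • g) := by
  intro φ hφ hc i
  have e₁ : ∫ x, (c • u : L2) x * fderiv ℝ φ x (EuclideanSpace.single i 1)
      = ∫ x, c * (u x * fderiv ℝ φ x (EuclideanSpace.single i 1)) := by
    refine integral_congr_ae ?_
    filter_upwards [Lp.coeFn_smul c u] with x hx
    rw [hx, Pi.smul_apply, smul_eq_mul, mul_assoc]
  have e₂ : ∫ x, (c • g : L2Vec) x i * φ x = ∫ x, c * (g x i * φ x) := by
    refine integral_congr_ae ?_
    filter_upwards [Lp.coeFn_smul c g] with x hx
    rw [hx, Pi.smul_apply, PiLp.smul_apply, smul_eq_mul, mul_assoc]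
  rw [e₁, e₂, integral_const_mul, integral_const_mul, h φ hφ hc i, mul_neg]

/-- The pairs `(u, ∇u)` of an `L²` function and its weak gradient in `L²`, normed by
`‖u‖² = ‖u‖²_{L²} + ‖∇u‖²_{L²}`. The second component is determined by the first. -/
def h1Submodule : Submodule ℝ (WithLp 2 (L2 × L2Vec)) where
  carrier := {p | IsWeakGradient p.fst p.snd}
  add_mem' h₁ h₂ := IsWeakGradient.add h₁ h₂
  zero_mem' := by
    have h : IsWeakGradient (0 : L2) (0 : L2Vec) := by
      intro φ _ _ i
      simp
    exact h
  smul_mem' c _ h := IsWeakGradient.smul c h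

/-- The Sobolev space `H¹(ℝ³)`. -/
def H1 : Type := h1Submodule

instance : NormedAddCommGroup H1 := inferInstanceAs (NormedAddCommGroup h1Submodule)

instance : InnerProductSpace ℝ H1 := inferInstanceAs (InnerProductSpace ℝ h1Submodule)

/-- The inclusion `H¹(ℝ³) ⊂ L²(ℝ³)`. -/
def toL2 : H1 →L[ℝ] L2 := (WithLp.fstL 2 ℝ L2 L2Vec).comp h1Submodule.subtypeL

/-- The gradient `∇ : H¹(ℝ³) → L²(ℝ³; ℝ³)`. -/
def grad : H1 →L[ℝ] L2Vec := (WithLp.sndL 2 ℝ L2 L2Vec).comp h1Submodule.subtypeL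

/-- The dual space `(H¹(ℝ³))'`. -/
abbrev H1Dual : Type := H1 →L[ℝ] ℝ

/-- The inclusion `L²(ℝ³) ⊂ (H¹(ℝ³))'`, `g ↦ (φ ↦ ∫ g φ dx)`. -/
def toH1Dual (g : L2) : H1Dual := (innerSL ℝ g).comp toL2

/-! ### Coefficients, the wave equation and the reduced equation -/

/-- `γ` is a symmetric matrix function with `L^∞` entries, and `γ(x) ≥ c₀` for almost every `x`
with a constant `c₀ > 0`. -/
structure IsCoefficient (γ : E3 → Matrix (Fin 3) (Fin 3) ℝ) : Prop where
  memLp : ∀ i j, MemLp (fun x => γ x i j) ∞ (volume : Measure E3)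
  symm : ∀ᵐ x : E3, (γ x).IsSymm
  elliptic : ∃ c₀ : ℝ, 0 < c₀ ∧ ∀ᵐ x : E3, ∀ ξ : E3, c₀ * ‖ξ‖ ^ 2 ≤ (γ x *ᵥ ξ.ofLp) ⬝ᵥ ξ.ofLp

/-- The form `∫ γ(x) ∇u · ∇φ dx`, the weak form of `-L_γ = -div (γ ∇ ·)`. -/
def form (γ : E3 → Matrix (Fin 3) (Fin 3) ℝ) (u φ : H1) : ℝ :=
  ∫ x, (γ x *ᵥ (grad u x).ofLp) ⬝ᵥ (grad φ x).ofLp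

/-- `g'` is the weak (distributional) derivative of the `X`-valued function `g` on `(0, T)`. -/
def IsWeakTimeDeriv {X : Type*} [NormedAddCommGroup X] [NormedSpace ℝ X] (T : ℝ)
    (g g' : ℝ → X) : Prop :=
  ∀ ψ : ℝ → ℝ, ContDiff ℝ ∞ ψ → HasCompactSupport ψ → tsupport ψ ⊆ Ioo 0 T →
    ∫ t in Ioo 0 T, deriv ψ t • g t = - ∫ t in Ioo 0 T, ψ t • g' t

/-- The representative of `g` on `(0, T)` that is continuous on `[0, T]` has the value `a` at
time `0`. -/
def HasInitialValue {X : Type*} [NormedAddCommGroup X] (T : ℝ) (g : ℝ → X) (a : X) : Prop :=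
  ∃ G : ℝ → X, ContinuousOn G (Icc 0 T) ∧
    (∀ᵐ t ∂(volume.restrict (Ioo 0 T)), G t = g t) ∧ G 0 = a

/-- `u` is a weak solution of `(∂_t² - L_γ) u = 0` in `(0, T) × ℝ³`, `u(0) = 0`, `∂_t u(0) = f`:
`u ∈ L²(0, T; H¹)`, `∂_t u ∈ L²(0, T; L²)`, `∂_t² u ∈ L²(0, T; (H¹)')`, the equation holds in
`(H¹)'` for almost every `t`, and the initial values are attained by the continuous
representatives of `u` in `L²` and of `∂_t u` in `(H¹)'`. -/
def IsWeakWaveSolution (γ : E3 → Matrix (Fin 3) (Fin 3) ℝ) (T : ℝ) (f : L2)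
    (u : ℝ → H1) : Prop :=
  ∃ (ut : ℝ → L2) (utt : ℝ → H1Dual),
    MemLp u 2 (volume.restrict (Ioo 0 T)) ∧
    MemLp ut 2 (volume.restrict (Ioo 0 T)) ∧
    MemLp utt 2 (volume.restrict (Ioo 0 T)) ∧
    IsWeakTimeDeriv T (fun t => toL2 (u t)) ut ∧
    IsWeakTimeDeriv T (fun t => toH1Dual (ut t)) utt ∧
    (∀ᵐ t ∂(volume.restrict (Ioo 0 T)), ∀ φ : H1, utt t φ + form γ (u t) φ = 0) ∧
    HasInitialValue T (fun t => toL2 (u t)) 0 ∧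
    HasInitialValue T (fun t => toH1Dual (ut t)) (toH1Dual f)

/-- `v ∈ H¹(ℝ³)` is the weak solution of `(L_γ - τ²) v + f = 0` in `ℝ³`. -/
def IsReducedSolution (γ : E3 → Matrix (Fin 3) (Fin 3) ℝ) (τ : ℝ) (f : L2) (v : H1) : Prop :=
  ∀ φ : H1, form γ v φ + τ ^ 2 * ∫ x, toL2 v x * toL2 φ x = ∫ x, f x * toL2 φ x

/-- `w(·; τ) = ∫₀ᵀ e^{-τ t} u(t, ·) dt`, as an element of `L²(ℝ³)`. -/
def truncLaplace (T : ℝ) (u : ℝ → H1) (τ : ℝ) : L2 :=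
  ∫ t in (0 : ℝ)..T, Real.exp (-τ * t) • toL2 (u t)

/-- The indicator function `I_τ = ∫ f(x) (w(x; τ) - v(x; τ)) dx`. -/
def indicatorFn (T : ℝ) (f : L2) (u : ℝ → H1) (v : ℝ → H1) (τ : ℝ) : ℝ :=
  ∫ x, f x * (truncLaplace T u τ x - toL2 (v τ) x)

/-! ### Inclusions and emission sets -/

/-- `(M)₊`: `inf_{x ∈ D} γ(x) > I₃`. -/
def MonotonePlus (γ : E3 → Matrix (Fin 3) (Fin 3) ℝ) (D : Set E3) : Prop :=
  ∃ c : ℝ, 1 < c ∧ ∀ᵐ x : E3, x ∈ D → ∀ ξ : E3, c * ‖ξ‖ ^ 2 ≤ (γ x *ᵥ ξ.ofLp) ⬝ᵥ ξ.ofLp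

/-- `(M)₋`: `sup_{x ∈ D} γ(x) < I₃`. -/
def MonotoneMinus (γ : E3 → Matrix (Fin 3) (Fin 3) ℝ) (D : Set E3) : Prop :=
  ∃ c : ℝ, c < 1 ∧ ∀ᵐ x : E3, x ∈ D → ∀ ξ : E3, (γ x *ᵥ ξ.ofLp) ⬝ᵥ ξ.ofLp ≤ c * ‖ξ‖ ^ 2

/-- The emission condition: `supp f ⊂ closure B`, and `f ≥ c₁` on `B` or `-f ≥ c₁` on `B` for some
constant `c₁ > 0`. -/
def EmissionCondition (B : Set E3) (f : L2) : Prop :=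
  (∀ᵐ x : E3, x ∉ closure B → f x = 0) ∧
  ∃ c₁ : ℝ, 0 < c₁ ∧ ((∀ᵐ x : E3, x ∈ B → c₁ ≤ f x) ∨ (∀ᵐ x : E3, x ∈ B → c₁ ≤ - f x))

/-- The cone with vertex `x`, direction `n`, radius `h` and opening angle `θ`. -/
def cone (x n : E3) (h θ : ℝ) : Set E3 :=
  {y | ‖y - x‖ ≤ h ∧ ‖y - x‖ * Real.cos θ ≤ inner ℝ (y - x) n}

/-- Condition (C). Opening angles are at most `π`; for larger `θ` the set `cone x n h θ` is no
cone of opening angle `θ` (it is a segment for `θ = 2π`). -/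
def ConeCondition (D : Set E3) : Prop :=
  ∀ x ∈ frontier D, ∃ (n : E3) (h θ : ℝ), ‖n‖ = 1 ∧ 0 < h ∧ 0 < θ ∧ θ ≤ Real.pi ∧
    cone x n h θ \ {x} ⊆ D

/-- `D` has `C¹` boundary: near each boundary point, `D` is, up to boundary points, the set
`{ρ < 0}` for a `C¹` function `ρ` with non-vanishing differential. (For open `D`, this is
`D = {ρ < 0}` near the boundary point.) -/
def HasC1Boundary (D : Set E3) : Prop :=
  ∀ x ∈ frontier D, ∃ (r : ℝ) (ρ : E3 → ℝ), 0 < r ∧ ContDiffOn ℝ 1 ρ (Metric.ball x r) ∧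
    (∀ y ∈ Metric.ball x r, fderiv ℝ ρ y ≠ 0) ∧
    ∀ y ∈ Metric.ball x r, (ρ y < 0 → y ∈ D) ∧ (0 < ρ y → y ∉ D)

/-- `dist(D, B) = inf_{x ∈ D, y ∈ B} |x - y|`. -/
def setDist (D B : Set E3) : ℝ := sInf {r : ℝ | ∃ x ∈ D, ∃ y ∈ B, r = dist x y}

end Enclosure

end

open Enclosure

noncomputable section

namespace Enclosure

/-! ### Basic facts on `H¹(ℝ³)` -/

/-! Integrating the wave equation against `e^{-τt}` over `(0,T)` shows that `w` solves the
stationary equation `(L_γ - τ²) w + f = e^{-τT}(∂_t u(T) + τ u(T))` weakly (`truncLaplace_spec`). So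
`w` and `v` solve equations which differ only in the coefficient on `D` and in a term of size
`e^{-τT}`. Testing both equations with `v` and `w` writes `∓I_τ` as a sum of squares plus a
pointwise quadratic expression in the gradients (`inner_sub_ge`, `inner_sub_ge_of_free`).

Consequently, up to an error `e^{-τT} K/τ`, the quantity `-I_τ` under `(M)₊`, respectively `I_τ`
under `(M)₋`, lies above a positive multiple of `∫_S |∇v|²` for every measurable `S ⊆ D`, while
`|I_τ|` always lies below a multiple of `∫ |∇v|²` over `closure D`. Both bounds come from
`exists_indicator_bound`, whose constant `k` may have either sign: positive `k` gives lower bounds,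
negative `k` upper ones.

It remains to show that the energy of the free solution `v` on `D` decays like `e^{-2τ dist(D,B)}`
to exponential order. The upper bound is Agmon's estimate with a weight `e^{-κ|x-x₀|}`, `κ` slightly
below `2τ`, on finitely many small balls covering `closure D` (`exists_energy_le_exp`). For the
lower bound the equation for `v` is tested with a cut-off Yukawa potential centred at a point `x₀`
of the interior of `D` that almost realises the distance (`exists_energy_lower_bound`). The source
side is at least a multiple of `e^{-τR}`, `R` close to `dist(D,B)`, since `f` has one sign. On the
other side, the cut-off produces one term near `x₀`, controlled by the local energy, and one beyond
radius `R + 1`, which is negligible.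

Regularity enters twice. The boundary condition on `D` makes its interior dense in `D`, so the
distance is approached from interior points. The cone condition on `B` makes `∂B` a null set, so
that `f` has one sign almost everywhere.

If `T < 2 dist(D,B)`, the energy is smaller than `e^{-τT}` and the error, carrying the extra factor
`1/τ`, still vanishes after multiplication by `e^{τT}`. If `T > 2 dist(D,B)`, the energy dominates
the error, which fixes the sign and the logarithmic rate of `I_τ`. -/

theorem integral_mul_eq_inner (f g : L2) : ∫ x, f x * g x = inner ℝ f g := by
  rw [L2.inner_def]
  refine integral_congr_ae (Eventually.of_forall fun x => ?_)
  simp [mul_comm]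

/-- The element of `H¹` given by a function and its weak gradient. -/
def H1.mk (u : L2) (g : L2Vec) (h : IsWeakGradient u g) : H1 :=
  ⟨WithLp.toLp 2 (u, g), h⟩

theorem isWeakGradient_grad (u : H1) : IsWeakGradient (toL2 u) (grad u) := u.2

theorem norm_sq_H1 (u : H1) : ‖u‖ ^ 2 = ‖toL2 u‖ ^ 2 + ‖grad u‖ ^ 2 :=
  WithLp.prod_norm_sq_eq_of_L2 (u.1 : WithLp 2 (L2 × L2Vec))

theorem integral_mul_toLp (u : L2) {ψ : E3 → ℝ} (hψ : MemLp ψ 2 (volume : Measure E3)) :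
    ∫ x, u x * ψ x = inner ℝ u (hψ.toLp ψ) := by
  rw [← integral_mul_eq_inner]
  refine integral_congr_ae ?_
  filter_upwards [hψ.coeFn_toLp] with x hx
  rw [hx]

theorem memLp_smul_single {ψ : E3 → ℝ} (hψ : MemLp ψ 2 (volume : Measure E3)) (i : Fin 3) :
    MemLp (fun x => ψ x • (EuclideanSpace.single i (1 : ℝ) : E3)) 2 (volume : Measure E3) :=
  ((ContinuousLinearMap.id ℝ ℝ).smulRight (EuclideanSpace.single i (1 : ℝ) : E3)).comp_memLp' hψ

theorem integral_coord_mul_toLp (g : L2Vec) {ψ : E3 → ℝ} (hψ : MemLp ψ 2 (volume : Measure E3))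
    (i : Fin 3) :
    ∫ x, g x i * ψ x = inner ℝ g ((memLp_smul_single hψ i).toLp _) := by
  rw [L2.inner_def]
  refine integral_congr_ae ?_
  filter_upwards [(memLp_smul_single hψ i).coeFn_toLp] with x hx
  rw [hx, inner_smul_right]
  simp [EuclideanSpace.inner_single_right, mul_comm]

/-- Each defining identity equates two inner products with fixed `L²` elements, hence two continuous
functionals. The resulting completeness of `H1` is needed for the Bochner integral of `u` in `H1`.
-/
theorem isClosed_h1Submodule : IsClosed (h1Submodule : Set (WithLp 2 (L2 × L2Vec))) := by
  have : (h1Submodule : Set (WithLp 2 (L2 × L2Vec))) =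
      ⋂ (φ : E3 → ℝ) (_ : ContDiff ℝ ∞ φ) (_ : HasCompactSupport φ) (i : Fin 3),
        {p | ∫ x, p.fst x * fderiv ℝ φ x (EuclideanSpace.single i 1)
          = - ∫ x, p.snd x i * φ x} := by
    ext p
    simp only [mem_iInter]
    rfl
  rw [this]
  refine isClosed_iInter fun φ => isClosed_iInter fun h => isClosed_iInter fun hc =>
    isClosed_iInter fun i => ?_
  simp only [integral_mul_toLp _ (memLp_test_deriv h hc _),
    integral_coord_mul_toLp _ (memLp_test h hc)]
  refine isClosed_eq ?_ ?_
  · exact ((WithLp.fstL 2 ℝ L2 L2Vec).continuous).inner continuous_const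
  · exact (((WithLp.sndL 2 ℝ L2 L2Vec).continuous).inner continuous_const).neg

instance : CompleteSpace H1 :=
  isClosed_h1Submodule.completeSpace_coe

/-! ### Smooth functions as elements and multipliers -/

theorem gradient_coord (m : E3 → ℝ) (x : E3) (i : Fin 3) :
    gradient m x i = fderiv ℝ m x (EuclideanSpace.single i 1) := by
  have h : inner ℝ (gradient m x) (EuclideanSpace.single i (1 : ℝ))
      = fderiv ℝ m x (EuclideanSpace.single i 1) := by
    rw [gradient, InnerProductSpace.toDual_symm_apply]
  rw [EuclideanSpace.inner_single_right] at h
  simpa using h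

theorem continuous_gradient {m : E3 → ℝ} (h : ContDiff ℝ ∞ m) : Continuous (gradient m) :=
  (InnerProductSpace.toDual ℝ E3).symm.continuous.comp (h.continuous_fderiv (by simp))

theorem memLp_gradient {φ : E3 → ℝ} (h : ContDiff ℝ ∞ φ) (hc : HasCompactSupport φ) :
    MemLp (gradient φ) 2 (volume : Measure E3) := by
  refine (continuous_gradient h).memLp_of_hasCompactSupport ?_
  exact (hc.fderiv (𝕜 := ℝ)).comp_left (map_zero (InnerProductSpace.toDual ℝ E3).symm)

theorem isWeakGradient_test {φ : E3 → ℝ} (h : ContDiff ℝ ∞ φ) (hc : HasCompactSupport φ) :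
    IsWeakGradient ((memLp_test h hc).toLp φ) ((memLp_gradient h hc).toLp _) := by
  intro ψ hψ hψc i
  have e₁ : ∫ x, (memLp_test h hc).toLp φ x * fderiv ℝ ψ x (EuclideanSpace.single i 1)
      = ∫ x, φ x * fderiv ℝ ψ x (EuclideanSpace.single i 1) := by
    refine integral_congr_ae ?_
    filter_upwards [(memLp_test h hc).coeFn_toLp] with x hx
    rw [hx]
  have e₂ : ∫ x, (memLp_gradient h hc).toLp _ x i * ψ x
      = ∫ x, fderiv ℝ φ x (EuclideanSpace.single i 1) * ψ x := by
    refine integral_congr_ae ?_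
    filter_upwards [(memLp_gradient h hc).coeFn_toLp] with x hx
    rw [hx, gradient_coord]
  rw [e₁, e₂]
  refine integral_mul_fderiv_eq_neg_fderiv_mul_of_integrable ?_ ?_ ?_ ?_ ?_
  · exact (memLp_test_deriv h hc _).integrable_mul (memLp_test hψ hψc)
  · exact (memLp_test h hc).integrable_mul (memLp_test_deriv hψ hψc _)
  · exact (memLp_test h hc).integrable_mul (memLp_test hψ hψc)
  · exact fun x _ => (h.differentiable (by simp)) x
  · exact fun x _ => (hψ.differentiable (by simp)) x

/-- A test function as an element of `H¹`. -/
def ofTest {φ : E3 → ℝ} (h : ContDiff ℝ ∞ φ) (hc : HasCompactSupport φ) : H1 :=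
  H1.mk _ _ (isWeakGradient_test h hc)

theorem toL2_ofTest {φ : E3 → ℝ} (h : ContDiff ℝ ∞ φ) (hc : HasCompactSupport φ) :
    toL2 (ofTest h hc) =ᵐ[volume] φ := (memLp_test h hc).coeFn_toLp

theorem grad_ofTest {φ : E3 → ℝ} (h : ContDiff ℝ ∞ φ) (hc : HasCompactSupport φ) :
    grad (ofTest h hc) =ᵐ[volume] gradient φ := (memLp_gradient h hc).coeFn_toLp

theorem memLp_mul_of_bounded {m : E3 → ℝ} (hm : Continuous m) {C : ℝ} (hC : ∀ x, |m x| ≤ C)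
    (u : L2) : MemLp (fun x => m x * u x) 2 (volume : Measure E3) := by
  refine MemLp.of_le_mul (c := C) (Lp.memLp u)
    (hm.aestronglyMeasurable.mul (Lp.memLp u).1) (Eventually.of_forall fun x => ?_)
  rw [norm_mul]
  exact mul_le_mul_of_nonneg_right (hC x) (norm_nonneg _)

theorem memLp_mul_gradient {m : E3 → ℝ} (hm : ContDiff ℝ ∞ m) {C C' : ℝ} (hC : ∀ x, |m x| ≤ C)
    (hC' : ∀ x, ‖gradient m x‖ ≤ C') (u : L2) (g : L2Vec) :
    MemLp (fun x => m x • g x + u x • gradient m x) 2 (volume : Measure E3) := by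
  refine MemLp.add ?_ ?_
  · refine MemLp.of_le_mul (c := C) (Lp.memLp g)
      (hm.continuous.aestronglyMeasurable.smul (Lp.memLp g).1) (Eventually.of_forall fun x => ?_)
    rw [norm_smul]
    exact mul_le_mul_of_nonneg_right (hC x) (norm_nonneg _)
  · refine MemLp.of_le_mul (c := C') (Lp.memLp u)
      ((Lp.memLp u).1.smul (continuous_gradient hm).aestronglyMeasurable)
      (Eventually.of_forall fun x => ?_)
    rw [norm_smul, mul_comm]
    exact mul_le_mul_of_nonneg_right (hC' x) (norm_nonneg _)

/-- The function `m φ` is again a test function, and `m ∂φ = ∂(m φ) - (∂m) φ`. The bounds on `m` and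
its gradient keep the product in `H¹`, so that `m v` is admissible in the reduced equation. -/
theorem isWeakGradient_mul {m : E3 → ℝ} (hm : ContDiff ℝ ∞ m) {C C' : ℝ} (hC : ∀ x, |m x| ≤ C)
    (hC' : ∀ x, ‖gradient m x‖ ≤ C') {u : L2} {g : L2Vec} (hug : IsWeakGradient u g) :
    IsWeakGradient ((memLp_mul_of_bounded hm.continuous hC u).toLp _)
      ((memLp_mul_gradient hm hC hC' u g).toLp _) := by
  intro φ hφ hc i
  set e : E3 := EuclideanSpace.single i 1
  have hmφ : ContDiff ℝ ∞ (fun x => m x * φ x) := hm.mul hφ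
  have hmc : HasCompactSupport (fun x => m x * φ x) := hc.mul_left
  have hdc : ContDiff ℝ ∞ (fun x => fderiv ℝ m x e) :=
    (hm.fderiv_right (m := ∞) (by simp)).clm_apply contDiff_const
  have hdφ : ContDiff ℝ ∞ (fun x => fderiv ℝ m x e * φ x) := hdc.mul hφ
  have hdφc : HasCompactSupport (fun x => fderiv ℝ m x e * φ x) := hc.mul_left
  have hd : ∀ x, fderiv ℝ (fun x => m x * φ x) x e
      = m x * fderiv ℝ φ x e + fderiv ℝ m x e * φ x := by
    intro x
    have := ((hm.differentiable (by simp) x).hasFDerivAt.mul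
      (hφ.differentiable (by simp) x).hasFDerivAt).fderiv
    erw [this]
    simp [mul_comm]
  have e₁ : ∫ x, (memLp_mul_of_bounded hm.continuous hC u).toLp _ x * fderiv ℝ φ x e
      = ∫ x, (u x * fderiv ℝ (fun x => m x * φ x) x e - u x * (fderiv ℝ m x e * φ x)) := by
    refine integral_congr_ae ?_
    filter_upwards [(memLp_mul_of_bounded hm.continuous hC u).coeFn_toLp] with x hx
    rw [hx, hd]
    ring
  have e₂ : ∫ x, (memLp_mul_gradient hm hC hC' u g).toLp _ x i * φ x
      = ∫ x, (g x i * (m x * φ x) + u x * (fderiv ℝ m x e * φ x)) := by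
    refine integral_congr_ae ?_
    filter_upwards [(memLp_mul_gradient hm hC hC' u g).coeFn_toLp] with x hx
    rw [hx, PiLp.add_apply, PiLp.smul_apply, PiLp.smul_apply, gradient_coord, smul_eq_mul,
      smul_eq_mul]
    ring
  rw [e₁, e₂, integral_sub, integral_add, hug _ hmφ hmc i]
  · ring
  · exact (memLp_coord g i).integrable_mul (memLp_test hmφ hmc)
  · exact (Lp.memLp u).integrable_mul (memLp_test hdφ hdφc)
  · exact (Lp.memLp u).integrable_mul (memLp_test_deriv hmφ hmc _)
  · exact (Lp.memLp u).integrable_mul (memLp_test hdφ hdφc)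

/-- The product of a smooth bounded function with bounded gradient and an element of `H¹`. -/
def mulSmooth {m : E3 → ℝ} (hm : ContDiff ℝ ∞ m) {C C' : ℝ} (hC : ∀ x, |m x| ≤ C)
    (hC' : ∀ x, ‖gradient m x‖ ≤ C') (v : H1) : H1 :=
  H1.mk _ _ (isWeakGradient_mul hm hC hC' (isWeakGradient_grad v))

theorem toL2_mulSmooth {m : E3 → ℝ} (hm : ContDiff ℝ ∞ m) {C C' : ℝ} (hC : ∀ x, |m x| ≤ C)
    (hC' : ∀ x, ‖gradient m x‖ ≤ C') (v : H1) :
    toL2 (mulSmooth hm hC hC' v) =ᵐ[volume] fun x => m x * toL2 v x :=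
  (memLp_mul_of_bounded hm.continuous hC (toL2 v)).coeFn_toLp

theorem grad_mulSmooth {m : E3 → ℝ} (hm : ContDiff ℝ ∞ m) {C C' : ℝ} (hC : ∀ x, |m x| ≤ C)
    (hC' : ∀ x, ‖gradient m x‖ ≤ C') (v : H1) :
    grad (mulSmooth hm hC hC' v) =ᵐ[volume]
      fun x => m x • grad v x + toL2 v x • gradient m x :=
  (memLp_mul_gradient hm hC hC' (toL2 v) (grad v)).coeFn_toLp

/-! ### The form of a coefficient -/

theorem IsCoefficient.exists_bound {γ : E3 → Matrix (Fin 3) (Fin 3) ℝ} (hγ : IsCoefficient γ) :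
    ∃ M : ℝ, 0 < M ∧ ∀ᵐ x : E3, ∀ i j, |γ x i j| ≤ M := by
  have h : ∀ i j, ∃ M : ℝ, ∀ᵐ x : E3, |γ x i j| ≤ M := by
    intro i j
    refine ⟨(eLpNormEssSup (fun x => γ x i j) volume).toReal, ?_⟩
    have hfin : eLpNormEssSup (fun x => γ x i j) (volume : Measure E3) ≠ ⊤ := by
      rw [← eLpNorm_exponent_top]
      exact (hγ.memLp i j).2.ne
    filter_upwards [ae_le_eLpNormEssSup (f := fun x => γ x i j) (μ := volume)] with x hx
    rw [← Real.norm_eq_abs, ← toReal_enorm]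
    exact ENNReal.toReal_mono hfin hx
  choose M hM using h
  refine ⟨(∑ i, ∑ j, |M i j|) + 1, by positivity, ?_⟩
  rw [ae_all_iff]
  intro i
  rw [ae_all_iff]
  intro j
  filter_upwards [hM i j] with x hx
  have h₁ : |M i j| ≤ ∑ j, |M i j| :=
    Finset.single_le_sum (f := fun j => |M i j|) (fun _ _ => abs_nonneg _) (Finset.mem_univ j)
  have h₂ : ∑ j, |M i j| ≤ ∑ i, ∑ j, |M i j| :=
    Finset.single_le_sum (f := fun i => ∑ j, |M i j|)
      (fun _ _ => Finset.sum_nonneg fun _ _ => abs_nonneg _) (Finset.mem_univ i)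
  linarith [le_abs_self (M i j)]

theorem abs_mulVec_dotProduct_le {A : Matrix (Fin 3) (Fin 3) ℝ} {M : ℝ}
    (hA : ∀ i j, |A i j| ≤ M) (p q : E3) :
    |(A *ᵥ p.ofLp) ⬝ᵥ q.ofLp| ≤ 9 * M * (‖p‖ * ‖q‖) := by
  have hM : 0 ≤ M := (abs_nonneg _).trans (hA 0 0)
  have hp : ∀ i, |p i| ≤ ‖p‖ := fun i => PiLp.norm_apply_le p i
  have hq : ∀ i, |q i| ≤ ‖q‖ := fun i => PiLp.norm_apply_le q i
  have h : (A *ᵥ p.ofLp) ⬝ᵥ q.ofLp = ∑ i, ∑ j, A i j * p j * q i := by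
    simp only [Matrix.mulVec, dotProduct, Finset.sum_mul]
  rw [h]
  have h₁ : ∀ i j, |A i j * p j * q i| ≤ M * (‖p‖ * ‖q‖) := by
    intro i j
    rw [abs_mul, abs_mul, mul_assoc]
    exact mul_le_mul (hA i j) (mul_le_mul (hp j) (hq i) (abs_nonneg _) (norm_nonneg _))
      (by positivity) hM
  calc |∑ i, ∑ j, A i j * p j * q i| ≤ ∑ i, ∑ j, |A i j * p j * q i| :=
        (Finset.abs_sum_le_sum_abs _ _).trans
          (Finset.sum_le_sum fun i _ => Finset.abs_sum_le_sum_abs _ _)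
    _ ≤ ∑ _i : Fin 3, ∑ _j : Fin 3, M * (‖p‖ * ‖q‖) :=
        Finset.sum_le_sum fun i _ => Finset.sum_le_sum fun j _ => h₁ i j
    _ = 9 * M * (‖p‖ * ‖q‖) := by
        simp only [Finset.sum_const, Finset.card_univ, Fintype.card_fin, nsmul_eq_mul]
        push_cast
        ring

theorem integrable_norm_mul_norm (g h : L2Vec) : Integrable fun x => ‖g x‖ * ‖h x‖ :=
  (Lp.memLp g).norm.integrable_mul (Lp.memLp h).norm

theorem integrable_norm_sq (g : L2Vec) : Integrable fun x => ‖g x‖ ^ 2 := by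
  simpa only [sq] using integrable_norm_mul_norm g g

theorem integral_norm_mul_norm_le (g h : L2Vec) : ∫ x, ‖g x‖ * ‖h x‖ ≤ ‖g‖ * ‖h‖ := by
  have e : ∫ x, ‖g x‖ * ‖h x‖ = inner ℝ ((Lp.memLp g).norm.toLp _) ((Lp.memLp h).norm.toLp _) := by
    rw [← integral_mul_eq_inner]
    refine integral_congr_ae ?_
    filter_upwards [(Lp.memLp g).norm.coeFn_toLp, (Lp.memLp h).norm.coeFn_toLp] with x h₁ h₂
    rw [h₁, h₂]
  rw [e]
  refine (real_inner_le_norm _ _).trans (le_of_eq ?_)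
  rw [Lp.norm_toLp, Lp.norm_toLp, eLpNorm_norm, eLpNorm_norm, ← Lp.norm_def, ← Lp.norm_def]

theorem IsCoefficient.integrable {γ : E3 → Matrix (Fin 3) (Fin 3) ℝ} (hγ : IsCoefficient γ)
    (g h : L2Vec) : Integrable fun x => (γ x *ᵥ (g x).ofLp) ⬝ᵥ (h x).ofLp := by
  obtain ⟨M, -, hM⟩ := hγ.exists_bound
  refine ((integrable_norm_mul_norm g h).const_mul (9 * M)).mono' ?_ ?_
  · have e : (fun x => (γ x *ᵥ (g x).ofLp) ⬝ᵥ (h x).ofLp)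
        = fun x => ∑ i, (∑ j, γ x i j * g x j) * h x i := rfl
    rw [e]
    refine Finset.aestronglyMeasurable_fun_sum _ fun i _ => ?_
    refine AEStronglyMeasurable.mul ?_ (memLp_coord h i).1
    exact Finset.aestronglyMeasurable_fun_sum _ fun j _ =>
      (hγ.memLp i j).1.mul (memLp_coord g j).1
  · filter_upwards [hM] with x hx
    exact abs_mulVec_dotProduct_le hx _ _

theorem norm_grad_le (u : H1) : ‖grad u‖ ≤ ‖u‖ := by
  refine (sq_le_sq₀ (norm_nonneg _) (norm_nonneg _)).1 ?_
  rw [norm_sq_H1]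
  exact le_add_of_nonneg_left (sq_nonneg _)

theorem IsCoefficient.abs_form_le {γ : E3 → Matrix (Fin 3) (Fin 3) ℝ} {M : ℝ}
    (hM : ∀ᵐ x : E3, ∀ i j, |γ x i j| ≤ M) (hM0 : 0 ≤ M) (u φ : H1) :
    |form γ u φ| ≤ 9 * M * ‖u‖ * ‖φ‖ := by
  calc |form γ u φ| ≤ ∫ x, 9 * M * (‖grad u x‖ * ‖grad φ x‖) := by
        rw [← Real.norm_eq_abs, form]
        refine norm_integral_le_of_norm_le
          ((integrable_norm_mul_norm (grad u) (grad φ)).const_mul (9 * M)) ?_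
        filter_upwards [hM] with x hx
        exact abs_mulVec_dotProduct_le hx _ _
    _ ≤ 9 * M * (‖grad u‖ * ‖grad φ‖) := by
        rw [integral_const_mul]
        exact mul_le_mul_of_nonneg_left (integral_norm_mul_norm_le _ _) (by positivity)
    _ ≤ 9 * M * (‖u‖ * ‖φ‖) := by gcongr <;> exact norm_grad_le _
    _ = _ := by ring

/-- The form of a coefficient as a continuous bilinear form. -/
theorem IsCoefficient.exists_bilinear {γ : E3 → Matrix (Fin 3) (Fin 3) ℝ}
    (hγ : IsCoefficient γ) : ∃ b : H1 →L[ℝ] H1 →L[ℝ] ℝ, ∀ u φ, b u φ = form γ u φ := by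
  obtain ⟨M, hM0, hM⟩ := hγ.exists_bound
  refine ⟨LinearMap.mkContinuous₂ (LinearMap.mk₂ ℝ (form γ) ?_ ?_ ?_ ?_) (9 * M) ?_, ?_⟩
  · intro u₁ u₂ φ
    rw [form, form, form, ← integral_add (hγ.integrable _ _) (hγ.integrable _ _)]
    refine integral_congr_ae ?_
    filter_upwards [Lp.coeFn_add (grad u₁) (grad u₂)] with x hx
    rw [map_add, hx, Pi.add_apply, WithLp.ofLp_add, Matrix.mulVec_add, add_dotProduct]
  · intro c u φ
    rw [form, form, smul_eq_mul, ← integral_const_mul]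
    refine integral_congr_ae ?_
    filter_upwards [Lp.coeFn_smul c (grad u)] with x hx
    rw [map_smul, hx, Pi.smul_apply, WithLp.ofLp_smul, Matrix.mulVec_smul, smul_dotProduct,
      smul_eq_mul]
  · intro u φ₁ φ₂
    rw [form, form, form, ← integral_add (hγ.integrable _ _) (hγ.integrable _ _)]
    refine integral_congr_ae ?_
    filter_upwards [Lp.coeFn_add (grad φ₁) (grad φ₂)] with x hx
    rw [map_add, hx, Pi.add_apply, WithLp.ofLp_add, dotProduct_add]
  · intro c u φ
    rw [form, form, smul_eq_mul, ← integral_const_mul]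
    refine integral_congr_ae ?_
    filter_upwards [Lp.coeFn_smul c (grad φ)] with x hx
    rw [map_smul, hx, Pi.smul_apply, WithLp.ofLp_smul, dotProduct_smul, smul_eq_mul]
  · intro u φ
    exact IsCoefficient.abs_form_le hM hM0.le u φ
  · intro u φ
    rfl

theorem IsCoefficient.form_comm {γ : E3 → Matrix (Fin 3) (Fin 3) ℝ} (hγ : IsCoefficient γ)
    (u φ : H1) : form γ u φ = form γ φ u := by
  refine integral_congr_ae ?_
  filter_upwards [hγ.symm] with x hx
  rw [dotProduct_comm, Matrix.dotProduct_mulVec, ← Matrix.mulVec_transpose, hx]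

theorem dotProduct_eq_inner (p q : E3) : p.ofLp ⬝ᵥ q.ofLp = inner ℝ p q := by
  simp [PiLp.inner_apply, dotProduct, mul_comm]

theorem form_one (u φ : H1) : form (fun _ => 1) u φ = inner ℝ (grad u) (grad φ) := by
  rw [form, L2.inner_def]
  simp only [Matrix.one_mulVec, dotProduct_eq_inner]

theorem norm_sq_eq_integral (g : L2Vec) : ‖g‖ ^ 2 = ∫ x, ‖g x‖ ^ 2 := by
  rw [← real_inner_self_eq_norm_sq, L2.inner_def]
  simp only [real_inner_self_eq_norm_sq]

theorem norm_sq_eq_integral_L2 (g : L2) : ‖g‖ ^ 2 = ∫ x, g x ^ 2 := by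
  rw [← real_inner_self_eq_norm_sq, ← integral_mul_eq_inner]
  simp only [sq]

theorem le_form_self {γ : E3 → Matrix (Fin 3) (Fin 3) ℝ} (hγ : IsCoefficient γ) {c : ℝ}
    (hc : ∀ᵐ x : E3, ∀ ξ : E3, c * ‖ξ‖ ^ 2 ≤ (γ x *ᵥ ξ.ofLp) ⬝ᵥ ξ.ofLp) (u : H1) :
    c * ‖grad u‖ ^ 2 ≤ form γ u u := by
  rw [norm_sq_eq_integral, ← integral_const_mul]
  refine integral_mono_ae ((integrable_norm_sq _).const_mul _) (hγ.integrable _ _) ?_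
  filter_upwards [hc] with x hx
  exact hx _

/-! ### Energy identities and inequalities -/

/-- The difference of the two sides is `‖c p - q‖² / c`. This removes the unknown `p = ∇w` and
leaves only `q = ∇v`. -/
theorem norm_sub_sq_add_ge (p q : E3) {c : ℝ} (hc : 0 < c) :
    (1 - 1 / c) * ‖q‖ ^ 2 ≤ ‖p - q‖ ^ 2 + (c * ‖p‖ ^ 2 - ‖p‖ ^ 2) := by
  have h₁ := norm_sub_sq_real p q
  have h₂ := norm_sub_sq_real (c • p) q
  rw [inner_smul_left, norm_smul, mul_pow, Real.norm_eq_abs, sq_abs] at h₂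
  have h₃ := sq_nonneg ‖c • p - q‖
  simp only [conj_trivial] at h₂
  have h₄ : (1 - 1 / c) * ‖q‖ ^ 2 = ‖q‖ ^ 2 - ‖q‖ ^ 2 / c := by ring
  have h₅ : c * ‖p‖ ^ 2 - 2 * inner ℝ p q + ‖q‖ ^ 2 / c = ‖c • p - q‖ ^ 2 / c := by
    rw [h₂]
    field_simp
  have h₆ : 0 ≤ ‖c • p - q‖ ^ 2 / c := by positivity
  linarith

/-- Lower bound for the energy of a perturbed solution `w` in terms of the free one `v`. -/
theorem inner_sub_ge {γ : E3 → Matrix (Fin 3) (Fin 3) ℝ} (hγ : IsCoefficient γ) {τ : ℝ} {f : L2}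
    {v w : H1} {Λ : H1 →L[ℝ] ℝ}
    (hv : ∀ φ : H1, inner ℝ (grad v) (grad φ) + τ ^ 2 * inner ℝ (toL2 v) (toL2 φ)
      = inner ℝ f (toL2 φ))
    (hw : ∀ φ : H1, form γ w φ + τ ^ 2 * inner ℝ (toL2 w) (toL2 φ) = inner ℝ f (toL2 φ) - Λ φ)
    {S : Set E3} (hS : MeasurableSet S) {k : ℝ}
    (hk : ∀ᵐ x : E3, ∀ p q : E3, S.indicator (fun _ => k * ‖q‖ ^ 2) x
      ≤ ‖p - q‖ ^ 2 + ((γ x *ᵥ p.ofLp) ⬝ᵥ p.ofLp - ‖p‖ ^ 2)) :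
    k * ∫ x in S, ‖grad v x‖ ^ 2 ≤ inner ℝ f (toL2 v) - inner ℝ f (toL2 w) - Λ w := by
  -- These three equations give `(f,v) - (f,w) - Λw = ‖∇(w-v)‖² + τ²‖w-v‖² + (form γ w w - ‖∇w‖²)`;
  -- the middle term is dropped.
  have e₁ := hv v
  have e₂ := hv w
  have e₃ := hw w
  have n₁ := norm_sub_sq_real (grad w) (grad v)
  have n₂ := norm_sub_sq_real (toL2 w) (toL2 v)
  have key : k * ∫ x in S, ‖grad v x‖ ^ 2 ≤
      ‖grad w - grad v‖ ^ 2 + (form γ w w - ‖grad w‖ ^ 2) := by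
    have hi : Integrable fun x => (γ x *ᵥ (grad w x).ofLp) ⬝ᵥ (grad w x).ofLp - ‖grad w x‖ ^ 2 :=
      (hγ.integrable _ _).sub (integrable_norm_sq _)
    rw [norm_sq_eq_integral, norm_sq_eq_integral, form, ← integral_sub (hγ.integrable _ _)
      (integrable_norm_sq _), ← integral_add (integrable_norm_sq _) hi, ← integral_const_mul,
      ← integral_indicator hS]
    refine integral_mono_ae ((((integrable_norm_sq _).const_mul _)).indicator hS)
      ((integrable_norm_sq _).add ((hγ.integrable _ _).sub (integrable_norm_sq _))) ?_
    filter_upwards [hk, Lp.coeFn_sub (grad w) (grad v)] with x hx hs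
    rw [hs]
    have := hx (grad w x) (grad v x)
    by_cases hxS : x ∈ S <;> simpa [hxS] using this
  rw [real_inner_self_eq_norm_sq, real_inner_self_eq_norm_sq] at e₁
  rw [real_inner_self_eq_norm_sq] at e₃
  rw [real_inner_comm, real_inner_comm (toL2 w)] at e₂
  have n₃ : 0 ≤ τ ^ 2 * ‖toL2 w - toL2 v‖ ^ 2 := by positivity
  rw [n₂] at n₃
  nlinarith

/-- The companion of `inner_sub_ge`. -/
theorem inner_sub_ge_of_free {γ : E3 → Matrix (Fin 3) (Fin 3) ℝ} (hγ : IsCoefficient γ) {τ : ℝ}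
    {f : L2} {v w : H1} {Λ : H1 →L[ℝ] ℝ}
    (hv : ∀ φ : H1, inner ℝ (grad v) (grad φ) + τ ^ 2 * inner ℝ (toL2 v) (toL2 φ)
      = inner ℝ f (toL2 φ))
    (hw : ∀ φ : H1, form γ w φ + τ ^ 2 * inner ℝ (toL2 w) (toL2 φ) = inner ℝ f (toL2 φ) - Λ φ)
    {S : Set E3} (hS : MeasurableSet S) {k : ℝ}
    (hk : ∀ᵐ x : E3, ∀ q : E3, S.indicator (fun _ => k * ‖q‖ ^ 2) x
      ≤ ‖q‖ ^ 2 - (γ x *ᵥ q.ofLp) ⬝ᵥ q.ofLp) :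
    k * ∫ x in S, ‖grad v x‖ ^ 2 ≤
      inner ℝ f (toL2 w) - inner ℝ f (toL2 v) - (Λ w - 2 * Λ v) := by
  obtain ⟨c₀, hc₀, hell⟩ := hγ.elliptic
  obtain ⟨b, hb⟩ := hγ.exists_bilinear
  -- With the roles exchanged the identity is `(f,w) - (f,v) - (Λw - 2Λv) = form γ (w-v) (w-v) +
  -- τ²‖w-v‖² + (‖∇v‖² - form γ v v)`, and the first two terms are nonnegative.
  have e₁ := hv v
  have e₂ := hw v
  have e₃ := hw w
  have n₂ := norm_sub_sq_real (toL2 w) (toL2 v)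
  have pos : 0 ≤ form γ (w - v) (w - v) :=
    (by positivity : 0 ≤ c₀ * ‖grad (w - v)‖ ^ 2).trans (le_form_self hγ hell _)
  have ex : form γ (w - v) (w - v) = form γ w w - 2 * form γ w v + form γ v v := by
    have hs : b v w = b w v := by rw [hb, hb, hγ.form_comm]
    rw [← hb, ← hb, ← hb, ← hb]
    simp only [map_sub, sub_apply, hs]
    ring
  have key : k * ∫ x in S, ‖grad v x‖ ^ 2 ≤ ‖grad v‖ ^ 2 - form γ v v := by
    rw [norm_sq_eq_integral, form, ← integral_sub (integrable_norm_sq _) (hγ.integrable _ _),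
      ← integral_const_mul, ← integral_indicator hS]
    refine integral_mono_ae ((((integrable_norm_sq _).const_mul _)).indicator hS)
      ((integrable_norm_sq _).sub (hγ.integrable _ _)) ?_
    filter_upwards [hk] with x hx
    have := hx (grad v x)
    by_cases hxS : x ∈ S <;> simpa [hxS] using this
  rw [real_inner_self_eq_norm_sq, real_inner_self_eq_norm_sq] at e₁
  rw [real_inner_self_eq_norm_sq] at e₃
  have n₃ : 0 ≤ τ ^ 2 * ‖toL2 w - toL2 v‖ ^ 2 := by positivity
  rw [n₂] at n₃
  nlinarith

/-! ### Weak time derivatives -/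

/-- The primitive started at the left end of an interval `[a, b]` carrying `ρ` vanishes left of `a`,
and right of `b` because the total integral is zero. -/
theorem exists_primitive_of_integral_eq_zero {T : ℝ} (hT : 0 < T) {ρ : ℝ → ℝ}
    (hρ : ContDiff ℝ ∞ ρ) (hs : tsupport ρ ⊆ Ioo 0 T) (h0 : ∫ t, ρ t = 0) (hc : HasCompactSupport ρ) :
    ∃ ψ : ℝ → ℝ, ContDiff ℝ ∞ ψ ∧ HasCompactSupport ψ ∧ tsupport ψ ⊆ Ioo 0 T ∧ deriv ψ = ρ := by
  obtain ⟨a, b, ha, hab, hb, hK⟩ : ∃ a b : ℝ, 0 < a ∧ a ≤ b ∧ b < T ∧ tsupport ρ ⊆ Icc a b := by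
    rcases (tsupport ρ).eq_empty_or_nonempty with he | hne
    · exact ⟨T / 2, T / 2, by linarith, le_rfl, by linarith, by simp [he]⟩
    · obtain ⟨a, ha⟩ := hc.isCompact.exists_isLeast hne
      obtain ⟨b, hb⟩ := hc.isCompact.exists_isGreatest hne
      exact ⟨a, b, (hs ha.1).1, ha.2 hb.1, (hs hb.1).2, fun t ht => ⟨ha.2 ht, hb.2 ht⟩⟩
  have hz : ∀ t, t ∉ Icc a b → ρ t = 0 := fun t ht =>
    image_eq_zero_of_notMem_tsupport fun h => ht (hK h)
  have hd : ∀ t, HasDerivAt (fun t => ∫ s in a..t, ρ s) (ρ t) t := fun t =>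
    intervalIntegral.integral_hasDerivAt_right (hρ.continuous.intervalIntegrable _ _)
      (hρ.continuous.stronglyMeasurableAtFilter _ _) hρ.continuous.continuousAt
  have hderiv : deriv (fun t => ∫ s in a..t, ρ s) = ρ := funext fun t => (hd t).deriv
  have hab0 : ∫ s in a..b, ρ s = 0 := by
    rw [intervalIntegral.integral_of_le hab, ← integral_Icc_eq_integral_Ioc,
      setIntegral_eq_integral_of_forall_compl_eq_zero hz, h0]
  have hψ0 : ∀ t, t ∉ Icc a b → ∫ s in a..t, ρ s = 0 := by
    intro t ht
    rcases lt_or_ge t a with hta | hta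
    · rw [intervalIntegral.integral_symm, intervalIntegral.integral_of_le hta.le,
        ← integral_Ico_eq_integral_Ioc, setIntegral_eq_zero_of_forall_eq_zero, neg_zero]
      exact fun s hs => hz s fun h => absurd h.1 (not_le.2 hs.2)
    · have hbt : b < t := by
        by_contra h
        exact ht ⟨hta, not_lt.1 h⟩
      rw [← intervalIntegral.integral_add_adjacent_intervals
        (hρ.continuous.intervalIntegrable a b) (hρ.continuous.intervalIntegrable b t), hab0,
        zero_add, intervalIntegral.integral_of_le hbt.le, setIntegral_eq_zero_of_forall_eq_zero]
      exact fun s hs => hz s fun h => absurd h.2 (not_le.2 hs.1)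
  have hsub : tsupport (fun t => ∫ s in a..t, ρ s) ⊆ Icc a b :=
    closure_minimal (fun t ht => by_contra fun h => ht (hψ0 t h)) isClosed_Icc
  refine ⟨fun t => ∫ s in a..t, ρ s, ?_, ?_, ?_, hderiv⟩
  · rw [contDiff_infty_iff_deriv, hderiv]
    exact ⟨fun t => (hd t).differentiableAt, hρ⟩
  · exact isCompact_Icc.of_isClosed_subset (isClosed_tsupport _) hsub
  · exact hsub.trans fun t ht => ⟨ha.trans_le ht.1, ht.2.trans_lt hb⟩

/-- A continuous function with vanishing weak derivative is constant. -/
theorem eq_of_weakTimeDeriv_zero {T : ℝ} (hT : 0 < T) {h : ℝ → ℝ}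
    (hcont : ContinuousOn h (Icc 0 T))
    (hw : ∀ ψ : ℝ → ℝ, ContDiff ℝ ∞ ψ → HasCompactSupport ψ → tsupport ψ ⊆ Ioo 0 T →
      ∫ t in Ioo 0 T, deriv ψ t * h t = 0) : h T = h 0 := by
  have hint : IntegrableOn h (Ioo 0 T) :=
    (hcont.integrableOn_compact isCompact_Icc).mono_set Ioo_subset_Icc_self
  let b : ContDiffBump (T / 2) := ⟨T / 8, T / 4, by linarith, by linarith⟩
  let ρ : ℝ → ℝ := b.normed volume
  have hρ : ContDiff ℝ ∞ ρ := b.contDiff_normed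
  have hρc : HasCompactSupport ρ := b.hasCompactSupport_normed
  have hρs : tsupport ρ ⊆ Ioo 0 T := by
    rw [b.tsupport_normed_eq, Real.closedBall_eq_Icc]
    intro t ht
    have h1 : b.rOut = T / 4 := rfl
    rw [h1] at ht
    exact ⟨by linarith [ht.1], by linarith [ht.2]⟩
  have hρ1 : ∫ t, ρ t = 1 := b.integral_normed
  let c : ℝ := ∫ t in Ioo 0 T, ρ t * h t
  have hmul : ∀ g : ℝ → ℝ, ContDiff ℝ ∞ g → HasCompactSupport g →
      IntegrableOn (fun t => g t * h t) (Ioo 0 T) := by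
    intro g hg hgc
    obtain ⟨C, hC⟩ := hgc.exists_bound_of_continuous hg.continuous
    exact hint.bdd_mul hg.continuous.aestronglyMeasurable (Eventually.of_forall hC)
  have hae : ∀ᵐ t, t ∈ Ioo 0 T → h t - c = 0 := by
    refine isOpen_Ioo.ae_eq_zero_of_integral_contDiff_smul_eq_zero ?_ ?_
    · exact (hint.sub (integrableOn_const (by simp))).locallyIntegrableOn
    · intro g hg hgc hgs
      have hg0 : ∀ t ∉ Ioo 0 T, g t • (h t - c) = 0 := fun t ht => by
        rw [image_eq_zero_of_notMem_tsupport fun h => ht (hgs h), zero_smul]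
      rw [← setIntegral_eq_integral_of_forall_compl_eq_zero hg0]
      -- Du Bois-Reymond: subtracting `(∫ g) ρ` from `g` makes the mean zero, so the difference is
      -- the derivative of a test function and the hypothesis applies to it.
      have s₁ : tsupport (fun t => g t - (∫ s, g s) * ρ t) ⊆ Ioo 0 T := by
        refine (tsupport_sub _ _).trans (union_subset hgs ?_)
        exact (closure_mono (Function.support_mul_subset_right _ _)).trans hρs
      have s₂ : ∫ t, (g t - (∫ s, g s) * ρ t) = 0 := by
        rw [integral_sub (hg.continuous.integrable_of_hasCompactSupport hgc)
          ((hρ.continuous.integrable_of_hasCompactSupport hρc).const_mul _), integral_const_mul,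
          hρ1, mul_one, sub_self]
      obtain ⟨ψ, hψ, hψc, hψs, hψd⟩ := exists_primitive_of_integral_eq_zero hT
        (hg.sub (contDiff_const.mul hρ)) s₁ s₂ (hgc.sub hρc.mul_left)
      have e := hw ψ hψ hψc hψs
      rw [hψd] at e
      have e₂ : ∫ t in Ioo 0 T, (g t - (∫ s, g s) * ρ t) * h t
          = ∫ t in Ioo 0 T, (g t * h t - (∫ s, g s) * (ρ t * h t)) := by
        refine integral_congr_ae (Eventually.of_forall fun t => ?_)
        simp only
        ring
      rw [e₂, integral_sub (hmul g hg hgc) ((hmul ρ hρ hρc).const_mul _),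
        integral_const_mul] at e
      have e₃ : ∫ t in Ioo 0 T, g t • (h t - c) = ∫ t in Ioo 0 T, (g t * h t - g t * c) := by
        refine integral_congr_ae (Eventually.of_forall fun t => ?_)
        simp only [smul_eq_mul]
        ring
      have hgi : Integrable g := hg.continuous.integrable_of_hasCompactSupport hgc
      have e₄ : ∫ t in Ioo 0 T, g t = ∫ t, g t :=
        setIntegral_eq_integral_of_forall_compl_eq_zero fun t ht =>
          image_eq_zero_of_notMem_tsupport fun h => ht (hgs h)
      rw [e₃, integral_sub (hmul g hg hgc) (hgi.integrableOn.mul_const _), integral_mul_const, e₄]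
      exact e
  have heq : EqOn h (fun _ => c) (Icc 0 T) := by
    refine Measure.eqOn_Icc_of_ae_eq volume hT.ne ?_ hcont continuousOn_const
    rw [← restrict_Ioo_eq_restrict_Icc]
    refine (ae_restrict_iff' measurableSet_Ioo).2 ?_
    filter_upwards [hae] with t ht hm
    exact sub_eq_zero.1 (ht hm)
  rw [heq ⟨hT.le, le_rfl⟩, heq ⟨le_rfl, hT.le⟩]

/-- The continuous representative `G` minus the primitive `P` of `k'` has weak derivative zero,
hence is constant. That `k'` is also the weak derivative of `P` follows by parts for absolutely
continuous functions. -/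
theorem integral_weakTimeDeriv {T : ℝ} (hT : 0 < T) {k k' G : ℝ → ℝ}
    (hk' : IntegrableOn k' (Ioo 0 T)) (hG : ContinuousOn G (Icc 0 T))
    (hGk : ∀ᵐ t ∂(volume.restrict (Ioo 0 T)), G t = k t) (hw : IsWeakTimeDeriv T k k') :
    ∫ t in Ioo 0 T, k' t = G T - G 0 := by
  have hki : IntervalIntegrable k' volume 0 T :=
    (intervalIntegrable_iff_integrableOn_Ioo_of_le hT.le).2 hk'
  let P : ℝ → ℝ := fun t => ∫ s in (0 : ℝ)..t, k' s
  have hPac : AbsolutelyContinuousOnInterval P 0 T :=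
    hki.absolutelyContinuousOnInterval_intervalIntegral (by simp)
  have hPc : ContinuousOn P (Icc 0 T) := by
    simpa [uIcc_of_le hT.le] using hPac.continuousOn
  have hPd : ∀ᵐ t, t ∈ uIcc 0 T → HasDerivAt P (k' t) t := by
    filter_upwards [hki.ae_hasDerivAt_integral] with t ht hm
    exact ht hm 0 (by simp)
  have key : G T - P T = G 0 - P 0 := by
    refine eq_of_weakTimeDeriv_zero (h := fun t => G t - P t) hT (hG.sub hPc) ?_
    intro ψ hψ hψc hψs
    have hψ' : Continuous (deriv ψ) := hψ.continuous_deriv (by simp)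
    have hψac : AbsolutelyContinuousOnInterval ψ 0 T := by
      have h1 : IntervalIntegrable (deriv ψ) volume 0 T := hψ'.intervalIntegrable _ _
      have h2 := h1.absolutelyContinuousOnInterval_intervalIntegral (c := 0) (by simp)
      have h0 : ψ 0 = 0 := image_eq_zero_of_notMem_tsupport fun h => lt_irrefl _ (hψs h).1
      have h3 : (fun x => ∫ v in (0 : ℝ)..x, deriv ψ v) = ψ := by
        funext x
        rw [intervalIntegral.integral_deriv_eq_sub
          (fun y _ => hψ.differentiable (by simp) y) (hψ'.intervalIntegrable _ _), h0, sub_zero]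
      rwa [h3] at h2
    have hbp := hψac.integral_mul_deriv_eq_deriv_mul hPac
    have hψT : ψ T = 0 := image_eq_zero_of_notMem_tsupport fun h => lt_irrefl _ (hψs h).2
    have hψ0 : ψ 0 = 0 := image_eq_zero_of_notMem_tsupport fun h => lt_irrefl _ (hψs h).1
    rw [hψT, hψ0] at hbp
    have e₁ : ∫ t in (0 : ℝ)..T, ψ t * deriv P t = ∫ t in Ioo 0 T, ψ t * k' t := by
      rw [intervalIntegral.integral_of_le hT.le, integral_Ioc_eq_integral_Ioo]
      refine setIntegral_congr_ae measurableSet_Ioo ?_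
      filter_upwards [hPd] with t ht hm
      rw [(ht (by rw [uIcc_of_le hT.le]; exact Ioo_subset_Icc_self hm)).deriv]
    rw [e₁, intervalIntegral.integral_of_le hT.le, integral_Ioc_eq_integral_Ioo] at hbp
    have e₂ := hw ψ hψ hψc hψs
    simp only [smul_eq_mul] at e₂
    have e₃ : ∫ t in Ioo 0 T, deriv ψ t * G t = ∫ t in Ioo 0 T, deriv ψ t * k t := by
      refine integral_congr_ae ?_
      filter_upwards [hGk] with t ht
      rw [ht]
    have hi : ∀ h : ℝ → ℝ, ContinuousOn h (Icc 0 T) →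
        IntegrableOn (fun t => deriv ψ t * h t) (Ioo 0 T) := fun h hh =>
      ((hψ'.continuousOn.mul hh).integrableOn_compact isCompact_Icc).mono_set Ioo_subset_Icc_self
    have e₄ : ∫ t in Ioo 0 T, deriv ψ t * (G t - P t)
        = (∫ t in Ioo 0 T, deriv ψ t * G t) - ∫ t in Ioo 0 T, deriv ψ t * P t := by
      rw [← integral_sub (hi G hG) (hi P hPc)]
      simp only [mul_sub]
    rw [e₄, e₃, e₂, hbp]
    ring
  have h0 : P 0 = 0 := intervalIntegral.integral_same
  have hPT : P T = ∫ t in Ioo 0 T, k' t := by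
    simp only [P]
    rw [intervalIntegral.integral_of_le hT.le, integral_Ioc_eq_integral_Ioo]
  linarith

/-- The Leibniz rule holds for `e^{-τt} g` because `ψ e^{-τt}` is a test function whenever `ψ` is.
Integrating this weak derivative gives the boundary terms. -/
theorem integral_exp_mul_weakTimeDeriv {T : ℝ} (hT : 0 < T) (τ : ℝ) {g g' G : ℝ → ℝ}
    (hg : IntegrableOn g (Ioo 0 T)) (hg' : IntegrableOn g' (Ioo 0 T))
    (hG : ContinuousOn G (Icc 0 T))
    (hGg : ∀ᵐ t ∂(volume.restrict (Ioo 0 T)), G t = g t) (hw : IsWeakTimeDeriv T g g') :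
    ∫ t in Ioo 0 T, Real.exp (-τ * t) * g' t
      = Real.exp (-τ * T) * G T - G 0 + τ * ∫ t in Ioo 0 T, Real.exp (-τ * t) * g t := by
  have hec : Continuous fun t : ℝ => Real.exp (-τ * t) := by fun_prop
  have hes : ContDiff ℝ ∞ fun t : ℝ => Real.exp (-τ * t) := by fun_prop
  have hbd : ∀ m k : ℝ → ℝ, Continuous m → IntegrableOn k (Ioo 0 T) →
      IntegrableOn (fun t => m t * k t) (Ioo 0 T) := by
    intro m k hm hk
    have := IntegrableOn.continuousOn_mul_of_subset (hm.continuousOn (s := Icc 0 T)) hk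
      isCompact_Icc measurableSet_Ioo Ioo_subset_Icc_self
    exact this
  have i₁ := hbd _ _ hec hg
  have i₂ := hbd _ _ hec hg'
  have hweak : IsWeakTimeDeriv T (fun t => Real.exp (-τ * t) * g t)
      (fun t => Real.exp (-τ * t) * g' t - τ * (Real.exp (-τ * t) * g t)) := by
    intro ψ hψ hψc hψs
    have hψe : ContDiff ℝ ∞ fun t => ψ t * Real.exp (-τ * t) := hψ.mul hes
    have e := hw _ hψe hψc.mul_right
      ((closure_mono (Function.support_mul_subset_left _ _)).trans hψs)
    have hd : ∀ t, deriv (fun t => ψ t * Real.exp (-τ * t)) t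
        = deriv ψ t * Real.exp (-τ * t) - τ * (ψ t * Real.exp (-τ * t)) := by
      intro t
      have h1 : HasDerivAt (fun t : ℝ => Real.exp (-τ * t)) (Real.exp (-τ * t) * (-τ * 1)) t :=
        ((hasDerivAt_id t).const_mul (-τ)).exp
      have h2 := ((hψ.differentiable (by simp) t).hasDerivAt.fun_mul h1).deriv
      rw [h2]
      ring
    simp only [hd, smul_eq_mul] at e ⊢
    have hψ' : Continuous (deriv ψ) := hψ.continuous_deriv (by simp)
    have j₁ := hbd (fun t => deriv ψ t * Real.exp (-τ * t)) g (hψ'.mul hec) hg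
    have j₂ := hbd (fun t => τ * (ψ t * Real.exp (-τ * t))) g
      (continuous_const.mul hψe.continuous) hg
    have j₃ := hbd (fun t => ψ t * Real.exp (-τ * t)) g' hψe.continuous hg'
    have e' : ∫ t in Ioo 0 T, (deriv ψ t * Real.exp (-τ * t) - τ * (ψ t * Real.exp (-τ * t))) * g t
        = (∫ t in Ioo 0 T, deriv ψ t * Real.exp (-τ * t) * g t)
          - ∫ t in Ioo 0 T, τ * (ψ t * Real.exp (-τ * t)) * g t := by
      rw [← integral_sub j₁ j₂]
      simp only [sub_mul]
    have e'' : ∫ t in Ioo 0 T, ψ t * (Real.exp (-τ * t) * g' t - τ * (Real.exp (-τ * t) * g t))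
        = (∫ t in Ioo 0 T, ψ t * Real.exp (-τ * t) * g' t)
          - ∫ t in Ioo 0 T, τ * (ψ t * Real.exp (-τ * t)) * g t := by
      rw [← integral_sub j₃ j₂]
      refine integral_congr_ae (Eventually.of_forall fun t => ?_)
      simp only
      ring
    rw [e'] at e
    rw [e'']
    simp only [← mul_assoc] at e ⊢
    linarith
  have := integral_weakTimeDeriv hT (G := fun t => Real.exp (-τ * t) * G t)
    (i₂.sub (i₁.const_mul τ)) (hec.continuousOn.mul hG) ?_ hweak
  · have e : ∫ t in Ioo 0 T, (Real.exp (-τ * t) * g' t - τ * (Real.exp (-τ * t) * g t)) = _ := this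
    rw [integral_sub i₂ (i₁.const_mul τ), integral_const_mul] at e
    simp only [mul_zero, Real.exp_zero, one_mul] at e
    linarith
  · filter_upwards [hGg] with t ht
    rw [ht]

theorem IsWeakTimeDeriv.clm_comp {X : Type*} [NormedAddCommGroup X] [NormedSpace ℝ X]
    [CompleteSpace X] {T : ℝ} {g g' : ℝ → X} (h : IsWeakTimeDeriv T g g')
    (hg : IntegrableOn g (Ioo 0 T)) (hg' : IntegrableOn g' (Ioo 0 T)) (l : X →L[ℝ] ℝ) :
    IsWeakTimeDeriv T (fun t => l (g t)) (fun t => l (g' t)) := by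
  intro ψ hψ hψc hψs
  have hbd : ∀ (m : ℝ → ℝ) (k : ℝ → X), Continuous m → HasCompactSupport m →
      IntegrableOn k (Ioo 0 T) → IntegrableOn (fun t => m t • k t) (Ioo 0 T) := by
    intro m k hm hmc hk
    obtain ⟨C, hC⟩ := hmc.exists_bound_of_continuous hm
    exact hk.bdd_smul C hm.aestronglyMeasurable (Eventually.of_forall hC)
  have i₁ := hbd (deriv ψ) g (hψ.continuous_deriv (by simp)) hψc.deriv hg
  have i₂ := hbd ψ g' hψ.continuous hψc hg'
  have e := congrArg l (h ψ hψ hψc hψs)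
  rw [map_neg, ← l.integral_comp_comm i₁, ← l.integral_comp_comm i₂] at e
  simpa only [map_smul] using e

/-! ### The truncated Laplace transform and the indicator function -/

/-- The inclusion `L² ⊂ (H¹)'` as a continuous linear map. -/
def toH1DualL : L2 →L[ℝ] H1Dual :=
  ((ContinuousLinearMap.compL ℝ H1 L2 ℝ).flip toL2).comp (innerSL ℝ)

theorem toH1DualL_apply (g : L2) : toH1DualL g = toH1Dual g := rfl

theorem toH1Dual_apply (g : L2) (φ : H1) : toH1Dual g φ = inner ℝ g (toL2 φ) := rfl

/-- Two integrations by parts in time: the boundary term at `0` produces `f`, those at `T` carry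
`e^{-τT}`. Essential for the asymptotics is that `Λ` and `a` do not depend on `τ`. -/
theorem truncLaplace_spec {γ : E3 → Matrix (Fin 3) (Fin 3) ℝ} (hγ : IsCoefficient γ) {T : ℝ}
    (hT : 0 < T) {f : L2} {u : ℝ → H1} (hu : IsWeakWaveSolution γ T f u) :
    ∃ (Λ : H1 →L[ℝ] ℝ) (a : L2), ∀ τ : ℝ, ∃ w : H1, toL2 w = truncLaplace T u τ ∧
      ∀ φ : H1, form γ w φ + τ ^ 2 * inner ℝ (toL2 w) (toL2 φ)
        = inner ℝ f (toL2 φ) - Real.exp (-τ * T) * (Λ φ + τ * inner ℝ a (toL2 φ)) := by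
  obtain ⟨ut, utt, mu, mu_t, mu_tt, hw₁, hw₂, heq, ⟨G₀, cG₀, aG₀, iG₀⟩, ⟨G₁, cG₁, aG₁, iG₁⟩⟩ := hu
  obtain ⟨b, hb⟩ := hγ.exists_bilinear
  have iu : IntegrableOn u (Ioo 0 T) := mu.integrable (by norm_num)
  have iut : IntegrableOn ut (Ioo 0 T) := mu_t.integrable (by norm_num)
  have iutt : IntegrableOn utt (Ioo 0 T) := mu_tt.integrable (by norm_num)
  -- The end values `∂_t u(T)` in `(H¹)'` and `u(T)` in `L²`; `w` is a Bochner integral in `H1`, so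
  -- it commutes with `toL2` and with the form.
  refine ⟨G₁ T, G₀ T, fun τ => ⟨∫ t in Ioo 0 T, Real.exp (-τ * t) • u t, ?_, ?_⟩⟩
  all_goals
    have ieu : IntegrableOn (fun t => Real.exp (-τ * t) • u t) (Ioo 0 T) :=
      IntegrableOn.continuousOn_smul_of_subset (f := fun t : ℝ => Real.exp (-τ * t)) (K := Icc 0 T)
        (by fun_prop) iu isCompact_Icc measurableSet_Ioo Ioo_subset_Icc_self
  · rw [truncLaplace, intervalIntegral.integral_of_le hT.le, integral_Ioc_eq_integral_Ioo,
      ← toL2.integral_comp_comm ieu]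
    simp only [map_smul]
  · intro φ
    have e₁ := integral_exp_mul_weakTimeDeriv hT τ (G := fun t => innerSL ℝ (toL2 φ) (G₀ t))
      ((innerSL ℝ (toL2 φ)).integrable_comp (toL2.integrable_comp iu))
      ((innerSL ℝ (toL2 φ)).integrable_comp iut)
      ((innerSL ℝ (toL2 φ)).continuous.comp_continuousOn cG₀)
      (by filter_upwards [aG₀] with t ht; rw [ht])
      (hw₁.clm_comp (toL2.integrable_comp iu) iut (innerSL ℝ (toL2 φ)))
    have e₂ := integral_exp_mul_weakTimeDeriv hT τ
      (G := fun t => ContinuousLinearMap.apply ℝ ℝ φ (G₁ t))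
      ((ContinuousLinearMap.apply ℝ ℝ φ).integrable_comp (toH1DualL.integrable_comp iut))
      ((ContinuousLinearMap.apply ℝ ℝ φ).integrable_comp iutt)
      ((ContinuousLinearMap.apply ℝ ℝ φ).continuous.comp_continuousOn cG₁)
      (by filter_upwards [aG₁] with t ht; rw [ht]; rfl)
      (hw₂.clm_comp (toH1DualL.integrable_comp iut) iutt (ContinuousLinearMap.apply ℝ ℝ φ))
    have e₃ : form γ (∫ t in Ioo 0 T, Real.exp (-τ * t) • u t) φ
        = - ∫ t in Ioo 0 T, Real.exp (-τ * t) * ContinuousLinearMap.apply ℝ ℝ φ (utt t) := by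
      rw [← hb, ← ContinuousLinearMap.flip_apply, ← (b.flip φ).integral_comp_comm ieu,
        ← integral_neg]
      refine integral_congr_ae ?_
      filter_upwards [heq] with t ht
      have := ht φ
      rw [map_smul, ContinuousLinearMap.flip_apply, hb, smul_eq_mul,
        ContinuousLinearMap.apply_apply]
      rw [eq_neg_of_add_eq_zero_left this]
      ring
    have e₄ : inner ℝ (toL2 (∫ t in Ioo 0 T, Real.exp (-τ * t) • u t)) (toL2 φ)
        = ∫ t in Ioo 0 T, Real.exp (-τ * t) * innerSL ℝ (toL2 φ) (toL2 (u t)) := by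
      rw [real_inner_comm, ← innerSL_apply_apply ℝ, ← toL2.integral_comp_comm ieu,
        ← (innerSL ℝ (toL2 φ)).integral_comp_comm (toL2.integrable_comp ieu)]
      simp only [map_smul, smul_eq_mul]
    have e₅ : ∫ t in Ioo 0 T, Real.exp (-τ * t) * innerSL ℝ (toL2 φ) (ut t)
        = ∫ t in Ioo 0 T, Real.exp (-τ * t) * ContinuousLinearMap.apply ℝ ℝ φ (toH1Dual (ut t)) := by
      refine integral_congr_ae (Eventually.of_forall fun t => ?_)
      simp only [innerSL_apply_apply, ContinuousLinearMap.apply_apply, toH1Dual_apply,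
        real_inner_comm]
    simp only [iG₀, iG₁, map_zero, toH1DualL_apply] at e₁ e₂
    rw [e₅] at e₁
    have e₆ : innerSL ℝ (toL2 φ) (G₀ T) = inner ℝ (G₀ T) (toL2 φ) := by
      rw [innerSL_apply_apply, real_inner_comm]
    rw [e₆] at e₁
    rw [e₃, e₄, e₂, e₁]
    simp only [ContinuousLinearMap.apply_apply, toH1Dual_apply]
    ring

/-- Here `X`, `Y`, `Z` stand for `‖w‖` in `L²`, `‖∇w‖` and `‖w‖` in `H¹`, and `s` for `e^{-τT}`. The
energy norm `N = √(cY² + τ²X²)` dominates `τX` and `√c Z`, so the hypothesis becomes `N² ≤ N · const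
/ τ`. The gained factor `1/τ` makes the error terms vanish below the threshold time. -/
theorem energy_estimate {c τ X Y Z F s A a S : ℝ} (hc : 0 < c) (hc1 : c ≤ 1) (hτ : 1 ≤ τ)
    (hX : 0 ≤ X) (hZ : 0 ≤ Z) (hZXY : Z ^ 2 = X ^ 2 + Y ^ 2) (hF : 0 ≤ F)
    (hA : 0 ≤ A) (ha : 0 ≤ a) (hs0 : 0 ≤ s) (hs : s ≤ S / τ)
    (h : c * Y ^ 2 + τ ^ 2 * X ^ 2 ≤ F * X + s * (A * Z + τ * (a * X))) :
    Z ≤ (F + S * (A / √c + a)) / √c / τ ∧ τ * X ≤ (F + S * (A / √c + a)) / τ := by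
  have hm : 0 < √c := Real.sqrt_pos.2 hc
  have hτ0 : 0 < τ := by linarith
  set N := √(c * Y ^ 2 + τ ^ 2 * X ^ 2) with hN
  have hN2 : N ^ 2 = c * Y ^ 2 + τ ^ 2 * X ^ 2 := Real.sq_sqrt (by positivity)
  have hN0 : 0 ≤ N := Real.sqrt_nonneg _
  have h₁ : τ * X ≤ N := Real.le_sqrt_of_sq_le (by nlinarith [mul_nonneg hc.le (sq_nonneg Y)])
  have h₂ : √c * Z ≤ N := by
    refine Real.le_sqrt_of_sq_le ?_
    rw [mul_pow, Real.sq_sqrt hc.le, hZXY]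
    nlinarith [mul_nonneg (by nlinarith : (0 : ℝ) ≤ τ ^ 2 - c) (sq_nonneg X)]
  have hX' : X ≤ N / τ := by rw [le_div_iff₀ hτ0]; linarith
  have hZ' : Z ≤ N / √c := by rw [le_div_iff₀ hm]; linarith
  have h₃ : N ^ 2 ≤ N * ((F + S * (A / √c + a)) / τ) := by
    calc N ^ 2 ≤ F * X + s * (A * Z + τ * (a * X)) := hN2 ▸ h
      _ ≤ F * (N / τ) + S / τ * (A * (N / √c) + a * N) := by
        have : τ * (a * X) ≤ a * N := by nlinarith
        have hS : 0 ≤ S / τ := hs0.trans hs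
        gcongr
      _ = N * ((F + S * (A / √c + a)) / τ) := by ring
  have h₄ : N ≤ (F + S * (A / √c + a)) / τ := by
    rcases hN0.eq_or_lt with h0 | h0
    · rw [← h0]
      have : 0 ≤ S := by
        have := hs0.trans hs
        rwa [le_div_iff₀ hτ0, zero_mul] at this
      positivity
    · rw [sq] at h₃
      exact le_of_mul_le_mul_left h₃ h0
  refine ⟨hZ'.trans ?_, h₁.trans h₄⟩
  rw [div_right_comm]
  gcongr

theorem IsReducedSolution.inner_eq {τ : ℝ} {f : L2} {v : H1}
    (hv : IsReducedSolution (fun _ => 1) τ f v) (φ : H1) :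
    inner ℝ (grad v) (grad φ) + τ ^ 2 * inner ℝ (toL2 v) (toL2 φ) = inner ℝ f (toL2 φ) := by
  have := hv φ
  rwa [form_one, integral_mul_eq_inner, integral_mul_eq_inner] at this

theorem IsReducedSolution.norm_le {τ : ℝ} (hτ : 1 ≤ τ) {f : L2} {v : H1}
    (hv : IsReducedSolution (fun _ => 1) τ f v) :
    ‖v‖ ≤ ‖f‖ / τ ∧ τ * ‖toL2 v‖ ≤ ‖f‖ / τ := by
  have h := hv.inner_eq v
  rw [real_inner_self_eq_norm_sq, real_inner_self_eq_norm_sq] at h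
  have := energy_estimate (c := 1) (F := ‖f‖) (s := 0) (A := 0) (a := 0) (S := 0) one_pos le_rfl hτ
    (norm_nonneg (toL2 v)) (norm_nonneg v) (norm_sq_H1 v) (norm_nonneg _) le_rfl le_rfl le_rfl
    (by simp) (by linarith [real_inner_le_norm f (toL2 v)])
  simpa using this

theorem indicatorFn_eq {T : ℝ} {f : L2} {u v : ℝ → H1} {τ : ℝ} {w : H1}
    (hw : toL2 w = truncLaplace T u τ) :
    indicatorFn T f u v τ = inner ℝ f (toL2 w) - inner ℝ f (toL2 (v τ)) := by
  rw [indicatorFn, ← hw, ← inner_sub_right, ← integral_mul_eq_inner]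
  refine integral_congr_ae ?_
  filter_upwards [Lp.coeFn_sub (toL2 w) (toL2 (v τ))] with x hx
  rw [hx, Pi.sub_apply]

/-- The indicator function is controlled by the Dirichlet energy of the free solution. -/
theorem exists_indicator_bound {γ : E3 → Matrix (Fin 3) (Fin 3) ℝ} (hγ : IsCoefficient γ) {T : ℝ}
    (hT : 0 < T) {f : L2} {u : ℝ → H1} (hu : IsWeakWaveSolution γ T f u) {v : ℝ → H1}
    (hv : ∀ τ : ℝ, 1 ≤ τ → IsReducedSolution (fun _ => 1) τ f (v τ)) :
    ∃ K : ℝ, ∀ τ : ℝ, 1 ≤ τ → ∀ (S : Set E3) (k : ℝ), MeasurableSet S →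
      ((∀ᵐ x : E3, ∀ p q : E3, S.indicator (fun _ => k * ‖q‖ ^ 2) x
          ≤ ‖p - q‖ ^ 2 + ((γ x *ᵥ p.ofLp) ⬝ᵥ p.ofLp - ‖p‖ ^ 2)) →
        k * ∫ x in S, ‖grad (v τ) x‖ ^ 2
          ≤ - indicatorFn T f u v τ + Real.exp (-τ * T) * (K / τ)) ∧
      ((∀ᵐ x : E3, ∀ q : E3, S.indicator (fun _ => k * ‖q‖ ^ 2) x
          ≤ ‖q‖ ^ 2 - (γ x *ᵥ q.ofLp) ⬝ᵥ q.ofLp) →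
        k * ∫ x in S, ‖grad (v τ) x‖ ^ 2
          ≤ indicatorFn T f u v τ + Real.exp (-τ * T) * (K / τ)) := by
  obtain ⟨Λ, a, hΛ⟩ := truncLaplace_spec hγ hT hu
  obtain ⟨c₁, hc₁, hell₁⟩ := hγ.elliptic
  obtain ⟨c, hc, hc1, hell⟩ : ∃ c : ℝ, 0 < c ∧ c ≤ 1 ∧
      ∀ᵐ x : E3, ∀ ξ : E3, c * ‖ξ‖ ^ 2 ≤ (γ x *ᵥ ξ.ofLp) ⬝ᵥ ξ.ofLp := by
    refine ⟨min c₁ 1, lt_min hc₁ one_pos, min_le_right _ _, ?_⟩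
    filter_upwards [hell₁] with x hx ξ
    exact (mul_le_mul_of_nonneg_right (min_le_left _ _) (sq_nonneg _)).trans (hx ξ)
  set K₀ := (‖f‖ + 1 / T * (‖Λ‖ / √c + ‖a‖)) with hK₀
  -- The first two summands bound the functional of the end values at `w`, the rest bounds twice its
  -- value at `v`, as `inner_sub_ge_of_free` requires.
  refine ⟨‖Λ‖ * (K₀ / √c) + ‖a‖ * K₀ + 2 * (‖Λ‖ * ‖f‖ + ‖a‖ * ‖f‖), fun τ hτ S k hS => ?_⟩
  have hτ0 : 0 < τ := by linarith
  obtain ⟨w, hw, hwφ⟩ := hΛ τ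
  have hs : Real.exp (-τ * T) ≤ 1 / T / τ := by
    rw [neg_mul, Real.exp_neg, div_div, one_div]
    refine inv_anti₀ (by positivity) ?_
    linarith [Real.add_one_le_exp (τ * T)]
  have hpair : ∀ φ : H1, |Λ φ + τ * inner ℝ a (toL2 φ)| ≤ ‖Λ‖ * ‖φ‖ + ‖a‖ * (τ * ‖toL2 φ‖) := by
    intro φ
    refine (abs_add_le _ _).trans (add_le_add (Λ.le_opNorm φ) ?_)
    rw [abs_mul, abs_of_pos hτ0]
    have := abs_real_inner_le_norm a (toL2 φ)
    nlinarith
  have hwb : ‖w‖ ≤ K₀ / √c / τ ∧ τ * ‖toL2 w‖ ≤ K₀ / τ := by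
    refine energy_estimate (Y := ‖grad w‖) hc hc1 hτ (norm_nonneg _) (norm_nonneg _) (norm_sq_H1 w)
      (norm_nonneg _) (norm_nonneg _) (norm_nonneg _) (Real.exp_pos _).le hs ?_
    have h := hwφ w
    rw [real_inner_self_eq_norm_sq] at h
    have h₁ := le_form_self hγ hell w
    have h₂ := real_inner_le_norm f (toL2 w)
    have h₃ : -(Λ w + τ * inner ℝ a (toL2 w)) ≤ ‖Λ‖ * ‖w‖ + τ * (‖a‖ * ‖toL2 w‖) := by
      have := (neg_le_abs _).trans (hpair w)
      linarith
    have h₄ := mul_le_mul_of_nonneg_left h₃ (Real.exp_pos (-τ * T)).le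
    linarith
  have hvb := (hv τ hτ).norm_le hτ
  have bw : |Λ w + τ * inner ℝ a (toL2 w)| ≤ (‖Λ‖ * (K₀ / √c) + ‖a‖ * K₀) / τ := by
    refine (hpair w).trans ?_
    have h₁ := mul_le_mul_of_nonneg_left hwb.1 (norm_nonneg Λ)
    have h₂ := mul_le_mul_of_nonneg_left hwb.2 (norm_nonneg a)
    rw [add_div, mul_div_assoc, mul_div_assoc]
    linarith
  have bv : |Λ (v τ) + τ * inner ℝ a (toL2 (v τ))| ≤ (‖Λ‖ * ‖f‖ + ‖a‖ * ‖f‖) / τ := by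
    refine (hpair _).trans ?_
    have h₁ := mul_le_mul_of_nonneg_left hvb.1 (norm_nonneg Λ)
    have h₂ := mul_le_mul_of_nonneg_left hvb.2 (norm_nonneg a)
    rw [add_div, mul_div_assoc, mul_div_assoc]
    linarith
  let Λ' : H1 →L[ℝ] ℝ := Real.exp (-τ * T) • (Λ + τ • (innerSL ℝ a).comp toL2)
  have hΛ' : ∀ φ, Λ' φ = Real.exp (-τ * T) * (Λ φ + τ * inner ℝ a (toL2 φ)) := fun _ => rfl
  have hw' : ∀ φ : H1, form γ w φ + τ ^ 2 * inner ℝ (toL2 w) (toL2 φ)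
      = inner ℝ f (toL2 φ) - Λ' φ := fun φ => by rw [hΛ', hwφ]
  have hsplit : (‖Λ‖ * (K₀ / √c) + ‖a‖ * K₀ + 2 * (‖Λ‖ * ‖f‖ + ‖a‖ * ‖f‖)) / τ
      = (‖Λ‖ * (K₀ / √c) + ‖a‖ * K₀) / τ + 2 * ((‖Λ‖ * ‖f‖ + ‖a‖ * ‖f‖) / τ) := by ring
  have he := (Real.exp_pos (-τ * T)).le
  rw [indicatorFn_eq hw, hsplit]
  have hb1 := abs_le.1 bw
  have hb2 := abs_le.1 bv
  constructor
  · intro hk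
    have := inner_sub_ge hγ (hv τ hτ).inner_eq hw' hS hk
    rw [hΛ'] at this
    have h3 : -(Λ w + τ * inner ℝ a (toL2 w)) ≤ (‖Λ‖ * (K₀ / √c) + ‖a‖ * K₀) / τ
        + 2 * ((‖Λ‖ * ‖f‖ + ‖a‖ * ‖f‖) / τ) := by linarith [(abs_nonneg _).trans bv]
    have := mul_le_mul_of_nonneg_left h3 he
    linarith
  · intro hk
    have := inner_sub_ge_of_free hγ (hv τ hτ).inner_eq hw' hS hk
    rw [hΛ', hΛ'] at this
    have h3 : -(Λ w + τ * inner ℝ a (toL2 w)) + 2 * (Λ (v τ) + τ * inner ℝ a (toL2 (v τ)))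
        ≤ (‖Λ‖ * (K₀ / √c) + ‖a‖ * K₀) / τ
        + 2 * ((‖Λ‖ * ‖f‖ + ‖a‖ * ‖f‖) / τ) := by linarith
    have := mul_le_mul_of_nonneg_left h3 he
    linarith

/-! ### Weighted energy estimates -/

theorem integrable_mul_norm_sq {m : E3 → ℝ} (hm : Continuous m) {C : ℝ} (hC : ∀ x, |m x| ≤ C)
    (g : L2Vec) : Integrable fun x => m x * ‖g x‖ ^ 2 :=
  (integrable_norm_sq g).bdd_mul hm.aestronglyMeasurable (Eventually.of_forall hC)

theorem integrable_mul_sq {m : E3 → ℝ} (hm : Continuous m) {C : ℝ} (hC : ∀ x, |m x| ≤ C)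
    (g : L2) : Integrable fun x => m x * g x ^ 2 :=
  (Lp.memLp g).integrable_sq.bdd_mul hm.aestronglyMeasurable (Eventually.of_forall hC)

theorem integrable_mul_inner_gradient {m : E3 → ℝ} (hm : ContDiff ℝ ∞ m) {C' : ℝ}
    (hC' : ∀ x, ‖gradient m x‖ ≤ C') (u : L2) (g : L2Vec) :
    Integrable fun x => u x * inner ℝ (g x) (gradient m x) := by
  have h : MemLp (fun x => inner ℝ (g x) (gradient m x)) 2 (volume : Measure E3) := by
    refine MemLp.of_le_mul (c := C') (Lp.memLp g)
      ((Lp.memLp g).1.inner (continuous_gradient hm).aestronglyMeasurable)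
      (Eventually.of_forall fun x => ?_)
    refine (norm_inner_le_norm _ _).trans ?_
    rw [mul_comm]
    exact mul_le_mul_of_nonneg_right (hC' x) (norm_nonneg _)
  exact (Lp.memLp u).integrable_mul h

/-- The reduced equation tested with `m v`. -/
theorem IsReducedSolution.weighted {τ : ℝ} {f : L2} {v : H1}
    (hv : IsReducedSolution (fun _ => 1) τ f v) {m : E3 → ℝ} (hm : ContDiff ℝ ∞ m) {C C' : ℝ}
    (hC : ∀ x, |m x| ≤ C) (hC' : ∀ x, ‖gradient m x‖ ≤ C') :
    ∫ x, (m x * ‖grad v x‖ ^ 2 + toL2 v x * inner ℝ (grad v x) (gradient m x)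
      + τ ^ 2 * (m x * toL2 v x ^ 2)) = ∫ x, f x * (m x * toL2 v x) := by
  have h := hv.inner_eq (mulSmooth hm hC hC' v)
  have i₁ := integrable_mul_norm_sq hm.continuous hC (grad v)
  have i₂ := integrable_mul_inner_gradient hm hC' (toL2 v) (grad v)
  have i₃ := (integrable_mul_sq hm.continuous hC (toL2 v)).const_mul (τ ^ 2)
  rw [L2.inner_def, ← integral_mul_eq_inner, ← integral_mul_eq_inner] at h
  have e₁ : ∫ x, inner ℝ (grad v x) (grad (mulSmooth hm hC hC' v) x)
      = ∫ x, (m x * ‖grad v x‖ ^ 2 + toL2 v x * inner ℝ (grad v x) (gradient m x)) := by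
    refine integral_congr_ae ?_
    filter_upwards [grad_mulSmooth hm hC hC' v] with x hx
    rw [hx, inner_add_right, inner_smul_right, inner_smul_right, real_inner_self_eq_norm_sq]
  have e₂ : τ ^ 2 * ∫ x, toL2 v x * toL2 (mulSmooth hm hC hC' v) x
      = ∫ x, τ ^ 2 * (m x * toL2 v x ^ 2) := by
    rw [← integral_const_mul]
    refine integral_congr_ae ?_
    filter_upwards [toL2_mulSmooth hm hC hC' v] with x hx
    rw [hx]
    ring
  have e₃ : ∫ x, f x * toL2 (mulSmooth hm hC hC' v) x = ∫ x, f x * (m x * toL2 v x) := by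
    refine integral_congr_ae ?_
    filter_upwards [toL2_mulSmooth hm hC hC' v] with x hx
    rw [hx]
  rw [e₁, e₂, e₃] at h
  rw [← h, ← integral_add (by exact i₁.add i₂) i₃]

theorem integral_abs_mul_abs_le (g h : L2) : ∫ x, |g x| * |h x| ≤ ‖g‖ * ‖h‖ := by
  have e : ∫ x, |g x| * |h x| = inner ℝ ((Lp.memLp g).norm.toLp _) ((Lp.memLp h).norm.toLp _) := by
    rw [← integral_mul_eq_inner]
    refine integral_congr_ae ?_
    filter_upwards [(Lp.memLp g).norm.coeFn_toLp, (Lp.memLp h).norm.coeFn_toLp] with x h₁ h₂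
    rw [h₁, h₂]
    rfl
  rw [e]
  refine (real_inner_le_norm _ _).trans (le_of_eq ?_)
  rw [Lp.norm_toLp, Lp.norm_toLp, eLpNorm_norm, eLpNorm_norm, ← Lp.norm_def, ← Lp.norm_def]

/-- Agmon's estimate: a weight whose logarithmic gradient is below `2τ`. -/
theorem IsReducedSolution.agmon {τ : ℝ} (hτ : 0 ≤ τ) {f : L2} {v : H1}
    (hv : IsReducedSolution (fun _ => 1) τ f v) {m : E3 → ℝ} (hm : ContDiff ℝ ∞ m) {C δ μ : ℝ}
    (hδ0 : 0 ≤ δ) (hδ : δ ≤ 1) (hm0 : ∀ x, 0 ≤ m x) (hC : ∀ x, m x ≤ C)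
    (hgrad : ∀ x, ‖gradient m x‖ ≤ 2 * τ * (1 - δ) * m x)
    (hμ : ∀ᵐ x : E3, f x = 0 ∨ m x ≤ μ) (hμ0 : 0 ≤ μ) :
    δ * ∫ x, m x * ‖grad v x‖ ^ 2 ≤ μ * (‖f‖ * ‖toL2 v‖) := by
  have hCa : ∀ x, |m x| ≤ C := fun x => by rw [abs_of_nonneg (hm0 x)]; exact hC x
  have hC' : ∀ x, ‖gradient m x‖ ≤ 2 * τ * (1 - δ) * C := fun x =>
    (hgrad x).trans (mul_le_mul_of_nonneg_left (hC x)
      (mul_nonneg (by linarith) (by linarith)))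
  have i₁ := integrable_mul_norm_sq hm.continuous hCa (grad v)
  have i₂ := integrable_mul_inner_gradient hm hC' (toL2 v) (grad v)
  have i₃ := (integrable_mul_sq hm.continuous hCa (toL2 v)).const_mul (τ ^ 2)
  have h := hv.weighted hm hCa hC'
  have l₁ : δ * ∫ x, m x * ‖grad v x‖ ^ 2 ≤ ∫ x, (m x * ‖grad v x‖ ^ 2
      + toL2 v x * inner ℝ (grad v x) (gradient m x) + τ ^ 2 * (m x * toL2 v x ^ 2)) := by
    rw [← integral_const_mul]
    refine integral_mono_ae (i₁.const_mul δ) ((i₁.add i₂).add i₃) (Eventually.of_forall fun x => ?_)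
    simp only
    have k₁ : |toL2 v x * inner ℝ (grad v x) (gradient m x)|
        ≤ |toL2 v x| * (‖grad v x‖ * (2 * τ * (1 - δ) * m x)) := by
      rw [abs_mul]
      refine mul_le_mul_of_nonneg_left ((abs_real_inner_le_norm _ _).trans ?_) (abs_nonneg _)
      exact mul_le_mul_of_nonneg_left (hgrad x) (norm_nonneg _)
    have k₂ := neg_le_of_abs_le k₁
    -- The cross term is at most `(1-δ) m (|∇v|² + τ²v²)`, so a fraction `δ` of the gradient term
    -- survives.
    have k₃ : 0 ≤ (1 - δ) * m x * (‖grad v x‖ - τ * |toL2 v x|) ^ 2 :=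
      mul_nonneg (mul_nonneg (by linarith) (hm0 x)) (sq_nonneg _)
    have k₄ : 0 ≤ δ * m x * (τ * |toL2 v x|) ^ 2 :=
      mul_nonneg (mul_nonneg hδ0 (hm0 x)) (sq_nonneg _)
    have k₅ : |toL2 v x| ^ 2 = toL2 v x ^ 2 := sq_abs _
    rw [← k₅]
    nlinarith
  have l₂ : ∫ x, f x * (m x * toL2 v x) ≤ μ * (‖f‖ * ‖toL2 v‖) := by
    have i₄ : Integrable fun x => |f x| * |toL2 v x| :=
      (Lp.memLp f).norm.integrable_mul (Lp.memLp (toL2 v)).norm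
    calc ∫ x, f x * (m x * toL2 v x) ≤ ∫ x, μ * (|f x| * |toL2 v x|) := by
          refine integral_mono_ae
            ((Lp.memLp f).integrable_mul (memLp_mul_of_bounded hm.continuous hCa (toL2 v)))
            (i₄.const_mul μ) ?_
          filter_upwards [hμ] with x hx
          rcases hx with hx | hx
          · simp [hx]
          · refine (le_abs_self _).trans ?_
            rw [abs_mul, abs_mul, abs_of_nonneg (hm0 x)]
            have := mul_le_mul_of_nonneg_right hx
              (mul_nonneg (abs_nonneg (f x)) (abs_nonneg (toL2 v x)))
            linarith
      _ ≤ μ * (‖f‖ * ‖toL2 v‖) := by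
          rw [integral_const_mul]
          exact mul_le_mul_of_nonneg_left (integral_abs_mul_abs_le _ _) hμ0
  linarith

/-- A smooth version of the distance from a point. -/
def smoothDist (x₀ : E3) (ε : ℝ) (x : E3) : ℝ := √(‖x - x₀‖ ^ 2 + ε ^ 2)

theorem contDiff_smoothDist (x₀ : E3) {ε : ℝ} (hε : 0 < ε) : ContDiff ℝ ∞ (smoothDist x₀ ε) := by
  refine ContDiff.sqrt ?_ fun x => by positivity
  exact ((contDiff_id.sub contDiff_const).norm_sq ℝ).add contDiff_const

theorem dist_le_smoothDist (x₀ : E3) (ε : ℝ) (x : E3) : dist x x₀ ≤ smoothDist x₀ ε x := by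
  rw [dist_eq_norm]
  exact Real.le_sqrt_of_sq_le (by nlinarith [sq_nonneg ε])

/-- The constant must be exactly `1`: it bounds the logarithmic gradient of `e^{-κ smoothDist}` by
`κ`, and a larger constant would worsen the decay rate. -/
theorem lipschitzWith_smoothDist (x₀ : E3) (ε : ℝ) : LipschitzWith 1 (smoothDist x₀ ε) := by
  refine LipschitzWith.of_le_add fun x y => ?_
  have h₁ := dist_le_smoothDist x₀ ε y
  have h₂ : ‖x - x₀‖ ≤ dist y x₀ + dist x y := by
    rw [← dist_eq_norm, add_comm]
    exact dist_triangle _ _ _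
  have h₃ : smoothDist x₀ ε y ^ 2 = dist y x₀ ^ 2 + ε ^ 2 := by
    rw [smoothDist, Real.sq_sqrt (by positivity), dist_eq_norm]
  refine Real.sqrt_le_iff.2 ⟨add_nonneg (Real.sqrt_nonneg _) dist_nonneg, ?_⟩
  have h₄ : ‖x - x₀‖ ^ 2 ≤ (dist y x₀ + dist x y) ^ 2 := by gcongr
  nlinarith [mul_le_mul_of_nonneg_right h₁ (dist_nonneg (x := x) (y := y))]

theorem norm_gradient (m : E3 → ℝ) (x : E3) : ‖gradient m x‖ = ‖fderiv ℝ m x‖ :=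
  (InnerProductSpace.toDual ℝ E3).symm.norm_map _

theorem norm_gradient_exp_smoothDist_le (x₀ : E3) {ε κ : ℝ} (hε : 0 < ε) (hκ : 0 ≤ κ) (x : E3) :
    ‖gradient (fun x => Real.exp (-κ * smoothDist x₀ ε x)) x‖
      ≤ κ * Real.exp (-κ * smoothDist x₀ ε x) := by
  have h := ((((contDiff_smoothDist x₀ hε).differentiable (by simp) x).hasFDerivAt).const_mul
    (-κ)).exp
  rw [norm_gradient, h.fderiv, norm_smul, norm_smul, Real.norm_eq_abs, Real.norm_eq_abs, abs_neg,
    abs_of_nonneg hκ, abs_of_pos (Real.exp_pos _)]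
  have h₁ : ‖fderiv ℝ (smoothDist x₀ ε) x‖ ≤ 1 := by
    simpa using norm_fderiv_le_of_lipschitz ℝ (lipschitzWith_smoothDist x₀ ε) (x₀ := x)
  have := mul_le_mul_of_nonneg_left h₁ (mul_nonneg (Real.exp_pos (-κ * smoothDist x₀ ε x)).le hκ)
  linarith

/-- Agmon's estimate with `m = e^{-κ smoothDist}`, `κ = 2τ(1-δ)`, smoothed at scale `η`. Where `f`
does not vanish `m ≤ e^{-κd}`, and on the ball `smoothDist ≤ √2 η ≤ 2η`, so `m ≥ e^{-2κη}` there. -/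
theorem IsReducedSolution.integral_ball_le {τ : ℝ} (hτ : 1 ≤ τ) {f : L2} {v : H1}
    (hv : IsReducedSolution (fun _ => 1) τ f v) {x₀ : E3} {d δ η : ℝ} (hδ0 : 0 < δ) (hδ : δ ≤ 1)
    (hη : 0 < η) (hf : ∀ᵐ x : E3, f x = 0 ∨ d ≤ dist x x₀) :
    ∫ x in Metric.ball x₀ η, ‖grad v x‖ ^ 2
      ≤ ‖f‖ ^ 2 / δ * Real.exp (-(2 * τ * (1 - δ) * (d - 2 * η))) := by
  set κ := 2 * τ * (1 - δ) with hκ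
  have hκ0 : 0 ≤ κ := mul_nonneg (by linarith) (by linarith)
  set m : E3 → ℝ := fun x => Real.exp (-κ * smoothDist x₀ η x) with hm
  have hmc : ContDiff ℝ ∞ m := (contDiff_const.mul (contDiff_smoothDist x₀ hη)).exp
  have hm1 : ∀ x, m x ≤ 1 := fun x => Real.exp_le_one_iff.2 (by
    have : 0 ≤ smoothDist x₀ η x := Real.sqrt_nonneg _
    nlinarith)
  have h := hv.agmon (by linarith) hmc hδ0.le hδ (fun x => (Real.exp_pos _).le) hm1
    (norm_gradient_exp_smoothDist_le x₀ hη hκ0) (μ := Real.exp (-κ * d)) ?_ (Real.exp_pos _).le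
  · have hvn : ‖toL2 v‖ ≤ ‖f‖ := by
      have h₁ := (hv.norm_le hτ).2
      have h₂ : ‖f‖ / τ ≤ ‖f‖ := div_le_self (norm_nonneg _) hτ
      nlinarith [norm_nonneg (toL2 v)]
    have hmi := integrable_mul_norm_sq hmc.continuous (C := 1)
      (fun x => by rw [abs_of_pos (Real.exp_pos _)]; exact hm1 x) (grad v)
    have l₁ : Real.exp (-κ * (2 * η)) * ∫ x in Metric.ball x₀ η, ‖grad v x‖ ^ 2
        ≤ ∫ x, m x * ‖grad v x‖ ^ 2 := by
      rw [← integral_const_mul]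
      calc ∫ x in Metric.ball x₀ η, Real.exp (-κ * (2 * η)) * ‖grad v x‖ ^ 2
          ≤ ∫ x in Metric.ball x₀ η, m x * ‖grad v x‖ ^ 2 := by
            refine setIntegral_mono_on ((integrable_norm_sq _).const_mul _).integrableOn
              hmi.integrableOn measurableSet_ball fun x hx => ?_
            refine mul_le_mul_of_nonneg_right (Real.exp_le_exp.2 ?_) (sq_nonneg _)
            have hs : smoothDist x₀ η x ≤ 2 * η := by
              rw [Metric.mem_ball, dist_eq_norm] at hx
              refine Real.sqrt_le_iff.2 ⟨by linarith, ?_⟩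
              nlinarith [norm_nonneg (x - x₀)]
            nlinarith
        _ ≤ ∫ x, m x * ‖grad v x‖ ^ 2 :=
            setIntegral_le_integral hmi
              (Eventually.of_forall fun x => mul_nonneg (Real.exp_pos _).le (sq_nonneg _))
    have l₂ : Real.exp (-κ * d) * (‖f‖ * ‖toL2 v‖) ≤ Real.exp (-κ * d) * ‖f‖ ^ 2 := by
      rw [sq]
      gcongr
    have l₃ : δ * (Real.exp (-κ * (2 * η)) * ∫ x in Metric.ball x₀ η, ‖grad v x‖ ^ 2)
        ≤ Real.exp (-κ * d) * ‖f‖ ^ 2 :=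
      (mul_le_mul_of_nonneg_left l₁ hδ0.le).trans (h.trans l₂)
    have e₁ : Real.exp (-(κ * (d - 2 * η))) = Real.exp (-κ * d) / Real.exp (-κ * (2 * η)) := by
      rw [← Real.exp_sub]
      ring_nf
    rw [e₁, div_mul_div_comm, le_div_iff₀ (by positivity)]
    linarith
  · filter_upwards [hf] with x hx
    refine hx.imp id fun hx => Real.exp_le_exp.2 ?_
    have := hx.trans (dist_le_smoothDist x₀ η x)
    nlinarith

theorem setIntegral_le_card_mul {S : Set E3} (hS : MeasurableSet S) {t : Finset E3} {η : ℝ}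
    (hcov : S ⊆ ⋃ x ∈ t, Metric.ball x η) {g : E3 → ℝ} (hg : Integrable g) (hg0 : ∀ x, 0 ≤ g x)
    {M : ℝ} (hM : ∀ x ∈ t, ∫ y in Metric.ball x η, g y ≤ M) : ∫ y in S, g y ≤ t.card * M := by
  have hi : ∀ x ∈ t, Integrable ((Metric.ball x η).indicator g) := fun x _ =>
    hg.indicator measurableSet_ball
  calc ∫ y in S, g y = ∫ y, S.indicator g y := (integral_indicator hS).symm
    _ ≤ ∫ y, ∑ x ∈ t, (Metric.ball x η).indicator g y := by
        refine integral_mono (hg.indicator hS) (integrable_finsetSum t hi) fun y => ?_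
        have hnn : ∀ x ∈ t, 0 ≤ (Metric.ball x η).indicator g y := fun x _ =>
          indicator_nonneg (fun z _ => hg0 z) y
        by_cases hy : y ∈ S
        · obtain ⟨x, hxt, hyx⟩ := mem_iUnion₂.1 (hcov hy)
          have := Finset.single_le_sum hnn hxt
          rw [indicator_of_mem hyx] at this
          simpa [indicator_of_mem hy] using this
        · simpa [indicator_of_notMem hy] using Finset.sum_nonneg hnn
    _ = ∑ x ∈ t, ∫ y in Metric.ball x η, g y := by
        rw [integral_finsetSum t hi]
        exact Finset.sum_congr rfl fun x _ => integral_indicator measurableSet_ball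
    _ ≤ t.card * M := by
        rw [← nsmul_eq_mul]
        exact Finset.sum_le_card_nsmul t _ M hM

/-- The energy of the free solution on a compact set at distance `d` from the source. -/
theorem exists_energy_upper_bound {f : L2} {v : ℝ → H1}
    (hv : ∀ τ : ℝ, 1 ≤ τ → IsReducedSolution (fun _ => 1) τ f (v τ)) {S : Set E3}
    (hS : IsCompact S) {d δ η : ℝ} (hδ0 : 0 < δ) (hδ : δ ≤ 1) (hη : 0 < η)
    (hf : ∀ x₀ ∈ S, ∀ᵐ x : E3, f x = 0 ∨ d ≤ dist x x₀) :
    ∃ C : ℝ, ∀ τ : ℝ, 1 ≤ τ → ∫ x in S, ‖grad (v τ) x‖ ^ 2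
      ≤ C * Real.exp (-(2 * τ * (1 - δ) * (d - 2 * η))) := by
  obtain ⟨t, ht, hcov⟩ := hS.elim_nhds_subcover (fun x => Metric.ball x η)
    fun x _ => Metric.ball_mem_nhds x hη
  refine ⟨t.card * (‖f‖ ^ 2 / δ), fun τ hτ => ?_⟩
  rw [mul_assoc]
  exact setIntegral_le_card_mul hS.measurableSet hcov (integrable_norm_sq _)
    (fun _ => sq_nonneg _) fun x hx =>
      (hv τ hτ).integral_ball_le hτ hδ0 hδ hη (hf x (ht x hx))

/-! ### Radial test functions -/

/-- The weak gradient identity of `v` is applied with the test functions `∂_i z`, which moves both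
derivatives onto `z`. -/
theorem inner_grad_ofTest (v : H1) {z : E3 → ℝ} (hz : ContDiff ℝ ∞ z) (hc : HasCompactSupport z) :
    inner ℝ (grad v) (grad (ofTest hz hc))
      = - ∫ x, toL2 v x * ∑ i : Fin 3, fderiv ℝ (fun y => fderiv ℝ z y (EuclideanSpace.single i 1)) x
          (EuclideanSpace.single i 1) := by
  have hd : ∀ i : Fin 3, ContDiff ℝ ∞ fun y => fderiv ℝ z y (EuclideanSpace.single i 1) := fun i =>
    (hz.fderiv_right (m := ∞) (by simp)).clm_apply contDiff_const
  have hdc : ∀ i : Fin 3, HasCompactSupport fun y => fderiv ℝ z y (EuclideanSpace.single i 1) :=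
    fun i => hc.fderiv_apply (𝕜 := ℝ) _
  have e₁ : inner ℝ (grad v) (grad (ofTest hz hc))
      = ∫ x, ∑ i : Fin 3, grad v x i * fderiv ℝ z x (EuclideanSpace.single i 1) := by
    rw [L2.inner_def]
    refine integral_congr_ae ?_
    filter_upwards [grad_ofTest hz hc] with x hx
    rw [hx, PiLp.inner_apply]
    refine Finset.sum_congr rfl fun i _ => ?_
    rw [← gradient_coord]
    simp [mul_comm]
  rw [e₁, integral_finsetSum]
  · simp only [Finset.mul_sum]
    rw [integral_finsetSum, ← Finset.sum_neg_distrib]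
    · refine Finset.sum_congr rfl fun i _ => ?_
      have := isWeakGradient_grad v _ (hd i) (hdc i) i
      linarith
    · exact fun i _ => (Lp.memLp (toL2 v)).integrable_mul (memLp_test_deriv (hd i) (hdc i) _)
  · exact fun i _ => (memLp_coord (grad v) i).integrable_mul (memLp_test_deriv hz hc _)

theorem hasFDerivAt_norm_sub_sq (x₀ x : E3) :
    HasFDerivAt (fun y : E3 => ‖y - x₀‖ ^ 2) (2 • innerSL ℝ (x - x₀)) x :=
  ((hasFDerivAt_id x).sub_const x₀).norm_sq

theorem contDiff_norm_sub_sq (x₀ : E3) : ContDiff ℝ ∞ fun y : E3 => ‖y - x₀‖ ^ 2 :=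
  (contDiff_id.sub contDiff_const).norm_sq ℝ

theorem fderiv_radial {F : ℝ → ℝ} (hF : Differentiable ℝ F) (x₀ x e : E3) :
    fderiv ℝ (fun y => F (‖y - x₀‖ ^ 2)) x e
      = 2 * (deriv F (‖x - x₀‖ ^ 2) * inner ℝ (x - x₀) e) := by
  have h := (hF (‖x - x₀‖ ^ 2)).hasDerivAt.comp_hasFDerivAt x (hasFDerivAt_norm_sub_sq x₀ x)
  have h' : HasFDerivAt (fun y => F (‖y - x₀‖ ^ 2)) _ x := h
  rw [h'.fderiv]
  simp only [smul_apply, innerSL_apply_apply, smul_eq_mul, nsmul_eq_mul]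
  push_cast
  ring

/-- The Laplacian of a function of `q = |x - x₀|²` is `4 q F'' + 6 F'`. -/
theorem sum_fderiv_fderiv_radial {F : ℝ → ℝ} (hF : ContDiff ℝ ∞ F) (x₀ x : E3) :
    ∑ i : Fin 3, fderiv ℝ (fun y => fderiv ℝ (fun y => F (‖y - x₀‖ ^ 2)) y
      (EuclideanSpace.single i 1)) x (EuclideanSpace.single i 1)
      = 4 * ‖x - x₀‖ ^ 2 * deriv (deriv F) (‖x - x₀‖ ^ 2) + 6 * deriv F (‖x - x₀‖ ^ 2) := by
  have hF' : ContDiff ℝ ∞ (deriv F) := (contDiff_infty_iff_deriv.1 hF).2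
  have h : ∀ i : Fin 3, fderiv ℝ (fun y => fderiv ℝ (fun y => F (‖y - x₀‖ ^ 2)) y
      (EuclideanSpace.single i 1)) x (EuclideanSpace.single i 1)
      = 4 * deriv (deriv F) (‖x - x₀‖ ^ 2) * (x - x₀) i ^ 2 + 2 * deriv F (‖x - x₀‖ ^ 2) := by
    intro i
    have hfun : (fun y => fderiv ℝ (fun y => F (‖y - x₀‖ ^ 2)) y (EuclideanSpace.single i 1))
        = fun y => 2 * (deriv F (‖y - x₀‖ ^ 2)
          * innerSL ℝ (EuclideanSpace.single i (1 : ℝ) : E3) (y - x₀)) := by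
      funext y
      rw [fderiv_radial (hF.differentiable (by simp)), innerSL_apply_apply, real_inner_comm]
    have h₀ := (hF'.differentiable (by simp) (‖x - x₀‖ ^ 2)).hasDerivAt.comp_hasFDerivAt x
      (hasFDerivAt_norm_sub_sq x₀ x)
    have h₁ : HasFDerivAt (fun y : E3 => deriv F (‖y - x₀‖ ^ 2)) _ x := h₀
    have h₂ : HasFDerivAt (fun y : E3 => innerSL ℝ (EuclideanSpace.single i (1 : ℝ) : E3) (y - x₀))
        _ x := (innerSL ℝ (EuclideanSpace.single i (1 : ℝ) : E3)).hasFDerivAt.comp x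
          ((hasFDerivAt_id x).sub_const x₀)
    rw [hfun, ((h₁.fun_mul h₂).const_mul 2).fderiv]
    have e₁ : inner ℝ (EuclideanSpace.single i (1 : ℝ) : E3) (x - x₀) = (x - x₀) i := by
      simp [EuclideanSpace.inner_single_left]
    have e₂ : inner ℝ (x - x₀) (EuclideanSpace.single i (1 : ℝ) : E3) = (x - x₀) i := by
      rw [real_inner_comm, e₁]
    have e₃ : inner ℝ (EuclideanSpace.single i (1 : ℝ) : E3) (EuclideanSpace.single i (1 : ℝ) : E3)
        = (1 : ℝ) := by simp
    simp only [smul_apply, add_apply,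
      ContinuousLinearMap.comp_apply, ContinuousLinearMap.id_apply, innerSL_apply_apply,
      smul_eq_mul, nsmul_eq_mul, e₁, e₂, e₃]
    push_cast
    ring
  simp only [h]
  rw [Finset.sum_add_distrib, ← Finset.mul_sum]
  have hn : ∑ i : Fin 3, (x - x₀) i ^ 2 = ‖x - x₀‖ ^ 2 := by
    rw [EuclideanSpace.norm_sq_eq]
    simp
  rw [hn]
  simp
  ring

/-- The Yukawa potential `e^{-τ r} / r` as a function of `q = r²`. -/
def yukawa (τ q : ℝ) : ℝ := Real.exp (-τ * √q) / √q

/-- The derivative of `yukawa`. -/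
def yukawaDeriv (τ q : ℝ) : ℝ := -(τ * √q + 1) / (2 * √q ^ 3) * Real.exp (-τ * √q)

theorem hasDerivAt_yukawa (τ : ℝ) {q : ℝ} (hq : 0 < q) :
    HasDerivAt (yukawa τ) (yukawaDeriv τ q) q := by
  have hs : 0 < √q := Real.sqrt_pos.2 hq
  have h₁ : HasDerivAt (fun q => √q) (1 / (2 * √q)) q := Real.hasDerivAt_sqrt hq.ne'
  have h₂ := ((h₁.const_mul (-τ)).exp).fun_div h₁ hs.ne'
  refine h₂.congr_deriv ?_
  rw [yukawaDeriv]
  field_simp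
  ring

/-- This is `4 q y'' + 6 y' = τ² y`, the equation `Δy = τ² y` away from the centre, written in the
variable `q = r²`. -/
theorem hasDerivAt_yukawaDeriv (τ : ℝ) {q : ℝ} (hq : 0 < q) :
    HasDerivAt (yukawaDeriv τ) ((τ ^ 2 * yukawa τ q - 6 * yukawaDeriv τ q) / (4 * q)) q := by
  have hs : 0 < √q := Real.sqrt_pos.2 hq
  have h₁ : HasDerivAt (fun q => √q) (1 / (2 * √q)) q := Real.hasDerivAt_sqrt hq.ne'
  have h₂ := ((((h₁.const_mul τ).add_const 1).fun_neg.fun_div ((h₁.fun_pow 3).const_mul 2)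
    (by positivity)).fun_mul ((h₁.const_mul (-τ)).exp))
  refine h₂.congr_deriv ?_
  have hqs : q = √q ^ 2 := (Real.sq_sqrt hq.le).symm
  rw [yukawa, yukawaDeriv]
  generalize √q = s at *
  subst hqs
  field_simp
  ring

theorem contDiffAt_yukawa (τ : ℝ) {q : ℝ} (hq : 0 < q) : ContDiffAt ℝ ∞ (yukawa τ) q := by
  have h₁ : ContDiffAt ℝ ∞ (fun q => √q) q := Real.contDiffAt_sqrt hq.ne'
  exact (contDiffAt_const.mul h₁).exp.div h₁ (Real.sqrt_pos.2 hq).ne'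

section Cutoff

variable {χ : ℝ → ℝ} {a : ℝ}

theorem eventually_eq_zero_of_lt (h0 : ∀ q ≤ a, χ q = 0) {q : ℝ} (hq : q < a) : χ =ᶠ[𝓝 q] 0 := by
  filter_upwards [Iio_mem_nhds hq] with p hp
  exact h0 p (le_of_lt hp)

theorem contDiff_cutoff_yukawa (hχ : ContDiff ℝ ∞ χ) (ha : 0 < a) (h0 : ∀ q ≤ a, χ q = 0) (τ : ℝ) :
    ContDiff ℝ ∞ fun q => χ q * yukawa τ q := by
  rw [contDiff_iff_contDiffAt]
  intro q
  rcases lt_or_ge 0 q with hq | hq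
  · exact hχ.contDiffAt.mul (contDiffAt_yukawa τ hq)
  · refine (contDiffAt_const (c := (0 : ℝ))).congr_of_eventuallyEq ?_
    filter_upwards [eventually_eq_zero_of_lt h0 (hq.trans_lt ha)] with p hp
    rw [hp, Pi.zero_apply, zero_mul]

theorem deriv_eq_zero_of_lt (h0 : ∀ q ≤ a, χ q = 0) {q : ℝ} (hq : q < a) : deriv χ q = 0 := by
  rw [(eventually_eq_zero_of_lt h0 hq).deriv_eq]
  simp

theorem deriv_cutoff_yukawa (hχ : ContDiff ℝ ∞ χ) (ha : 0 < a) (h0 : ∀ q ≤ a, χ q = 0) (τ : ℝ) :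
    deriv (fun q => χ q * yukawa τ q) = fun q => deriv χ q * yukawa τ q + χ q * yukawaDeriv τ q := by
  funext q
  rcases lt_or_ge 0 q with hq | hq
  · exact ((hχ.differentiable (by simp) q).hasDerivAt.fun_mul (hasDerivAt_yukawa τ hq)).deriv
  · have hqa := hq.trans_lt ha
    have : (fun q => χ q * yukawa τ q) =ᶠ[𝓝 q] 0 := by
      filter_upwards [eventually_eq_zero_of_lt h0 hqa] with p hp
      rw [hp, Pi.zero_apply, zero_mul]
    rw [this.deriv_eq, deriv_eq_zero_of_lt h0 hqa, h0 q hqa.le]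
    simp

/-- The defect of `χ(q) e^{-τ r} / r` in the reduced equation. -/
def cutoffDefect (χ : ℝ → ℝ) (τ q : ℝ) : ℝ :=
  Real.exp (-τ * √q) * (-4 * τ * deriv χ q + (4 * q * deriv (deriv χ) q + 2 * deriv χ q) / √q)

/-- The terms with undifferentiated `χ` cancel by the Yukawa equation, so the defect contains only
derivatives of `χ`. Near `q ≤ 0`, where `yukawa` is singular, everything vanishes with `χ`. -/
theorem cutoff_yukawa_eq (hχ : ContDiff ℝ ∞ χ) (ha : 0 < a) (h0 : ∀ q ≤ a, χ q = 0) (τ q : ℝ) :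
    4 * q * deriv (deriv fun q => χ q * yukawa τ q) q + 6 * deriv (fun q => χ q * yukawa τ q) q
      - τ ^ 2 * (χ q * yukawa τ q) = cutoffDefect χ τ q := by
  have hχ' : ContDiff ℝ ∞ (deriv χ) := (contDiff_infty_iff_deriv.1 hχ).2
  rw [deriv_cutoff_yukawa hχ ha h0]
  beta_reduce
  rcases lt_or_ge 0 q with hq | hq
  · have h := ((hχ'.differentiable (by simp) q).hasDerivAt.fun_mul (hasDerivAt_yukawa τ hq)).fun_add
      ((hχ.differentiable (by simp) q).hasDerivAt.fun_mul (hasDerivAt_yukawaDeriv τ hq))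
    rw [h.deriv, cutoffDefect]
    have hs : 0 < √q := Real.sqrt_pos.2 hq
    have hqs : q = √q ^ 2 := (Real.sq_sqrt hq.le).symm
    rw [yukawa, yukawaDeriv]
    generalize deriv (deriv χ) q = A
    generalize deriv χ q = A'
    generalize χ q = A''
    generalize √q = s at *
    subst hqs
    field_simp
    ring
  · have hqa := hq.trans_lt ha
    have h1 : ∀ q ≤ a / 2, deriv χ q = 0 := fun p hp => deriv_eq_zero_of_lt h0 (by linarith)
    have h2 : deriv (deriv χ) q = 0 := deriv_eq_zero_of_lt h1 (by linarith)
    have : (fun q => deriv χ q * yukawa τ q + χ q * yukawaDeriv τ q) =ᶠ[𝓝 q] 0 := by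
      filter_upwards [eventually_eq_zero_of_lt h0 hqa,
        eventually_eq_zero_of_lt h1 (by linarith : q < a / 2)] with p hp hp'
      rw [hp, hp', Pi.zero_apply, zero_mul, zero_mul, add_zero]
    rw [this.deriv_eq, cutoffDefect, deriv_eq_zero_of_lt h0 hqa, h0 q hqa.le, h2]
    simp

end Cutoff

/-! ### Lower bound for the energy of the free solution -/

theorem cutoffDefect_eq_zero {χ : ℝ → ℝ} {k τ q : ℝ} (h : χ =ᶠ[𝓝 q] fun _ => k) :
    cutoffDefect χ τ q = 0 := by
  have h₁ : deriv χ =ᶠ[𝓝 q] fun _ => 0 := by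
    have := h.deriv
    rwa [deriv_const'] at this
  have h₂ : deriv (deriv χ) q = 0 := by rw [h₁.deriv_eq, deriv_const]
  rw [cutoffDefect, h₁.eq_of_nhds, h₂]
  simp

/-- The defect lives where `χ` is not locally constant: on the inner shell `a ≤ q ≤ b`, where
`e^{-τ√q} ≤ 1` suffices, and on the outer shell `c ≤ q ≤ e`, where it is at most `e^{-τ√c}`. -/
theorem exists_cutoffDefect_bound {χ : ℝ → ℝ} (hχ : ContDiff ℝ ∞ χ) (hχc : HasCompactSupport χ)
    {a b c e : ℝ} (ha : 0 < a) (h0 : ∀ q ≤ a, χ q = 0) (h1 : ∀ q ∈ Icc b c, χ q = 1)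
    (h2 : ∀ q ≥ e, χ q = 0) :
    ∃ C : ℝ, 0 ≤ C ∧ ∀ τ q : ℝ, 1 ≤ τ → |cutoffDefect χ τ q|
      ≤ C * τ * ((Iic b).indicator (fun _ => 1) q
        + (Iic e).indicator (fun _ => Real.exp (-τ * √c)) q) := by
  have hχ' : ContDiff ℝ ∞ (deriv χ) := (contDiff_infty_iff_deriv.1 hχ).2
  obtain ⟨M₁, hM₁⟩ := hχc.deriv.exists_bound_of_continuous hχ'.continuous
  obtain ⟨M₂, hM₂⟩ := hχc.deriv.deriv.exists_bound_of_continuous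
    (contDiff_infty_iff_deriv.1 hχ').2.continuous
  have hM₁0 : 0 ≤ M₁ := (norm_nonneg _).trans (hM₁ 0)
  have hM₂0 : 0 ≤ M₂ := (norm_nonneg _).trans (hM₂ 0)
  have hsa : 0 < √a := Real.sqrt_pos.2 ha
  set C := 4 * M₁ + (4 * |e| * M₂ + 2 * M₁) / √a with hC
  have hC0 : 0 ≤ C := by positivity
  refine ⟨C, hC0, fun τ q hτ => ?_⟩
  have hRHS : 0 ≤ C * τ * ((Iic b).indicator (fun _ => 1) q
        + (Iic e).indicator (fun _ => Real.exp (-τ * √c)) q) := by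
    refine mul_nonneg (mul_nonneg hC0 (by linarith)) (add_nonneg ?_ ?_)
    · exact indicator_nonneg (fun _ _ => zero_le_one) _
    · exact indicator_nonneg (fun _ _ => (Real.exp_pos _).le) _
  rcases lt_or_ge q a with hqa | hqa
  · rw [cutoffDefect_eq_zero (k := 0) (eventually_eq_zero_of_lt h0 hqa), abs_zero]
    exact hRHS
  rcases lt_or_ge e q with hqe | hqe
  · have : χ =ᶠ[𝓝 q] fun _ => 0 := by
      filter_upwards [Ioi_mem_nhds hqe] with p hp
      exact h2 p (le_of_lt hp)
    rw [cutoffDefect_eq_zero this, abs_zero]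
    exact hRHS
  have hq0 : 0 < q := ha.trans_le hqa
  have hsq : √a ≤ √q := Real.sqrt_le_sqrt hqa
  have hbr : |-4 * τ * deriv χ q + (4 * q * deriv (deriv χ) q + 2 * deriv χ q) / √q| ≤ C * τ := by
    have k₁ : |-4 * τ * deriv χ q| ≤ 4 * M₁ * τ := by
      rw [abs_mul, abs_mul, abs_neg, abs_of_pos (by linarith : (0 : ℝ) < τ)]
      norm_num
      have := hM₁ q
      rw [Real.norm_eq_abs] at this
      nlinarith
    have k₂ : |(4 * q * deriv (deriv χ) q + 2 * deriv χ q) / √q|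
        ≤ (4 * |e| * M₂ + 2 * M₁) / √a := by
      rw [abs_div, abs_of_pos (Real.sqrt_pos.2 hq0)]
      refine div_le_div₀ (by positivity) ((abs_add_le _ _).trans (add_le_add ?_ ?_)) hsa hsq
      · rw [abs_mul, abs_mul, abs_of_pos hq0]
        norm_num
        exact mul_le_mul (by linarith [le_abs_self e]) (hM₂ q) (abs_nonneg _) (by positivity)
      · rw [abs_mul]
        norm_num
        exact hM₁ q
    have k₃ : (4 * |e| * M₂ + 2 * M₁) / √a ≤ (4 * |e| * M₂ + 2 * M₁) / √a * τ :=
      le_mul_of_one_le_right (by positivity) hτ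
    refine (abs_add_le _ _).trans ?_
    rw [hC, add_mul]
    linarith
  have hCτ : 0 ≤ C * τ := mul_nonneg hC0 (by linarith)
  have hexp : |cutoffDefect χ τ q| ≤ C * τ * Real.exp (-τ * √q) := by
    rw [cutoffDefect, abs_mul, abs_of_pos (Real.exp_pos _), mul_comm]
    exact mul_le_mul_of_nonneg_right hbr (Real.exp_pos _).le
  rcases le_or_gt q b with hqb | hqb
  · refine hexp.trans (mul_le_mul_of_nonneg_left ?_ hCτ)
    rw [indicator_of_mem (show q ∈ Iic b from hqb)]
    have : Real.exp (-τ * √q) ≤ 1 := Real.exp_le_one_iff.2 (by nlinarith [Real.sqrt_nonneg q])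
    exact this.trans (le_add_of_nonneg_right (indicator_nonneg (fun _ _ => (Real.exp_pos _).le) _))
  rcases lt_or_ge q c with hqc | hqc
  · have : χ =ᶠ[𝓝 q] fun _ => 1 := by
      filter_upwards [Ioo_mem_nhds hqb hqc] with p hp
      exact h1 p ⟨hp.1.le, hp.2.le⟩
    rw [cutoffDefect_eq_zero this, abs_zero]
    exact hRHS
  · refine hexp.trans (mul_le_mul_of_nonneg_left ?_ hCτ)
    rw [indicator_of_mem (show q ∈ Iic e from hqe)]
    have : Real.exp (-τ * √q) ≤ Real.exp (-τ * √c) := by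
      refine Real.exp_le_exp.2 ?_
      have := Real.sqrt_le_sqrt hqc
      nlinarith
    exact this.trans (le_add_of_nonneg_left (indicator_nonneg (fun _ _ => zero_le_one) _))

theorem integrableOn_abs (v : L2) {U : Set E3} (hU : volume U ≠ ⊤) :
    IntegrableOn (fun x => |v x|) U := by
  have : IsFiniteMeasure (volume.restrict U) := ⟨by simpa using hU.lt_top⟩
  exact ((Lp.memLp v).norm.restrict U).integrable one_le_two

/-- Cauchy-Schwarz, read off from the discriminant of `s ↦ ∫_U (|v| - s)² ≥ 0`. -/
theorem sq_setIntegral_abs_le (v : L2) {U : Set E3} (hU : volume U ≠ ⊤) :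
    (∫ x in U, |v x|) ^ 2 ≤ volume.real U * ∫ x in U, v x ^ 2 := by
  have hsq : IntegrableOn (fun x => v x ^ 2) U := (Lp.memLp v).integrable_sq.integrableOn
  have hab := integrableOn_abs v hU
  have key : ∀ s : ℝ, 0 ≤ (∫ x in U, v x ^ 2) - 2 * s * (∫ x in U, |v x|) + s ^ 2 * volume.real U := by
    intro s
    have e : ∫ x in U, (|v x| - s) ^ 2
        = (∫ x in U, v x ^ 2) - 2 * s * (∫ x in U, |v x|) + s ^ 2 * volume.real U := by
      have i₂ : IntegrableOn (fun x => v x ^ 2 - 2 * s * |v x|) U := hsq.sub (hab.const_mul _)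
      rw [← integral_const_mul, ← integral_sub hsq (hab.const_mul _), mul_comm (s ^ 2),
        ← smul_eq_mul (volume.real U), ← setIntegral_const,
        ← integral_add i₂ (integrableOn_const hU)]
      refine integral_congr_ae (Eventually.of_forall fun x => ?_)
      simp only [← sq_abs (v x)]
      ring
    rw [← e]
    exact integral_nonneg fun x => sq_nonneg _
  have h := discrim_le_zero (a := volume.real U) (b := -2 * ∫ x in U, |v x|)
    (c := ∫ x in U, v x ^ 2) fun s => by
      have := key s
      nlinarith
  rw [discrim] at h
  nlinarith

/-- The equation is tested with `ζ² v`, where `ζ` is a bump supported away from the source. The term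
`τ² ζ² v²`, with `τ ≥ 1`, has to be balanced by `2 ζ v ∇v·∇ζ`, so `v` is controlled by its gradient,
with a constant independent of `τ`. -/
theorem exists_local_energy_bound (x₀ : E3) {r r₀ : ℝ} (hr : 0 < r) (hrr : r < r₀) :
    ∃ C : ℝ, 0 ≤ C ∧ ∀ (τ : ℝ) (f : L2) (v : H1), 1 ≤ τ → IsReducedSolution (fun _ => 1) τ f v →
      (∀ᵐ x : E3, x ∈ Metric.ball x₀ r₀ → f x = 0) →
      ∫ x in Metric.closedBall x₀ r, toL2 v x ^ 2
        ≤ C * ∫ x in Metric.ball x₀ r₀, ‖grad v x‖ ^ 2 := by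
  let ζ : ContDiffBump x₀ := ⟨r, r₀, hr, hrr⟩
  have hζ : ContDiff ℝ ∞ ζ := ζ.contDiff
  have hζc : HasCompactSupport ζ := ζ.hasCompactSupport
  have hζ0 : ∀ x, x ∉ Metric.ball x₀ r₀ → ζ x = 0 := fun x hx => ζ.zero_of_le_dist (by
    simpa using hx)
  have hgc : HasCompactSupport (gradient ζ) :=
    (hζc.fderiv (𝕜 := ℝ)).comp_left (map_zero (InnerProductSpace.toDual ℝ E3).symm)
  obtain ⟨M, hM⟩ := hgc.exists_bound_of_continuous (continuous_gradient hζ)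
  have hM0 : 0 ≤ M := (norm_nonneg _).trans (hM 0)
  have hm : ContDiff ℝ ∞ fun x => ζ x ^ 2 := hζ.pow 2
  have hgm : ∀ x, gradient (fun x => ζ x ^ 2) x = (2 * ζ x) • gradient ζ x := by
    intro x
    have h := ((hζ.differentiable (by simp) x).hasFDerivAt).pow 2
    have h' : HasFDerivAt (fun x => ζ x ^ 2) _ x := h
    rw [gradient, gradient, h'.fderiv, ← map_smul]
    congr 1
    ext y
    simp
  have hζ1 : ∀ x, |ζ x| ≤ 1 := fun x => by rw [abs_of_nonneg ζ.nonneg]; exact ζ.le_one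
  have hC : ∀ x, |ζ x ^ 2| ≤ 1 := fun x => by
    rw [abs_pow]
    exact pow_le_one₀ (abs_nonneg _) (hζ1 x)
  have hC' : ∀ x, ‖gradient (fun x => ζ x ^ 2) x‖ ≤ 2 * M := fun x => by
    rw [hgm, norm_smul, Real.norm_eq_abs, abs_mul, abs_two]
    have := mul_le_mul (hζ1 x) (hM x) (norm_nonneg _) zero_le_one
    linarith
  refine ⟨4 * M ^ 2, by positivity, fun τ f v hτ hv hf => ?_⟩
  have h := hv.weighted hm hC hC'
  have hrhs : ∫ x, f x * (ζ x ^ 2 * toL2 v x) = 0 := by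
    refine integral_eq_zero_of_ae ?_
    filter_upwards [hf] with x hx
    by_cases hxb : x ∈ Metric.ball x₀ r₀
    · simp [hx hxb]
    · simp [hζ0 x hxb]
  rw [hrhs] at h
  have i₁ := integrable_mul_norm_sq hm.continuous hC (grad v)
  have i₂ := integrable_mul_inner_gradient hm hC' (toL2 v) (grad v)
  have i₃ := integrable_mul_sq hm.continuous hC (toL2 v)
  have i₄ : Integrable ((Metric.ball x₀ r₀).indicator fun x => ‖grad v x‖ ^ 2) :=
    (integrable_norm_sq (grad v)).indicator measurableSet_ball
  have hle : ∫ x, (1 / 2 * (ζ x ^ 2 * toL2 v x ^ 2)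
      - 2 * M ^ 2 * (Metric.ball x₀ r₀).indicator (fun x => ‖grad v x‖ ^ 2) x) ≤ 0 := by
    rw [← h]
    refine integral_mono_ae ((i₃.const_mul _).sub (i₄.const_mul _))
      ((i₁.add i₂).add (i₃.const_mul (τ ^ 2))) (Eventually.of_forall fun x => ?_)
    simp only
    by_cases hxb : x ∈ Metric.ball x₀ r₀
    · rw [indicator_of_mem hxb, hgm, inner_smul_right]
      have k₁ : |inner ℝ (grad v x) (gradient ζ x)| ≤ ‖grad v x‖ * M :=
        (abs_real_inner_le_norm _ _).trans (mul_le_mul_of_nonneg_left (hM x) (norm_nonneg _))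
      have k₂ : inner ℝ (grad v x) (gradient ζ x) ^ 2 ≤ (‖grad v x‖ * M) ^ 2 :=
        sq_le_sq' (abs_le.1 k₁).1 (abs_le.1 k₁).2
      set y := ζ x * toL2 v x with hy
      have k₃ : toL2 v x * (2 * ζ x * inner ℝ (grad v x) (gradient ζ x))
          = 2 * y * inner ℝ (grad v x) (gradient ζ x) := by rw [hy]; ring
      have k₄ : ζ x ^ 2 * toL2 v x ^ 2 = y ^ 2 := by rw [hy]; ring
      have k₅ : 0 ≤ ζ x ^ 2 * ‖grad v x‖ ^ 2 := by positivity
      have k₆ : y ^ 2 ≤ τ ^ 2 * y ^ 2 := le_mul_of_one_le_left (sq_nonneg _) (by nlinarith)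
      rw [k₃, k₄]
      -- Half of this square is `y²/2 + 2 y g + 2 g²`, where `g` is the inner product; hence the
      -- factors `1/2` and `2 M²`.
      nlinarith [sq_nonneg (y + 2 * inner ℝ (grad v x) (gradient ζ x))]
    · rw [indicator_of_notMem hxb, hgm, hζ0 x hxb]
      simp
  rw [integral_sub (i₃.const_mul _) (i₄.const_mul _), integral_const_mul, integral_const_mul,
    integral_indicator measurableSet_ball] at hle
  have hin : ∫ x in Metric.closedBall x₀ r, toL2 v x ^ 2 ≤ ∫ x, ζ x ^ 2 * toL2 v x ^ 2 := by
    calc ∫ x in Metric.closedBall x₀ r, toL2 v x ^ 2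
        = ∫ x in Metric.closedBall x₀ r, ζ x ^ 2 * toL2 v x ^ 2 := by
          refine setIntegral_congr_fun measurableSet_closedBall fun x hx => ?_
          rw [ζ.one_of_mem_closedBall hx]
          ring
      _ ≤ ∫ x, ζ x ^ 2 * toL2 v x ^ 2 :=
          setIntegral_le_integral i₃ (Eventually.of_forall fun x => by positivity)
  linarith

theorem abs_integral_mul_cutoffDefect_le (v : L2) (x₀ : E3) {χ : ℝ → ℝ} {b c e C τ : ℝ}
    (hb : 0 ≤ b) (he : 0 ≤ e)
    (hC : ∀ q : ℝ, |cutoffDefect χ τ q| ≤ C * τ * ((Iic b).indicator (fun _ => 1) q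
        + (Iic e).indicator (fun _ => Real.exp (-τ * √c)) q)) :
    |∫ x, v x * cutoffDefect χ τ (‖x - x₀‖ ^ 2)|
      ≤ C * τ * ((∫ x in Metric.closedBall x₀ √b, |v x|)
        + Real.exp (-τ * √c) * ∫ x in Metric.closedBall x₀ √e, |v x|) := by
  have hi : ∀ r : ℝ, Integrable ((Metric.closedBall x₀ r).indicator fun x => |v x|) := fun r =>
    (integrable_indicator_iff measurableSet_closedBall).2
      (integrableOn_abs v measure_closedBall_lt_top.ne)
  have hmem : ∀ {s : ℝ} (x : E3), 0 ≤ s → (x ∈ Metric.closedBall x₀ √s ↔ ‖x - x₀‖ ^ 2 ≤ s) := by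
    intro s x hs
    rw [Metric.mem_closedBall, dist_eq_norm, Real.le_sqrt (norm_nonneg _) hs]
  rw [← integral_indicator measurableSet_closedBall, ← integral_indicator measurableSet_closedBall,
    ← integral_const_mul, ← integral_add (hi _) ((hi _).const_mul _), ← integral_const_mul,
    ← Real.norm_eq_abs]
  refine norm_integral_le_of_norm_le (((hi _).add ((hi _).const_mul _)).const_mul _)
    (Eventually.of_forall fun x => ?_)
  rw [norm_mul, Real.norm_eq_abs, Real.norm_eq_abs]
  refine (mul_le_mul_of_nonneg_left (hC _) (abs_nonneg _)).trans (le_of_eq ?_)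
  have hind : ∀ {s : ℝ}, 0 ≤ s → (Metric.closedBall x₀ √s).indicator (fun x => |v x|) x
      = if ‖x - x₀‖ ^ 2 ≤ s then |v x| else 0 := by
    intro s hs
    by_cases h : ‖x - x₀‖ ^ 2 ≤ s
    · rw [indicator_of_mem ((hmem x hs).2 h), if_pos h]
    · rw [indicator_of_notMem (fun h' => h ((hmem x hs).1 h')), if_neg h]
  rw [hind hb, hind he]
  simp only [indicator_apply, mem_Iic]
  split_ifs <;> ring

theorem IsReducedSolution.integral_mul_radial {τ : ℝ} {f : L2} {v : H1}
    (hv : IsReducedSolution (fun _ => 1) τ f v) (x₀ : E3) {χ : ℝ → ℝ} (hχ : ContDiff ℝ ∞ χ)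
    {a e : ℝ} (ha : 0 < a) (h0 : ∀ q ≤ a, χ q = 0) (h2 : ∀ q ≥ e, χ q = 0) (he : 0 ≤ e) :
    ∫ x, f x * (χ (‖x - x₀‖ ^ 2) * yukawa τ (‖x - x₀‖ ^ 2))
      = - ∫ x, toL2 v x * cutoffDefect χ τ (‖x - x₀‖ ^ 2) := by
  have hF := contDiff_cutoff_yukawa hχ ha h0 τ
  have hz : ContDiff ℝ ∞ fun x : E3 => χ (‖x - x₀‖ ^ 2) * yukawa τ (‖x - x₀‖ ^ 2) :=
    hF.comp (contDiff_norm_sub_sq x₀)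
  have hzc : HasCompactSupport fun x : E3 => χ (‖x - x₀‖ ^ 2) * yukawa τ (‖x - x₀‖ ^ 2) := by
    refine HasCompactSupport.intro (isCompact_closedBall x₀ √e) fun x hx => ?_
    rw [h2, zero_mul]
    rw [Metric.mem_closedBall, dist_eq_norm, Real.le_sqrt (norm_nonneg _) he, not_le] at hx
    exact hx.le
  have h := hv.inner_eq (ofTest hz hzc)
  rw [inner_grad_ofTest] at h
  simp only [sum_fderiv_fderiv_radial hF] at h
  rw [← integral_mul_eq_inner, ← integral_mul_eq_inner] at h
  have e₁ : ∀ g : L2, ∫ x, g x * toL2 (ofTest hz hzc) x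
      = ∫ x, g x * (χ (‖x - x₀‖ ^ 2) * yukawa τ (‖x - x₀‖ ^ 2)) := by
    intro g
    refine integral_congr_ae ?_
    filter_upwards [toL2_ofTest hz hzc] with x hx
    rw [hx]
  rw [e₁, e₁] at h
  rw [← h]
  have i₁ : Integrable fun x => toL2 v x *
      (χ (‖x - x₀‖ ^ 2) * yukawa τ (‖x - x₀‖ ^ 2)) :=
    (Lp.memLp (toL2 v)).integrable_mul (memLp_test hz hzc)
  have i₂ : Integrable fun x => toL2 v x *
      (4 * ‖x - x₀‖ ^ 2 * deriv (deriv fun q => χ q * yukawa τ q) (‖x - x₀‖ ^ 2)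
        + 6 * deriv (fun q => χ q * yukawa τ q) (‖x - x₀‖ ^ 2)) := by
    simp only [← sum_fderiv_fderiv_radial hF, Finset.mul_sum]
    refine integrable_finsetSum _ fun i _ => ?_
    exact (Lp.memLp (toL2 v)).integrable_mul (memLp_test_deriv
      ((hz.fderiv_right (m := ∞) (by simp)).clm_apply contDiff_const)
      (hzc.fderiv_apply (𝕜 := ℝ) _) _)
  have e₂ : ∫ x, toL2 v x * cutoffDefect χ τ (‖x - x₀‖ ^ 2)
      = (∫ x, toL2 v x * (4 * ‖x - x₀‖ ^ 2 * deriv (deriv fun q => χ q * yukawa τ q) (‖x - x₀‖ ^ 2)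
        + 6 * deriv (fun q => χ q * yukawa τ q) (‖x - x₀‖ ^ 2)))
        - τ ^ 2 * ∫ x, toL2 v x * (χ (‖x - x₀‖ ^ 2) * yukawa τ (‖x - x₀‖ ^ 2)) := by
    rw [← integral_const_mul, ← integral_sub i₂ (i₁.const_mul _)]
    refine integral_congr_ae (Eventually.of_forall fun x => ?_)
    simp only [← cutoff_yukawa_eq hχ ha h0]
    ring
  rw [e₂]
  ring

theorem exists_cutoff {a b c : ℝ} (hab : a < b) (hbc : b < c) :
    ∃ (χ : ℝ → ℝ) (e : ℝ), c < e ∧ ContDiff ℝ ∞ χ ∧ HasCompactSupport χ ∧ (∀ q, 0 ≤ χ q) ∧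
      (∀ q ≤ a, χ q = 0) ∧ (∀ q ∈ Icc b c, χ q = 1) ∧ (∀ q ≥ e, χ q = 0) := by
  let ζ : ContDiffBump ((b + c) / 2) := ⟨(c - b) / 2, (c - b) / 2 + (b - a), by linarith, by linarith⟩
  have hout : ζ.rOut = (c - b) / 2 + (b - a) := rfl
  have hin : ζ.rIn = (c - b) / 2 := rfl
  refine ⟨ζ, c + (b - a), by linarith, ζ.contDiff, ζ.hasCompactSupport, fun q => ζ.nonneg, ?_, ?_, ?_⟩
  · intro q hq
    refine ζ.zero_of_le_dist ?_
    rw [Real.dist_eq, hout]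
    exact le_trans (by linarith) (neg_le_abs _)
  · intro q hq
    refine ζ.one_of_mem_closedBall ?_
    rw [Metric.mem_closedBall, Real.dist_eq, hin, abs_le]
    exact ⟨by linarith [hq.1], by linarith [hq.2]⟩
  · intro q hq
    refine ζ.zero_of_le_dist ?_
    rw [Real.dist_eq, hout]
    exact le_trans (by linarith) (le_abs_self _)

theorem add_mul_sq_le {P Q E A a b : ℝ} (hP : P ^ 2 ≤ a * A) (hQ : Q ^ 2 ≤ b) (hA : 0 ≤ A)
    (ha : 0 ≤ a) (hb : 0 ≤ b) : (P + E * Q) ^ 2 ≤ 2 * ((a + b) * (A + E ^ 2)) := by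
  have s₁ : (P + E * Q) ^ 2 ≤ 2 * (P ^ 2 + E ^ 2 * Q ^ 2) := by
    linarith [sq_nonneg (P - E * Q), (by ring : (P + E * Q) ^ 2 + (P - E * Q) ^ 2
      = 2 * (P ^ 2 + E ^ 2 * Q ^ 2))]
  have s₂ : E ^ 2 * Q ^ 2 ≤ E ^ 2 * b := mul_le_mul_of_nonneg_left hQ (sq_nonneg _)
  have s₃ : 0 ≤ a * E ^ 2 := by positivity
  have s₄ : 0 ≤ b * A := by positivity
  linarith

/-- The energy of the free solution near a point `x₀` at distance at most `R` from a part of the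
source. -/
theorem exists_energy_lower_bound {f : L2} {v : ℝ → H1}
    (hv : ∀ τ : ℝ, 1 ≤ τ → IsReducedSolution (fun _ => 1) τ f (v τ)) {x₀ y₀ : E3} {r₀ ρ R c₁ σ : ℝ}
    (hr₀ : 0 < r₀) (hρ : 0 < ρ) (hc₁ : 0 < c₁) (hσ : σ ^ 2 = 1)
    (hf0 : ∀ᵐ x : E3, x ∈ Metric.ball x₀ r₀ → f x = 0) (hfσ : ∀ᵐ x : E3, 0 ≤ σ * f x)
    (hfc : ∀ᵐ x : E3, x ∈ Metric.ball y₀ ρ → c₁ ≤ σ * f x)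
    (hshell : ∀ x ∈ Metric.ball y₀ ρ, r₀ ≤ dist x x₀ ∧ dist x x₀ ≤ R) :
    ∃ κ C : ℝ, 0 < κ ∧ 0 ≤ C ∧ ∀ τ : ℝ, 1 ≤ τ → κ * Real.exp (-(2 * τ * R))
      ≤ C * τ ^ 2 * ((∫ x in Metric.ball x₀ r₀, ‖grad (v τ) x‖ ^ 2)
        + Real.exp (-(2 * τ * (R + 1)))) := by
  have hrR : r₀ ≤ R :=
    (hshell y₀ (Metric.mem_ball_self hρ)).1.trans (hshell y₀ (Metric.mem_ball_self hρ)).2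
  have hR : 0 < R := hr₀.trans_le hrR
  -- In terms of the radius, `χ` vanishes up to `r₀/4` and equals `1` from `r₀/2` to `R + 1`. The
  -- source ball lies where `χ = 1`, the inner shell in the region controlled by
  -- `exists_local_energy_bound`, and the outer defect gains `e^{-τ}` over `e^{-τR}`.
  obtain ⟨χ, e, hce, hχ, hχc, hχ0, h0, h1, h2⟩ := exists_cutoff
    (a := (r₀ / 4) ^ 2) (b := (r₀ / 2) ^ 2) (c := (R + 1) ^ 2) (by nlinarith) (by nlinarith)
  have he : 0 ≤ e := (sq_nonneg (R + 1)).trans hce.le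
  obtain ⟨C₁, hC₁0, hC₁⟩ := exists_cutoffDefect_bound hχ hχc (by positivity) h0 h1 h2
  obtain ⟨C₂, hC₂0, hC₂⟩ := exists_local_energy_bound x₀ (r := r₀ / 2) (r₀ := r₀) (by linarith)
    (by linarith)
  have hsb : √((r₀ / 2) ^ 2) = r₀ / 2 := Real.sqrt_sq (by linarith)
  have hsc : √((R + 1) ^ 2) = R + 1 := Real.sqrt_sq (by linarith)
  set V₁ := volume.real (Metric.closedBall x₀ (r₀ / 2)) with hV₁
  set V₂ := volume.real (Metric.closedBall x₀ √e) with hV₂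
  set V := volume.real (Metric.ball y₀ ρ) with hV
  have hVpos : 0 < V :=
    ENNReal.toReal_pos (Metric.measure_ball_pos volume y₀ hρ).ne' measure_ball_lt_top.ne
  refine ⟨(c₁ * V / R) ^ 2, 2 * C₁ ^ 2 * (V₁ * C₂ + V₂ * ‖f‖ ^ 2), by positivity, by positivity,
    fun τ hτ => ?_⟩
  have hτ0 : 0 < τ := by linarith
  set z : E3 → ℝ := fun x => χ (‖x - x₀‖ ^ 2) * yukawa τ (‖x - x₀‖ ^ 2) with hz
  have hz0 : ∀ x, 0 ≤ z x := fun x => mul_nonneg (hχ0 _) (by unfold yukawa; positivity)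
  have hzc : ContDiff ℝ ∞ z :=
    (contDiff_cutoff_yukawa hχ (by positivity) h0 τ).comp (contDiff_norm_sub_sq x₀)
  have hzcs : HasCompactSupport z := by
    refine HasCompactSupport.intro (isCompact_closedBall x₀ √e) fun x hx => ?_
    rw [Metric.mem_closedBall, dist_eq_norm, Real.le_sqrt (norm_nonneg _) he, not_le] at hx
    simp only [hz]
    rw [h2 _ hx.le, zero_mul]
  have hzl : ∀ x ∈ Metric.ball y₀ ρ, Real.exp (-τ * R) / R ≤ z x := by
    intro x hx
    obtain ⟨l₁, l₂⟩ := hshell x hx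
    rw [dist_eq_norm] at l₁ l₂
    simp only [hz]
    rw [h1 _ ⟨by nlinarith, by nlinarith⟩, one_mul, yukawa, Real.sqrt_sq (norm_nonneg _)]
    refine div_le_div₀ (Real.exp_pos _).le (Real.exp_le_exp.2 ?_) (by linarith) l₂
    nlinarith
  have iσ : Integrable fun x => σ * f x * z x := by
    have := ((Lp.memLp f).integrable_mul (memLp_test hzc hzcs)).const_mul σ
    refine this.congr (Eventually.of_forall fun x => ?_)
    simp [mul_assoc]
  -- As `σ f` and `z` are nonnegative, no cancellation occurs and only the ball about `y₀` is kept.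
  have lower : c₁ * V / R * Real.exp (-τ * R) ≤ σ * ∫ x, f x * z x := by
    calc c₁ * V / R * Real.exp (-τ * R)
        = ∫ _x in Metric.ball y₀ ρ, c₁ * (Real.exp (-τ * R) / R) := by
          rw [setIntegral_const, smul_eq_mul]
          ring
      _ ≤ ∫ x in Metric.ball y₀ ρ, σ * f x * z x := by
          refine setIntegral_mono_on_ae (integrableOn_const measure_ball_lt_top.ne)
            iσ.integrableOn measurableSet_ball ?_
          filter_upwards [hfc] with x hx hxb
          exact mul_le_mul (hx hxb) (hzl x hxb) (by positivity) (hc₁.le.trans (hx hxb))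
      _ ≤ ∫ x, σ * f x * z x := by
          refine setIntegral_le_integral iσ ?_
          filter_upwards [hfσ] with x hx
          exact mul_nonneg hx (hz0 x)
      _ = σ * ∫ x, f x * z x := by
          rw [← integral_const_mul]
          simp only [mul_assoc]
  have upper := abs_integral_mul_cutoffDefect_le (toL2 (v τ)) x₀ (sq_nonneg (r₀ / 2)) he
    fun q => hC₁ τ q hτ
  rw [hsb, hsc] at upper
  have heq := (hv τ hτ).integral_mul_radial x₀ hχ (by positivity) h0 h2 he
  set I := ∫ x, f x * z x with hI
  set P := ∫ x in Metric.closedBall x₀ (r₀ / 2), |toL2 (v τ) x| with hP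
  set Q := ∫ x in Metric.closedBall x₀ √e, |toL2 (v τ) x| with hQ
  set A := ∫ x in Metric.ball x₀ r₀, ‖grad (v τ) x‖ ^ 2 with hA
  set E := Real.exp (-τ * (R + 1)) with hE
  have hIle : I ^ 2 ≤ (C₁ * τ * (P + E * Q)) ^ 2 := by
    rw [show I = _ from heq, neg_sq]
    exact sq_le_sq' (neg_le_of_abs_le upper) (le_of_abs_le upper)
  have hlow : (c₁ * V / R * Real.exp (-τ * R)) ^ 2 ≤ I ^ 2 := by
    have := pow_le_pow_left₀ (by positivity) lower 2
    rwa [mul_pow σ, hσ, one_mul] at this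
  have hP2 : P ^ 2 ≤ V₁ * C₂ * A := by
    rw [mul_assoc]
    refine (sq_setIntegral_abs_le _ measure_closedBall_lt_top.ne).trans ?_
    exact mul_le_mul_of_nonneg_left (hC₂ τ f (v τ) hτ (hv τ hτ) hf0) measureReal_nonneg
  have hQ2 : Q ^ 2 ≤ V₂ * ‖f‖ ^ 2 := by
    refine (sq_setIntegral_abs_le _ measure_closedBall_lt_top.ne).trans ?_
    refine mul_le_mul_of_nonneg_left ?_ measureReal_nonneg
    have hvn : ‖toL2 (v τ)‖ ≤ ‖f‖ := by
      have h₁ := ((hv τ hτ).norm_le hτ).2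
      have h₂ : ‖f‖ / τ ≤ ‖f‖ := div_le_self (norm_nonneg _) hτ
      nlinarith [norm_nonneg (toL2 (v τ))]
    calc ∫ x in Metric.closedBall x₀ √e, toL2 (v τ) x ^ 2 ≤ ∫ x, toL2 (v τ) x ^ 2 :=
          setIntegral_le_integral (Lp.memLp _).integrable_sq (Eventually.of_forall fun x => sq_nonneg _)
      _ = ‖toL2 (v τ)‖ ^ 2 := (norm_sq_eq_integral_L2 _).symm
      _ ≤ ‖f‖ ^ 2 := by gcongr
  have hA0 : 0 ≤ A := integral_nonneg fun x => sq_nonneg _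
  have hE2 : E ^ 2 = Real.exp (-(2 * τ * (R + 1))) := by
    rw [hE, ← Real.exp_nat_mul]
    congr 1
    push_cast
    ring
  have hR2 : Real.exp (-τ * R) ^ 2 = Real.exp (-(2 * τ * R)) := by
    rw [← Real.exp_nat_mul]
    congr 1
    push_cast
    ring
  rw [mul_pow, hR2] at hlow
  rw [← hE2]
  have hV₁0 : 0 ≤ V₁ := measureReal_nonneg
  have hV₂0 : 0 ≤ V₂ := measureReal_nonneg
  have hsum : (P + E * Q) ^ 2 ≤ 2 * ((V₁ * C₂ + V₂ * ‖f‖ ^ 2) * (A + E ^ 2)) := by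
    exact add_mul_sq_le hP2 hQ2 hA0 (by positivity) (by positivity)
  calc (c₁ * V / R) ^ 2 * Real.exp (-(2 * τ * R)) ≤ (C₁ * τ * (P + E * Q)) ^ 2 := hlow.trans hIle
    _ = (C₁ * τ) ^ 2 * (P + E * Q) ^ 2 := by ring
    _ ≤ (C₁ * τ) ^ 2 * (2 * ((V₁ * C₂ + V₂ * ‖f‖ ^ 2) * (A + E ^ 2))) :=
        mul_le_mul_of_nonneg_left hsum (sq_nonneg _)
    _ = _ := by ring

/-! ### Geometry of the inclusion and of the emission set -/

/-- The cone is scale invariant up to its truncation at `h`, so one `σ` serves all `s`. With `k =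
cos θ` the requirement is `(1 + σ) k ≤ 1 - σ`, which `σ = (1 - k)/3` satisfies. -/
theorem exists_ball_subset_cone (x : E3) {n : E3} {h θ : ℝ} (hn : ‖n‖ = 1) (hθ0 : 0 < θ)
    (hθ : θ ≤ Real.pi) :
    ∃ σ : ℝ, 0 < σ ∧ σ ≤ 1 ∧ ∀ s : ℝ, 0 < s → 2 * s ≤ h →
      Metric.ball (x + s • n) (s * σ) ⊆ cone x n h θ \ {x} := by
  have hk : Real.cos θ < 1 := by
    have := Real.cos_lt_cos_of_nonneg_of_le_pi le_rfl hθ hθ0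
    rwa [Real.cos_zero] at this
  have hk' : -1 ≤ Real.cos θ := Real.neg_one_le_cos θ
  refine ⟨(1 - Real.cos θ) / 3, by linarith, by linarith, fun s hs hsh y hy => ?_⟩
  set k := Real.cos θ
  set σ := (1 - k) / 3 with hσ
  obtain ⟨w, rfl⟩ : ∃ w : E3, y = x + s • n + w := ⟨y - (x + s • n), by abel⟩
  rw [Metric.mem_ball, dist_eq_norm, add_sub_cancel_left] at hy
  have e : x + s • n + w - x = s • n + w := by abel
  have h₁ : ‖s • n + w‖ ≤ s + s * σ := by
    refine (norm_add_le _ _).trans (add_le_add (le_of_eq ?_) hy.le)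
    rw [norm_smul, hn, mul_one, Real.norm_eq_abs, abs_of_pos hs]
  have h₂ : s - s * σ ≤ inner ℝ (s • n + w) n := by
    rw [inner_add_left, inner_smul_left, real_inner_self_eq_norm_sq, hn]
    have := (abs_le.1 (abs_real_inner_le_norm w n)).1
    rw [hn, mul_one] at this
    simp only [conj_trivial]
    linarith
  have hpos : 0 < s - s * σ := by
    have : 0 < s * (1 - σ) := mul_pos hs (by linarith)
    linarith
  refine ⟨⟨?_, ?_⟩, ?_⟩
  · rw [e]
    have : s * σ ≤ s * 1 := mul_le_mul_of_nonneg_left (by linarith) hs.le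
    linarith
  · rw [e]
    refine le_trans ?_ h₂
    rcases le_or_gt k 0 with hk0 | hk0
    · exact (mul_nonpos_of_nonneg_of_nonpos (norm_nonneg _) hk0).trans hpos.le
    · refine (mul_le_mul_of_nonneg_right h₁ hk0.le).trans ?_
      have : 0 ≤ s * (1 - σ - (1 + σ) * k) := mul_nonneg hs.le (by nlinarith)
      linarith
  · intro hx
    have hw : s • n + w = 0 := by
      rw [← e, hx, sub_self]
    rw [hw, inner_zero_left] at h₂
    linarith

/-- A set with the cone condition has frontier of measure zero. -/
theorem ConeCondition.volume_frontier {B : Set E3} (hB : IsOpen B) (hC : ConeCondition B) :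
    volume (frontier B) = 0 := by
  -- At almost every point outside `B` the density of `B` is zero. A frontier point of the open set
  -- `B` lies outside `B`, yet the cone there contains balls of a fixed proportion at every small
  -- scale.
  have hd := Besicovitch.ae_tendsto_measure_inter_div_of_measurableSet (volume : Measure E3)
    hB.measurableSet
  refine measure_mono_null (fun x hx => ?_) (ae_iff.1 hd)
  intro ht
  have hxB : x ∉ B := by
    rw [hB.frontier_eq] at hx
    exact hx.2
  rw [indicator_of_notMem hxB] at ht
  obtain ⟨n, h, θ, hn, hh, hθ0, hθ, hsub⟩ := hC x hx
  obtain ⟨σ, hσ0, hσ1, hball⟩ := exists_ball_subset_cone x (h := h) hn hθ0 hθ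
  set ρ : ℝ≥0∞ := volume (Metric.ball (0 : E3) σ) / volume (Metric.closedBall (0 : E3) 2) with hρ
  have hρ0 : 0 < ρ := ENNReal.div_pos (Metric.measure_ball_pos volume _ hσ0).ne'
    measure_closedBall_lt_top.ne
  have hev : ∀ᶠ r in 𝓝[>] (0 : ℝ),
      volume (B ∩ Metric.closedBall x r) / volume (Metric.closedBall x r) < ρ :=
    ht.eventually (gt_mem_nhds hρ0)
  obtain ⟨r, hr, hrI⟩ := (hev.and (Ioo_mem_nhdsGT hh)).exists
  have hs : 0 < r / 2 := by linarith [hrI.1]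
  have hsubB : Metric.ball (x + (r / 2) • n) (r / 2 * σ) ⊆ B ∩ Metric.closedBall x r := by
    intro y hy
    refine ⟨hsub (hball (r / 2) hs (by linarith [hrI.2]) hy), ?_⟩
    rw [Metric.mem_ball] at hy
    rw [Metric.mem_closedBall]
    refine (dist_triangle _ (x + (r / 2) • n) _).trans ?_
    have : dist (x + (r / 2) • n) x = r / 2 := by
      rw [dist_eq_norm, add_sub_cancel_left, norm_smul, hn, mul_one, Real.norm_eq_abs,
        abs_of_pos hs]
    have h2 : r / 2 * σ ≤ r / 2 := mul_le_of_le_one_right hs.le hσ1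
    linarith
  refine absurd hr (not_lt.2 ?_)
  have e₁ := Measure.addHaar_ball_mul_of_pos (volume : Measure E3) (x + (r / 2) • n) hs σ
  have e₂ := Measure.addHaar_closedBall_mul_of_pos (volume : Measure E3) x hs 2
  rw [show r / 2 * 2 = r by ring] at e₂
  have hne : ENNReal.ofReal ((r / 2) ^ Module.finrank ℝ E3) ≠ 0 := by
    rw [Ne, ENNReal.ofReal_eq_zero, not_le]
    positivity
  calc ρ = volume (Metric.ball (x + (r / 2) • n) (r / 2 * σ)) / volume (Metric.closedBall x r) := by
        rw [e₁, e₂, hρ, ENNReal.mul_div_mul_left _ _ hne ENNReal.ofReal_ne_top]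
    _ ≤ _ := ENNReal.div_le_div_right (measure_mono hsubB) _

theorem ConeCondition.frontier_subset {D : Set E3} (hC : ConeCondition D) :
    frontier D ⊆ closure (interior D) := by
  intro x hx
  obtain ⟨n, h, θ, hn, hh, hθ0, hθ, hsub⟩ := hC x hx
  obtain ⟨σ, hσ0, hσ1, hball⟩ := exists_ball_subset_cone x (h := h) hn hθ0 hθ
  rw [Metric.mem_closure_iff]
  intro ε hε
  set s := min (ε / 2) (h / 2) with hs
  have hs0 : 0 < s := lt_min (by linarith) (by linarith)
  refine ⟨x + s • n, ?_, ?_⟩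
  · refine mem_interior.2 ⟨_, (hball s hs0 ?_).trans hsub, Metric.isOpen_ball,
      Metric.mem_ball_self (by positivity)⟩
    linarith [min_le_right (ε / 2) (h / 2)]
  · rw [dist_comm, dist_eq_norm, add_sub_cancel_left, norm_smul, hn, mul_one, Real.norm_eq_abs,
      abs_of_pos hs0]
    linarith [min_le_left (ε / 2) (h / 2)]

/-- Points with `g < 0` are interior to `D`. If none accumulated at `x`, then `g ≥ 0` near `x` while
`g x ≤ 0`, so `x` would be a local minimum with vanishing differential. -/
theorem HasC1Boundary.frontier_subset {D : Set E3} (hC : HasC1Boundary D) :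
    frontier D ⊆ closure (interior D) := by
  intro x hx
  obtain ⟨r, g, hr, hg, hg', hgD⟩ := hC x hx
  by_contra hcl
  have hxr : x ∈ Metric.ball x r := Metric.mem_ball_self hr
  have hgc : ContinuousOn g (Metric.ball x r) := hg.continuousOn
  have hgx : g x ≤ 0 := by
    by_contra h
    push Not at h
    have hev : ∀ᶠ y in 𝓝 x, 0 < g y ∧ y ∈ Metric.ball x r :=
      ((hgc.continuousAt (Metric.ball_mem_nhds x hr)).eventually (lt_mem_nhds h)).and
        (Metric.ball_mem_nhds x hr)
    obtain ⟨y, hyD, hy⟩ := (mem_closure_iff_frequently.1 hx.1).and_eventually hev |>.exists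
    exact (hgD y hy.2).2 hy.1 hyD
  have hmin : IsLocalMin g x := by
    have hev : ∀ᶠ y in 𝓝 x, y ∉ closure (interior D) :=
      isClosed_closure.isOpen_compl.mem_nhds hcl
    filter_upwards [hev, Metric.ball_mem_nhds x hr] with y hy hyr
    refine hgx.trans ?_
    by_contra h
    push Not at h
    refine hy (subset_closure (mem_interior_iff_mem_nhds.2 ?_))
    filter_upwards [(hgc.continuousAt (Metric.isOpen_ball.mem_nhds hyr)).eventually (gt_mem_nhds h),
      Metric.isOpen_ball.mem_nhds hyr] with w hw hwr
    exact (hgD w hwr).1 hw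
  exact hg' x hxr hmin.fderiv_eq_zero

theorem setDist_le {D B : Set E3} {x y : E3} (hx : x ∈ closure D) (hy : y ∈ closure B) :
    setDist D B ≤ dist x y := by
  have h : ∀ p ∈ closure D ×ˢ closure B, setDist D B ≤ dist p.1 p.2 := by
    rw [← closure_prod_eq]
    intro p hp
    refine closure_minimal (s := D ×ˢ B) ?_ (isClosed_le continuous_const continuous_dist) hp
    intro p hp
    rw [mem_ofPred_eq, setDist]
    refine csInf_le ⟨0, ?_⟩ ⟨p.1, hp.1, p.2, hp.2, rfl⟩
    rintro _ ⟨_, _, _, _, rfl⟩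
    exact dist_nonneg
  exact h (x, y) ⟨hx, hy⟩

theorem setDist_nonneg (D B : Set E3) : 0 ≤ setDist D B :=
  Real.sInf_nonneg (by rintro _ ⟨_, _, _, _, rfl⟩; exact dist_nonneg)

/-- A nearly optimal point of `D` is moved into the interior, so that a whole ball around it lies in
`D`; the strict inequality leaves room for this. -/
theorem exists_mem_interior_dist_lt {D B : Set E3} (hD : D.Nonempty) (hB : B.Nonempty)
    (hfr : frontier D ⊆ closure (interior D)) {R : ℝ} (hR : setDist D B < R) :
    ∃ x ∈ interior D, ∃ y ∈ B, dist x y < R := by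
  obtain ⟨x, hx⟩ := hD
  obtain ⟨y, hy⟩ := hB
  have hne : {r : ℝ | ∃ x ∈ D, ∃ y ∈ B, r = dist x y}.Nonempty := ⟨dist x y, x, hx, y, hy, rfl⟩
  obtain ⟨_, ⟨x, hx, y, hy, rfl⟩, hlt⟩ := exists_lt_of_csInf_lt hne hR
  have hxc : x ∈ closure (interior D) := by
    by_cases hi : x ∈ interior D
    · exact subset_closure hi
    · exact hfr ⟨subset_closure hx, hi⟩
  obtain ⟨x', hx', hxx'⟩ := Metric.mem_closure_iff.1 hxc (R - dist x y) (by linarith)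
  refine ⟨x', hx', y, hy, ?_⟩
  linarith [dist_triangle x' x y, dist_comm x x']

/-- On `∂B` the emission condition says nothing about the sign of `f`, so this set has to be null.
-/
theorem EmissionCondition.exists_sign {B : Set E3} {f : L2} (hf : EmissionCondition B f)
    (hB : volume (frontier B) = 0) :
    ∃ c₁ σ : ℝ, 0 < c₁ ∧ σ ^ 2 = 1 ∧ (∀ᵐ x : E3, 0 ≤ σ * f x) ∧
      ∀ᵐ x : E3, x ∈ B → c₁ ≤ σ * f x := by
  obtain ⟨hsupp, c₁, hc₁, hsign⟩ := hf
  obtain ⟨σ, hσ, hpos⟩ : ∃ σ : ℝ, σ ^ 2 = 1 ∧ ∀ᵐ x : E3, x ∈ B → c₁ ≤ σ * f x := by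
    rcases hsign with h | h
    · exact ⟨1, by norm_num, by simpa using h⟩
    · exact ⟨-1, by norm_num, by simpa using h⟩
  refine ⟨c₁, σ, hc₁, hσ, ?_, hpos⟩
  filter_upwards [hsupp, hpos, measure_eq_zero_iff_ae_notMem.1 hB] with x h₁ h₂ h₃
  by_cases hx : x ∈ closure B
  · have hxB : x ∈ B := by
      by_contra h
      exact h₃ ⟨hx, fun hi => h (interior_subset hi)⟩
    exact hc₁.le.trans (h₂ hxB)
  · rw [h₁ hx, mul_zero]

/-! ### Asymptotics of the indicator function -/

theorem one_mulVec_dotProduct (p : E3) :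
    ((1 : Matrix (Fin 3) (Fin 3) ℝ) *ᵥ p.ofLp) ⬝ᵥ p.ofLp = ‖p‖ ^ 2 := by
  rw [Matrix.one_mulVec, dotProduct_eq_inner, real_inner_self_eq_norm_sq]

section

variable {γ : E3 → Matrix (Fin 3) (Fin 3) ℝ} {D : Set E3}

/-- For `c ≥ 1` the left side is nonnegative and may be restricted to any `S ⊆ D`. For `c ≤ 1` it is
nonpositive, and `S` may be enlarged beyond `D`, because there the right side is `‖p - q‖²`. The
second case allows the measurable set `closure D` in place of `D`. -/
theorem indicator_le_of_lower_bound (hγ_out : ∀ᵐ x : E3, x ∉ D → γ x = 1) {c : ℝ} (hc : 0 < c)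
    (h : ∀ᵐ x : E3, x ∈ D → ∀ ξ : E3, c * ‖ξ‖ ^ 2 ≤ (γ x *ᵥ ξ.ofLp) ⬝ᵥ ξ.ofLp) {S : Set E3}
    (hS : S ⊆ D ∧ 1 ≤ c ∨ D ⊆ S ∧ c ≤ 1) :
    ∀ᵐ x : E3, ∀ p q : E3, S.indicator (fun _ => (1 - 1 / c) * ‖q‖ ^ 2) x
      ≤ ‖p - q‖ ^ 2 + ((γ x *ᵥ p.ofLp) ⬝ᵥ p.ofLp - ‖p‖ ^ 2) := by
  filter_upwards [hγ_out, h] with x h₁ h₂ p q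
  have hpos : 1 ≤ c → 0 ≤ (1 - 1 / c) * ‖q‖ ^ 2 := fun hc1 =>
    mul_nonneg (by rw [sub_nonneg, div_le_one hc]; exact hc1) (sq_nonneg _)
  have hneg : c ≤ 1 → (1 - 1 / c) * ‖q‖ ^ 2 ≤ 0 := fun hc1 =>
    mul_nonpos_of_nonpos_of_nonneg (by rw [sub_nonpos, one_le_div hc]; exact hc1) (sq_nonneg _)
  by_cases hx : x ∈ D
  · refine le_trans ?_ ((norm_sub_sq_add_ge p q hc).trans ?_)
    · rcases hS with ⟨-, hc1⟩ | ⟨hDS, -⟩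
      · exact indicator_le_self' (fun _ _ => hpos hc1) x
      · rw [indicator_of_mem (hDS hx)]
    · linarith [h₂ hx p]
  · rw [h₁ hx, one_mulVec_dotProduct, sub_self, add_zero]
    refine le_trans ?_ (sq_nonneg _)
    rcases hS with ⟨hSD, -⟩ | ⟨-, hc1⟩
    · rw [indicator_of_notMem fun h => hx (hSD h)]
    · exact indicator_nonpos (fun _ _ => hneg hc1) x

theorem indicator_le_of_upper_bound (hγ_out : ∀ᵐ x : E3, x ∉ D → γ x = 1) {c : ℝ}
    (h : ∀ᵐ x : E3, x ∈ D → ∀ ξ : E3, (γ x *ᵥ ξ.ofLp) ⬝ᵥ ξ.ofLp ≤ c * ‖ξ‖ ^ 2) {S : Set E3}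
    (hS : S ⊆ D ∧ c ≤ 1 ∨ D ⊆ S ∧ 1 ≤ c) :
    ∀ᵐ x : E3, ∀ q : E3, S.indicator (fun _ => (1 - c) * ‖q‖ ^ 2) x
      ≤ ‖q‖ ^ 2 - (γ x *ᵥ q.ofLp) ⬝ᵥ q.ofLp := by
  filter_upwards [hγ_out, h] with x h₁ h₂ q
  by_cases hx : x ∈ D
  · refine le_trans ?_ (by linarith [h₂ hx q] : (1 - c) * ‖q‖ ^ 2 ≤ _)
    rcases hS with ⟨-, hc1⟩ | ⟨hDS, -⟩
    · exact indicator_le_self' (fun _ _ => mul_nonneg (by linarith) (sq_nonneg _)) x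
    · rw [indicator_of_mem (hDS hx)]
  · rw [h₁ hx, one_mulVec_dotProduct, sub_self]
    rcases hS with ⟨hSD, -⟩ | ⟨-, hc1⟩
    · rw [indicator_of_notMem fun h => hx (hSD h)]
    · exact indicator_nonpos
        (fun _ _ => mul_nonpos_of_nonpos_of_nonneg (by linarith) (sq_nonneg _)) x

end

theorem exists_rate {d β : ℝ} (hd : 0 ≤ d) (hβ : β < 2 * d) :
    ∃ δ η : ℝ, 0 < δ ∧ δ ≤ 1 ∧ 0 < η ∧ β ≤ 2 * (1 - δ) * (d - 2 * η) := by
  set g := 2 * d - β with hg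
  have hg0 : 0 < g := by linarith
  set δ := min 1 (g / (4 * (d + 1))) with hδ
  have hδ0 : 0 < δ := lt_min one_pos (by positivity)
  -- Of the gap `g = 2d - β`, the loss `4η` uses one half and the loss `2δd ≤ g/2` at most the
  -- other.
  refine ⟨δ, g / 8, hδ0, min_le_left _ _, by positivity, ?_⟩
  have h₁ : δ * (4 * (d + 1)) ≤ g := by
    rw [← le_div_iff₀ (by positivity)]
    exact min_le_right _ _
  have h₂ : 0 ≤ δ * g := by positivity
  nlinarith

/-- Exponential decay of the Dirichlet energy of the free solution, at any rate below `2 d`. -/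
theorem exists_energy_le_exp {D B : Set E3} (hD : Bornology.IsBounded D) {f : L2}
    (hf : ∀ᵐ x : E3, x ∉ closure B → f x = 0) {v : ℝ → H1}
    (hv : ∀ τ : ℝ, 1 ≤ τ → IsReducedSolution (fun _ => 1) τ f (v τ)) {β : ℝ}
    (hβ : β < 2 * setDist D B) :
    ∃ C : ℝ, 0 ≤ C ∧ ∀ τ : ℝ, 1 ≤ τ →
      ∫ x in closure D, ‖grad (v τ) x‖ ^ 2 ≤ C * Real.exp (-(τ * β)) := by
  obtain ⟨δ, η, hδ0, hδ, hη, hβ'⟩ := exists_rate (setDist_nonneg D B) hβ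
  obtain ⟨C, hC⟩ := exists_energy_upper_bound hv hD.isCompact_closure (d := setDist D B) hδ0 hδ hη
    fun x₀ hx₀ => by
      filter_upwards [hf] with x hx
      by_cases hxB : x ∈ closure B
      · right
        rw [dist_comm]
        exact setDist_le hx₀ hxB
      · exact Or.inl (hx hxB)
  refine ⟨|C|, abs_nonneg _, fun τ hτ => (hC τ hτ).trans ?_⟩
  refine mul_le_mul (le_abs_self C) (Real.exp_le_exp.2 ?_) (Real.exp_pos _).le (abs_nonneg _)
  have := mul_le_mul_of_nonneg_left hβ' (by linarith : (0 : ℝ) ≤ τ)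
  linarith

theorem tendsto_sq_mul_exp_neg {α : ℝ} (hα : 0 < α) :
    Tendsto (fun τ : ℝ => τ ^ 2 * Real.exp (-(α * τ))) atTop (𝓝 0) := by
  have := tendsto_rpow_mul_exp_neg_mul_atTop_nhds_zero 2 α hα
  simpa using this

/-- The Dirichlet energy of the free solution decays at no rate above `2 d`. -/
theorem exists_exp_le_energy {D B : Set E3} (hD : D.Nonempty) (hB : B.Nonempty) (hBo : IsOpen B)
    (hBD : closure B ∩ closure D = ∅) (hfr : frontier D ⊆ closure (interior D))
    (hB0 : volume (frontier B) = 0) {f : L2} (hf : EmissionCondition B f) {v : ℝ → H1}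
    (hv : ∀ τ : ℝ, 1 ≤ τ → IsReducedSolution (fun _ => 1) τ f (v τ)) {β : ℝ}
    (hβ : 2 * setDist D B < β) :
    ∃ S : Set E3, S ⊆ D ∧ MeasurableSet S ∧
      ∀ᶠ τ : ℝ in atTop, Real.exp (-(τ * β)) ≤ ∫ x in S, ‖grad (v τ) x‖ ^ 2 := by
  obtain ⟨c₁, σ, hc₁, hσ, hσf, hσc⟩ := hf.exists_sign hB0
  -- Strictly between `setDist D B` and `β / 2`: the first gives the points `x₀`, `y₀`, the second
  -- makes `e^{-τβ}` negligible against `e^{-2τR}`, even multiplied by `τ²`.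
  set R := (setDist D B + β / 2) / 2 with hR
  obtain ⟨x₀, hx₀, y₀, hy₀, hxy⟩ := exists_mem_interior_dist_lt hD hB hfr
    (R := R) (by linarith)
  obtain ⟨r₀, hr₀, hrD⟩ := Metric.mem_nhds_iff.1 (mem_interior_iff_mem_nhds.1 hx₀)
  obtain ⟨ρ', hρ', hρB⟩ := Metric.isOpen_iff.1 hBo y₀ hy₀
  have hdisj : ∀ x, x ∈ closure B → x ∉ closure D := fun x h₁ h₂ => by
    have : x ∈ closure B ∩ closure D := ⟨h₁, h₂⟩
    rw [hBD] at this
    exact this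
  set ρ := min ρ' (R - dist x₀ y₀) with hρ
  have hρ0 : 0 < ρ := lt_min hρ' (by linarith)
  have hρB' : Metric.ball y₀ ρ ⊆ B := (Metric.ball_subset_ball (min_le_left _ _)).trans hρB
  have hf0 : ∀ᵐ x : E3, x ∈ Metric.ball x₀ r₀ → f x = 0 := by
    filter_upwards [hf.1] with x hx hxb
    exact hx fun h => hdisj x h (subset_closure (hrD hxb))
  have hfc : ∀ᵐ x : E3, x ∈ Metric.ball y₀ ρ → c₁ ≤ σ * f x := by
    filter_upwards [hσc] with x hx hxb
    exact hx (hρB' hxb)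
  have hshell : ∀ x ∈ Metric.ball y₀ ρ, r₀ ≤ dist x x₀ ∧ dist x x₀ ≤ R := by
    intro x hx
    constructor
    · by_contra h
      push Not at h
      exact hdisj x (subset_closure (hρB' hx)) (subset_closure (hrD h))
    · rw [Metric.mem_ball] at hx
      have := min_le_right ρ' (R - dist x₀ y₀)
      linarith [dist_triangle x y₀ x₀, dist_comm x₀ y₀]
  obtain ⟨κ, C, hκ, hC, hlow⟩ := exists_energy_lower_bound hv hr₀ hρ0 hc₁ hσ
    hf0 hσf hfc hshell
  refine ⟨Metric.ball x₀ r₀, hrD, measurableSet_ball, ?_⟩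
  have hα : 0 < β - 2 * R := by linarith
  have hlim : Tendsto (fun τ : ℝ => C * (τ ^ 2 * Real.exp (-((β - 2 * R) * τ))
      + τ ^ 2 * Real.exp (-(2 * τ)))) atTop (𝓝 0) := by
    simpa using ((tendsto_sq_mul_exp_neg hα).add (tendsto_sq_mul_exp_neg two_pos)).const_mul C
  filter_upwards [hlim.eventually (gt_mem_nhds hκ), eventually_ge_atTop 1] with τ h₁ h₂
  by_contra h
  push Not at h
  have h₃ := hlow τ h₂
  have h₄ : κ * Real.exp (-(2 * τ * R)) ≤ C * τ ^ 2 * (Real.exp (-(τ * β))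
      + Real.exp (-(2 * τ * (R + 1)))) :=
    h₃.trans (mul_le_mul_of_nonneg_left (by linarith) (by positivity))
  have e₁ : Real.exp (-(τ * β)) = Real.exp (-((β - 2 * R) * τ)) * Real.exp (-(2 * τ * R)) := by
    rw [← Real.exp_add]
    ring_nf
  have e₂ : Real.exp (-(2 * τ * (R + 1))) = Real.exp (-(2 * τ)) * Real.exp (-(2 * τ * R)) := by
    rw [← Real.exp_add]
    ring_nf
  rw [e₁, e₂] at h₄
  have h₅ := mul_lt_mul_of_pos_right h₁ (Real.exp_pos (-(2 * τ * R)))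
  nlinarith

/-- Constants disappear after division by `τ`, so bounds at every rate near `ℓ` suffice. Lower
bounds are needed only for `β < T`, where the error `e^{-τT}` is negligible. One of them gives `|I
τ| > 0` eventually, which monotonicity of `Real.log` requires in the upper estimate. -/
theorem tendsto_log_abs_div {I : ℝ → ℝ} {ℓ T : ℝ} (hℓT : ℓ < T)
    (hup : ∀ β < ℓ, ∃ C : ℝ, 0 < C ∧ ∀ᶠ τ : ℝ in atTop, |I τ| ≤ C * Real.exp (-(τ * β)))
    (hlow : ∀ β, ℓ < β → β < T →
      ∃ k : ℝ, 0 < k ∧ ∀ᶠ τ : ℝ in atTop, k * Real.exp (-(τ * β)) ≤ |I τ|) :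
    Tendsto (fun τ : ℝ => 1 / τ * Real.log |I τ|) atTop (𝓝 (-ℓ)) := by
  have hlim : ∀ a β : ℝ, Tendsto (fun τ : ℝ => 1 / τ * a - β) atTop (𝓝 (-β)) := by
    intro a β
    have h : Tendsto (fun τ : ℝ => 1 / τ) atTop (𝓝 0) := by
      simpa using tendsto_inv_atTop_zero (𝕜 := ℝ)
    simpa using (h.mul_const a).sub_const β
  have hlog : ∀ {k τ β : ℝ}, 0 < k → 0 < τ →
      1 / τ * Real.log (k * Real.exp (-(τ * β))) = 1 / τ * Real.log k - β := by
    intro k τ β hk hτ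
    rw [Real.log_mul hk.ne' (Real.exp_pos _).ne', Real.log_exp]
    field_simp
    ring
  obtain ⟨β₀, hβ₀, hβ₀T⟩ := exists_between hℓT
  obtain ⟨k₀, hk₀, hev₀⟩ := hlow β₀ hβ₀ hβ₀T
  have hpos : ∀ᶠ τ : ℝ in atTop, 0 < |I τ| := by
    filter_upwards [hev₀] with τ hτ
    exact lt_of_lt_of_le (by positivity) hτ
  rw [tendsto_order]
  constructor
  · intro a ha
    obtain ⟨β, hβ, hβ'⟩ := exists_between (lt_min (by linarith : ℓ < -a) hℓT)
    obtain ⟨k, hk, hev⟩ := hlow β hβ (hβ'.trans_le (min_le_right _ _))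
    have haβ : a < -β := by linarith [hβ'.trans_le (min_le_left _ _)]
    filter_upwards [hev, (hlim (Real.log k) β).eventually (lt_mem_nhds haβ), eventually_gt_atTop 0]
      with τ h₁ h₂ h₃
    refine h₂.trans_le ?_
    rw [← hlog hk h₃]
    exact mul_le_mul_of_nonneg_left (Real.log_le_log (by positivity) h₁) (by positivity)
  · intro a ha
    obtain ⟨β, hβ, hβ'⟩ := exists_between (by linarith : -a < ℓ)
    obtain ⟨C, hC, hev⟩ := hup β hβ'
    have haβ : -β < a := by linarith
    filter_upwards [hev, (hlim (Real.log C) β).eventually (gt_mem_nhds haβ), eventually_gt_atTop 0,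
      hpos] with τ h₁ h₂ h₃ h₄
    refine lt_of_le_of_lt ?_ h₂
    rw [← hlog hC h₃]
    exact mul_le_mul_of_nonneg_left (Real.log_le_log h₄ h₁) (by positivity)

theorem tendsto_const_div_atTop (K : ℝ) : Tendsto (fun τ : ℝ => K / τ) atTop (𝓝 0) :=
  tendsto_const_nhds.div_atTop tendsto_id

/-- Below the threshold time: the rescaled indicator tends to zero. -/
theorem tendsto_exp_mul_zero {I : ℝ → ℝ} {T K C β : ℝ} (hβ : T < β)
    (hI : ∀ τ : ℝ, 1 ≤ τ → |I τ| ≤ C * Real.exp (-(τ * β)) + Real.exp (-τ * T) * (K / τ)) :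
    Tendsto (fun τ : ℝ => Real.exp (τ * T) * I τ) atTop (𝓝 0) := by
  have hlim : Tendsto (fun τ : ℝ => C * Real.exp (-((β - T) * τ)) + K / τ) atTop (𝓝 0) := by
    have h₁ : Tendsto (fun τ : ℝ => Real.exp (-((β - T) * τ))) atTop (𝓝 0) :=
      Real.tendsto_exp_neg_atTop_nhds_zero.comp
        (tendsto_id.const_mul_atTop (by linarith : 0 < β - T))
    simpa using (h₁.const_mul C).add (tendsto_const_div_atTop K)
  refine squeeze_zero_norm' ?_ hlim
  filter_upwards [eventually_ge_atTop 1] with τ hτ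
  rw [norm_mul, Real.norm_eq_abs, Real.norm_eq_abs, abs_of_pos (Real.exp_pos _)]
  refine (mul_le_mul_of_nonneg_left (hI τ hτ) (Real.exp_pos _).le).trans (le_of_eq ?_)
  have e₁ : Real.exp (-((β - T) * τ)) = Real.exp (τ * T) * Real.exp (-(τ * β)) := by
    rw [← Real.exp_add]
    ring_nf
  have e₂ : Real.exp (τ * T) * Real.exp (-τ * T) = 1 := by
    rw [← Real.exp_add]
    ring_nf
    exact Real.exp_zero
  rw [e₁]
  linear_combination (K / τ) * e₂

/-- Above the threshold time: the rescaled indicator tends to infinity. -/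
theorem tendsto_exp_mul_atTop {I : ℝ → ℝ} {T K k β : ℝ} (hβ : β < T) (hk : 0 < k)
    (hI : ∀ᶠ τ : ℝ in atTop, k * Real.exp (-(τ * β)) ≤ I τ + Real.exp (-τ * T) * (K / τ)) :
    Tendsto (fun τ : ℝ => Real.exp (τ * T) * I τ) atTop atTop := by
  have hlim : Tendsto (fun τ : ℝ => k * Real.exp ((T - β) * τ) - K / τ) atTop atTop := by
    have h₁ : Tendsto (fun τ : ℝ => Real.exp ((T - β) * τ)) atTop atTop :=
      Real.tendsto_exp_atTop.comp (tendsto_id.const_mul_atTop (by linarith : 0 < T - β))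
    simpa [sub_eq_add_neg] using
      (h₁.const_mul_atTop hk).atTop_add ((tendsto_const_div_atTop K).neg)
  refine tendsto_atTop_mono' _ ?_ hlim
  filter_upwards [hI] with τ h
  have e₁ : Real.exp ((T - β) * τ) = Real.exp (τ * T) * Real.exp (-(τ * β)) := by
    rw [← Real.exp_add]
    ring_nf
  have e₂ : Real.exp (τ * T) * Real.exp (-τ * T) = 1 := by
    rw [← Real.exp_add]
    ring_nf
    exact Real.exp_zero
  have h₁ := mul_le_mul_of_nonneg_left h (Real.exp_pos (τ * T)).le
  rw [e₁]
  have h₂ : Real.exp (τ * T) * (I τ + Real.exp (-τ * T) * (K / τ))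
      = Real.exp (τ * T) * I τ + K / τ := by linear_combination (K / τ) * e₂
  linarith

/-- Since `β < T`, the error is eventually below `(k/2) e^{-τβ}` and can be absorbed. -/
theorem exists_mul_exp_le {I : ℝ → ℝ} {T K k β : ℝ} (hβ : β < T) (hk : 0 < k)
    (hI : ∀ᶠ τ : ℝ in atTop, k * Real.exp (-(τ * β)) ≤ I τ + Real.exp (-τ * T) * (K / τ)) :
    ∀ᶠ τ : ℝ in atTop, k / 2 * Real.exp (-(τ * β)) ≤ I τ := by
  have hlim : Tendsto (fun τ : ℝ => Real.exp (-((T - β) * τ)) * (K / τ)) atTop (𝓝 0) := by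
    have h₁ : Tendsto (fun τ : ℝ => Real.exp (-((T - β) * τ))) atTop (𝓝 0) :=
      Real.tendsto_exp_neg_atTop_nhds_zero.comp
        (tendsto_id.const_mul_atTop (by linarith : 0 < T - β))
    simpa using h₁.mul (tendsto_const_div_atTop K)
  filter_upwards [hI, hlim.eventually (gt_mem_nhds (by linarith : 0 < k / 2))] with τ h₁ h₂
  have e₁ : Real.exp (-τ * T) = Real.exp (-((T - β) * τ)) * Real.exp (-(τ * β)) := by
    rw [← Real.exp_add]
    ring_nf
  have h₃ := mul_lt_mul_of_pos_right h₂ (Real.exp_pos (-(τ * β)))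
  rw [e₁] at h₁
  linarith

end Enclosure

end

/-! ### Conclusion: energy bounds turned into asymptotics of the indicator function -/

theorem mainTheorem1
    (γ : E3 → Matrix (Fin 3) (Fin 3) ℝ) (hγ : IsCoefficient γ)
    (D B : Set E3)
    (hD_ne : D.Nonempty) (hD_bdd : Bornology.IsBounded D) (hD_conn : IsConnected Dᶜ)
    (hγ_out : ∀ᵐ x : E3, x ∉ D → γ x = 1)
    (hM : MonotonePlus γ D ∨ MonotoneMinus γ D)
    (hB_ne : B.Nonempty) (hB_open : IsOpen B) (hBD : closure B ∩ closure D = ∅)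
    (hreg : (HasC1Boundary D ∧ ConeCondition B) ∨
      (ConeCondition D ∧ ConeCondition B ∧ Convex ℝ B))
    (f : L2) (hf : EmissionCondition B f)
    (T : ℝ) (hT : 0 < T)
    (u : ℝ → H1) (hu : IsWeakWaveSolution γ T f u)
    (v : ℝ → H1) (hv : ∀ τ : ℝ, 1 ≤ τ → IsReducedSolution (fun _ => 1) τ f (v τ)) :
    (T < 2 * setDist D B →
      Tendsto (fun τ : ℝ => Real.exp (τ * T) * indicatorFn T f u v τ) atTop (𝓝 0)) ∧
    (2 * setDist D B < T → MonotonePlus γ D →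
      Tendsto (fun τ : ℝ => Real.exp (τ * T) * indicatorFn T f u v τ) atTop atBot) ∧
    (2 * setDist D B < T → MonotoneMinus γ D →
      Tendsto (fun τ : ℝ => Real.exp (τ * T) * indicatorFn T f u v τ) atTop atTop) ∧
    (2 * setDist D B < T →
      Tendsto (fun τ : ℝ => 1 / τ * Real.log |indicatorFn T f u v τ|) atTop
        (𝓝 (-(2 * setDist D B)))) := by
  set I := indicatorFn T f u v with hI
  have hfr : frontier D ⊆ closure (interior D) := by
    rcases hreg with h | h
    · exact h.1.frontier_subset
    · exact h.1.frontier_subset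
  have hB0 : volume (frontier B) = 0 := by
    rcases hreg with h | h
    · exact h.2.volume_frontier hB_open
    · exact h.2.1.volume_frontier hB_open
  obtain ⟨K, hK⟩ := exists_indicator_bound hγ hT hu hv
  have hupper : ∀ β < 2 * setDist D B, ∃ C : ℝ, 0 ≤ C ∧ ∀ τ : ℝ, 1 ≤ τ →
      |I τ| ≤ C * Real.exp (-(τ * β)) + Real.exp (-τ * T) * (K / τ) := by
    intro β hβ
    obtain ⟨C, hC, hCle⟩ := exists_energy_le_exp hD_bdd hf.1 hv hβ
    obtain ⟨c, hc, hell⟩ := hγ.elliptic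
    obtain ⟨M, hM0, hMle⟩ := hγ.exists_bound
    -- Truncation at `1` makes `1 - 1/c'` nonpositive, so the inequalities in `hK` with `S = closure
    -- D` turn into upper bounds for `|I τ|`. The same holds for `1 - M'` below, where `9 M` bounds
    -- the quadratic form of a `3 × 3` matrix with entries at most `M`.
    set c' := min c 1 with hc'
    have hc'0 : 0 < c' := lt_min hc one_pos
    have hc'1 : c' ≤ 1 := min_le_right _ _
    set M' := max (9 * M) 1 with hM'
    have h1M' : 1 ≤ M' := le_max_right _ _
    have b₁ := indicator_le_of_lower_bound hγ_out hc'0 (S := closure D) (by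
      filter_upwards [hell] with x hx _ ξ
      exact (mul_le_mul_of_nonneg_right (min_le_left _ _) (sq_nonneg _)).trans (hx ξ))
      (Or.inr ⟨subset_closure, hc'1⟩)
    have b₂ := indicator_le_of_upper_bound hγ_out (c := M') (S := closure D) (by
      filter_upwards [hMle] with x hx _ ξ
      refine (le_of_abs_le (abs_mulVec_dotProduct_le hx ξ ξ)).trans ?_
      rw [← sq]
      exact mul_le_mul_of_nonneg_right (le_max_left _ _) (sq_nonneg _))
      (Or.inr ⟨subset_closure, h1M'⟩)
    have hk₁ : 0 ≤ 1 / c' - 1 := by rw [sub_nonneg, one_le_div hc'0]; exact hc'1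
    have hk₂ : 0 ≤ M' - 1 := by linarith
    refine ⟨((1 / c' - 1) + (M' - 1)) * C, by positivity, fun τ hτ => ?_⟩
    have l := hK τ hτ (closure D)
    have l₁ := (l _ isClosed_closure.measurableSet).1 b₁
    have l₂ := (l _ isClosed_closure.measurableSet).2 b₂
    have hA := hCle τ hτ
    have hCe : 0 ≤ C * Real.exp (-(τ * β)) := by positivity
    have m₁ := mul_le_mul_of_nonneg_left hA hk₁
    have m₂ := mul_le_mul_of_nonneg_left hA hk₂
    have m₃ := mul_nonneg hk₁ hCe
    have m₄ := mul_nonneg hk₂ hCe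
    rw [abs_le]
    constructor <;> linarith
  have hplus : MonotonePlus γ D → ∀ β, 2 * setDist D B < β → ∃ k : ℝ, 0 < k ∧
      ∀ᶠ τ : ℝ in atTop, k * Real.exp (-(τ * β)) ≤ -I τ + Real.exp (-τ * T) * (K / τ) := by
    rintro ⟨c, hc, hcD⟩ β hβ
    obtain ⟨S, hSD, hS, hev⟩ := exists_exp_le_energy hD_ne hB_ne hB_open hBD hfr hB0 hf hv hβ
    have hk : 0 < 1 - 1 / c := by rw [sub_pos, div_lt_one (by linarith)]; exact hc
    refine ⟨1 - 1 / c, hk, ?_⟩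
    filter_upwards [hev, eventually_ge_atTop 1] with τ h₁ h₂
    exact (mul_le_mul_of_nonneg_left h₁ hk.le).trans ((hK τ h₂ S _ hS).1
      (indicator_le_of_lower_bound hγ_out (by linarith) hcD (Or.inl ⟨hSD, hc.le⟩)))
  have hminus : MonotoneMinus γ D → ∀ β, 2 * setDist D B < β → ∃ k : ℝ, 0 < k ∧
      ∀ᶠ τ : ℝ in atTop, k * Real.exp (-(τ * β)) ≤ I τ + Real.exp (-τ * T) * (K / τ) := by
    rintro ⟨c, hc, hcD⟩ β hβ
    obtain ⟨S, hSD, hS, hev⟩ := exists_exp_le_energy hD_ne hB_ne hB_open hBD hfr hB0 hf hv hβ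
    have hk : 0 < 1 - c := by linarith
    refine ⟨1 - c, hk, ?_⟩
    filter_upwards [hev, eventually_ge_atTop 1] with τ h₁ h₂
    exact (mul_le_mul_of_nonneg_left h₁ hk.le).trans ((hK τ h₂ S _ hS).2
      (indicator_le_of_upper_bound hγ_out hcD (Or.inl ⟨hSD, hc.le⟩)))
  refine ⟨fun hlt => ?_, fun hlt hMp => ?_, fun hlt hMm => ?_, fun hlt => ?_⟩
  · obtain ⟨β, hβ, hβ'⟩ := exists_between hlt
    obtain ⟨C, -, hC⟩ := hupper β hβ'
    exact tendsto_exp_mul_zero hβ hC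
  · obtain ⟨β, hβ, hβ'⟩ := exists_between hlt
    obtain ⟨k, hk, hev⟩ := hplus hMp β hβ
    have := tendsto_neg_atTop_atBot.comp (tendsto_exp_mul_atTop (I := fun τ => -I τ) hβ' hk hev)
    refine this.congr fun τ => ?_
    simp
  · obtain ⟨β, hβ, hβ'⟩ := exists_between hlt
    obtain ⟨k, hk, hev⟩ := hminus hMm β hβ
    exact tendsto_exp_mul_atTop hβ' hk hev
  · refine tendsto_log_abs_div hlt (fun β hβ => ?_) (fun β hβ hβT => ?_)
    · obtain ⟨C, hC, hCle⟩ := hupper β hβ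
      -- As `β < 2 dist(D,B) < T`, the error is at most `|K| e^{-τβ}`; the `1` only ensures
      -- positivity.
      refine ⟨C + |K| + 1, by positivity, ?_⟩
      filter_upwards [eventually_ge_atTop 1] with τ hτ
      refine (hCle τ hτ).trans ?_
      have h₁ : Real.exp (-τ * T) ≤ Real.exp (-(τ * β)) := Real.exp_le_exp.2 (by nlinarith)
      have h₂ : K / τ ≤ |K| := (div_le_div_of_nonneg_right (le_abs_self K) (by linarith)).trans
        (div_le_self (abs_nonneg _) hτ)
      have h₃ : Real.exp (-τ * T) * (K / τ) ≤ Real.exp (-(τ * β)) * |K| :=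
        (mul_le_mul_of_nonneg_left h₂ (Real.exp_pos _).le).trans
          (mul_le_mul_of_nonneg_right h₁ (abs_nonneg _))
      linarith [Real.exp_pos (-(τ * β))]
    · rcases hM with h | h
      · obtain ⟨k, hk, hev⟩ := hplus h β hβ
        refine ⟨k / 2, by linarith, ?_⟩
        filter_upwards [exists_mul_exp_le (I := fun τ => -I τ) hβT hk hev] with τ hτ
        exact hτ.trans (neg_le_abs _)
      · obtain ⟨k, hk, hev⟩ := hminus h β hβ
        refine ⟨k / 2, by linarith, ?_⟩
        filter_upwards [exists_mul_exp_le hβT hk hev] with τ hτ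
        exact hτ.trans (le_abs_self _)
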